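/- Let $L$ be a complex separable Hilbert space with inner product $\{\cdot,\cdot\}$ (conjugate linear in the first argument), $\mathcal T(L)$ its trace class operators, and $\Xi(L)$ the space of real linear maps $\Lambda:L\to L$ with $\{\xi,\Lambda\tau\}=-\{\tau,\Lambda\xi\}$ for all $\xi,\tau\in L$ (so $\Lambda$ is conjugate linear) such that $\Lambda^2$ is trace class. Let $\mathcal F$ be the fermionic Fock space over $L$, with vacuum $\psi_0$ and annihilation operators $a_\xi$, complex linear in $\xi\in L$, satisfying $a_\xi\psi_0=0$, $a_\xi a_\tau+a_\tau a_\xi=0$, $a_\xi^\dagger a_\tau+a_\tau a_\xi^\dagger=\{\xi,\tau\}\mathbf 1$. For an orthonormal basis $(\zeta_i)$ of $L$, $\lambda\in\mathcal T(L)$, $\Lambda\in\Xi(L)$, $\xi\in L$ put $$\hat\lambda=\tfrac12\sum_i\big(a_{\zeta_i}^\dagger a_{\lambda\zeta_i}-a_{\lambda\zeta_i}a_{\zeta_i}^\dagger\big),\quad \hat\Lambda=\tfrac12\sum_i a_{\zeta_i}a_{\Lambda\zeta_i},\quad \hat\Lambda^\dagger=\tfrac12\sum_i a_{\Lambda\zeta_i}^\dagger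 a_{\zeta_i}^\dagger,\quad \hat\xi=\tfrac1{\sqrt2}a_\xi,\quad \hat\xi^\dagger=\tfrac1{\sqrt2}a_\xi^\dagger .$$ The complexified dynamical Lie algebra $\mathfrak g^{\mathbb C}$ consists of all sums $\hat\lambda+\hat\Lambda_1^\dagger+\hat\Lambda_2+\hat\xi_1^\dagger+\hat\xi_2$. If $\dim L=\infty$ its elements may be unbounded; products of exponentials $e^X=\sum_k X^k/k!$, $X\in\mathfrak g^{\mathbb C}$, are then understood as operators on the dense subspace $\mathcal D\subset\mathcal F$ of vectors with finitely many particles, where the series converge. Let $G^{\mathbb C}$ be the set of invertible bounded operators $T$ on $\mathcal F$ such that for every $\epsilon>0$ there is a finite product $S$ of such exponentials with $\|S\psi-T\psi\|\le\epsilon\|\psi\|$ for all $\psi\in\mathcal D$, and let $G$ be the set of unitary elements of $G^{\mathbb C}$. An operator $g$ on $\mathcal D$ is said to be in $G$ if it is the restriction to $\mathcal D$ of an element of $G$. Let $r,s\in\mathcal T(L)$ with $r^*=r$, $s^*=-s$, let $\Lambda,\Lambda'\in\Xi(L)$ and $\xi,\xi'\in L$. Then: (a) There is a unique $\mu\in\mathcal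 T(L)$ such that $-\mu$ is positive and $e^{-\mu}=\mathbf 1-\Lambda^2$. Put $b=\{\xi,e^\mu\xi\}$. (b) There is a unique $\beta\in\mathcal T(L)$ such that $-\beta$ is positive with respect to the inner product $\{\cdot,e^\mu\,\cdot\}$ (that is, $-e^\mu\beta$ is a positive operator) and $e^{-\frac12\beta}=\mathbf 1+\frac12\,\xi\{e^\mu\xi,\cdot\}$. (c) $\nu:=\frac12e^\mu\Lambda\xi\{\xi,\cdot\}$ is trace class, and $$g:=e^{\hat\Lambda^\dagger+\hat\xi^\dagger}\,e^{\hat r}\,e^{\hat s}\,e^{\hat\Lambda'+\hat\xi'}$$ is in $G$ if and only if the following three conditions hold: $$e^{-2\hat r}=e^{\hat\nu^\dagger}e^{\hat\beta}e^{\hat\mu}e^{\hat\nu},$$ $$\Lambda'=-e^se^r\Big(e^\mu\Lambda-(2+b)^{-1}\big(e^\mu\Lambda\xi\,\{\cdot,e^\mu\xi\}-e^\mu\xi\,\{\cdot,e^\mu\Lambda\xi\}\big)\Big)e^re^{-s},$$ $$\xi'=-2(2+b)^{-1}e^se^r(\mathbf 1-\Lambda)e^\mu\xi .$$ -/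

import Mathlib

noncomputable section
namespace FermiFock

variable {ι : Type*} [LinearOrder ι]

/-- The fermionic Fock space in its occupation number representation: `ℓ²` of the finite subsets of
the index set `ι` of an orthonormal basis `ζ` of the one-particle space. The basis vector at
`S = {i₁ < ... < iₖ}` is `a†(ζ i₁) ... a†(ζ iₖ) ψ₀`, and `ψ₀` is the basis vector at `∅`. -/
abbrev Fock (ι : Type*) : Type _ := lp (fun _ : Finset ι => ℂ) 2

/-- The sign `(-1) ^ #{j ∈ S | j < i}` picked up when `i` is moved to its place in `S`. -/
def sgn (i : ι) (S : Finset ι) : ℂ := (-1) ^ (S.filter (· < i)).card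

/-- The involution `S ↦ S ∆ {i}`; only used to prove boundedness. -/
def toggle (i : ι) : Equiv.Perm (Finset ι) :=
  Function.Involutive.toPerm (fun S => if i ∈ S then S.erase i else insert i S) (by
    intro S
    by_cases h : i ∈ S <;> simp [h])

theorem norm_sgn (i : ι) (S : Finset ι) : ‖sgn i S‖ = 1 := by simp [sgn]

/-- Removal of a particle in the mode `i`, on coefficient functions. -/
def modeFun (i : ι) (f : Finset ι → ℂ) : Finset ι → ℂ :=
  fun S => if i ∈ S then 0 else sgn i S * f (insert i S)

theorem norm_modeFun_le (i : ι) (f : Finset ι → ℂ) (S : Finset ι) :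
    ‖modeFun i f S‖ ≤ ‖f (toggle i S)‖ := by
  by_cases h : i ∈ S
  · simp [modeFun, h]
  · have : toggle i S = insert i S := by simp [toggle, Function.Involutive.toPerm, h]
    simp [modeFun, h, norm_sgn, this]

theorem summable_toggle (i : ι) (f : Fock ι) :
    Summable fun S => ‖(f : Finset ι → ℂ) (toggle i S)‖ ^ (2 : ENNReal).toReal := by
  have h : Summable fun S => ‖(f : Finset ι → ℂ) S‖ ^ (2 : ENNReal).toReal :=
    (lp.memℓp f).summable (by norm_num)
  exact h.comp_injective (toggle i).injective

theorem rpow_modeFun_le (i : ι) (f : Finset ι → ℂ) (S : Finset ι) :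
    ‖modeFun i f S‖ ^ (2 : ENNReal).toReal ≤ ‖f (toggle i S)‖ ^ (2 : ENNReal).toReal :=
  Real.rpow_le_rpow (norm_nonneg _) (norm_modeFun_le i f S) (by norm_num)

theorem memℓp_modeFun (i : ι) (f : Fock ι) : Memℓp (modeFun i f) 2 :=
  memℓp_gen (Summable.of_nonneg_of_le (fun _ => by positivity) (rpow_modeFun_le i f)
    (summable_toggle i f))

theorem norm_mode_le (i : ι) (f : Fock ι) :
    ‖(⟨modeFun i f, memℓp_modeFun i f⟩ : Fock ι)‖ ≤ ‖f‖ := by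
  rw [lp.norm_eq_tsum_rpow (by norm_num), lp.norm_eq_tsum_rpow (by norm_num)]
  refine Real.rpow_le_rpow (tsum_nonneg fun _ => by positivity) ?_ (by norm_num)
  rw [← (toggle i).tsum_eq (fun S => ‖(f : Finset ι → ℂ) S‖ ^ (2 : ENNReal).toReal)]
  exact Summable.tsum_le_tsum (rpow_modeFun_le i f)
    ((memℓp_modeFun i f).summable (by norm_num)) (summable_toggle i f)

/-- Removal of a particle in the mode `i`, as a linear map of the Fock space. -/
def modeLin (i : ι) : Fock ι →ₗ[ℂ] Fock ι where
  toFun f := ⟨modeFun i f, memℓp_modeFun i f⟩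
  map_add' f g := by
    refine Subtype.ext (funext fun S => ?_)
    change modeFun i (f + g : Fock ι) S = modeFun i f S + modeFun i g S
    by_cases h : i ∈ S <;> simp [modeFun, h, mul_add]
  map_smul' c f := by
    refine Subtype.ext (funext fun S => ?_)
    change modeFun i (c • f : Fock ι) S = c * modeFun i f S
    by_cases h : i ∈ S <;> simp [modeFun, h, mul_left_comm]

/-- The annihilation operator of the mode `i`, a bounded operator on the Fock space. -/
def modeAnnih (i : ι) : Fock ι →L[ℂ] Fock ι :=
  (modeLin i).mkContinuous 1 (fun f => by rw [one_mul]; exact norm_mode_le i f)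

theorem modeAnnih_apply (i : ι) (f : Fock ι) (S : Finset ι) :
    (modeAnnih i f : Finset ι → ℂ) S = if i ∈ S then 0 else sgn i S * f (insert i S) := rfl

theorem sgn_mul_self (i : ι) (S : Finset ι) : sgn i S * sgn i S = 1 := by
  simp [sgn, ← mul_pow]

theorem sgn_insert (i j : ι) (S : Finset ι) (hj : j ∉ S) :
    sgn i (insert j S) = (if j < i then -1 else 1) * sgn i S := by
  by_cases h : j < i
  · simp [sgn, Finset.filter_insert, h, Finset.card_insert_of_notMem, hj, pow_succ]
  · simp [sgn, Finset.filter_insert, h]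

theorem sgn_erase (i j : ι) (S : Finset ι) (hj : j ∈ S) :
    sgn i (S.erase j) = (if j < i then -1 else 1) * sgn i S := by
  have h := sgn_insert i j (S.erase j) (Finset.notMem_erase j S)
  rw [Finset.insert_erase hj] at h
  rw [h, ← mul_assoc]
  split_ifs <;> simp

theorem modeAnnih_single (i : ι) (S : Finset ι) :
    modeAnnih i (lp.single 2 S (1 : ℂ)) =
      if i ∈ S then sgn i S • (lp.single 2 (S.erase i) (1 : ℂ) : Fock ι) else 0 := by
  refine Subtype.ext (funext fun T => ?_)
  rw [modeAnnih_apply]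
  by_cases hS : i ∈ S
  · by_cases hT : i ∈ T
    · have : T ≠ S.erase i := fun h => by simp [h] at hT
      simp [hS, hT, this]
    · by_cases h : insert i T = S
      · subst h
        simp [hT, sgn_insert]
      · have : T ≠ S.erase i := fun h' => h (by rw [h', Finset.insert_erase hS])
        simp [hS, hT, this, h]
  · by_cases hT : i ∈ T
    · simp [hS, hT]
    · have : insert i T ≠ S := fun h => hS (h ▸ Finset.mem_insert_self i T)
      simp [hS, hT, this]

theorem modeCreate_apply (i : ι) (f : Fock ι) (S : Finset ι) :
    ((modeAnnih i).adjoint f : Finset ι → ℂ) S = if i ∈ S then sgn i S * f (S.erase i) else 0 := by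
  have h1 : inner ℂ (lp.single 2 S (1 : ℂ) : Fock ι) ((modeAnnih i).adjoint f)
      = ((modeAnnih i).adjoint f : Finset ι → ℂ) S := by
    rw [lp.inner_single_left]; simp
  rw [← h1, ContinuousLinearMap.adjoint_inner_right, modeAnnih_single]
  have hs : (starRingEnd ℂ) (sgn i S) = sgn i S := by simp [sgn]
  by_cases hS : i ∈ S
  · simp only [hS, if_true]
    rw [inner_smul_left, lp.inner_single_left, hs]
    simp
  · simp [hS]

theorem modeAnnih_anticomm (i j : ι) :
    modeAnnih i * modeAnnih j + modeAnnih j * modeAnnih i = 0 := by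
  refine ContinuousLinearMap.ext fun f => Subtype.ext (funext fun S => ?_)
  change (modeAnnih i (modeAnnih j f) : Finset ι → ℂ) S
    + (modeAnnih j (modeAnnih i f) : Finset ι → ℂ) S = 0
  simp only [modeAnnih_apply]
  rcases lt_trichotomy i j with h | h | h
  · by_cases hi : i ∈ S <;> by_cases hj : j ∈ S <;>
      simp [hi, hj, sgn_insert, h, h.ne, h.ne', h.not_gt, Finset.insert_comm i j S]
    ring
  · subst h
    simp
  · by_cases hi : i ∈ S <;> by_cases hj : j ∈ S <;>
      simp [hi, hj, sgn_insert, h, h.ne, h.ne', h.not_gt, Finset.insert_comm i j S]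
    ring

theorem modeAnnih_create_anticomm (i j : ι) :
    (modeAnnih i).adjoint * modeAnnih j + modeAnnih j * (modeAnnih i).adjoint =
      (if i = j then 1 else 0 : Fock ι →L[ℂ] Fock ι) := by
  refine ContinuousLinearMap.ext fun f => Subtype.ext (funext fun S => ?_)
  change ((modeAnnih i).adjoint (modeAnnih j f) : Finset ι → ℂ) S
    + (modeAnnih j ((modeAnnih i).adjoint f) : Finset ι → ℂ) S = _
  simp only [modeAnnih_apply, modeCreate_apply]
  rcases lt_trichotomy i j with h | h | h
  · by_cases hi : i ∈ S <;> by_cases hj : j ∈ S <;>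
      simp [hi, hj, sgn_insert, sgn_erase, h, h.ne, h.ne', h.not_gt,
        Finset.erase_insert_of_ne h.ne']
    ring
  · subst h
    by_cases hi : i ∈ S
    · simp [hi, sgn_erase, ← mul_assoc, sgn_mul_self]
    · simp [hi, sgn_insert, ← mul_assoc, sgn_mul_self]
  · by_cases hi : i ∈ S <;> by_cases hj : j ∈ S <;>
      simp [hi, hj, sgn_insert, sgn_erase, h, h.ne, h.ne', h.not_gt,
        Finset.erase_insert_of_ne h.ne]
    ring

theorem finsetSum_create_anticomm (t : Finset ι) (c d : ι → ℂ) :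
    (∑ i ∈ t, c i • modeAnnih i).adjoint * (∑ j ∈ t, d j • modeAnnih j)
      + (∑ j ∈ t, d j • modeAnnih j) * (∑ i ∈ t, c i • modeAnnih i).adjoint
      = (∑ i ∈ t, starRingEnd ℂ (c i) * d i) • (1 : Fock ι →L[ℂ] Fock ι) := by
  have hadj : (∑ i ∈ t, c i • modeAnnih i).adjoint
      = ∑ i ∈ t, starRingEnd ℂ (c i) • (modeAnnih i).adjoint := by
    rw [map_sum]
    exact Finset.sum_congr rfl fun i _ => map_smulₛₗ _ _ _
  rw [hadj, Finset.sum_mul_sum, Finset.sum_mul_sum, Finset.sum_comm (s := t) (t := t),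
    ← Finset.sum_add_distrib, Finset.sum_smul]
  refine Finset.sum_congr rfl fun j hj => ?_
  rw [← Finset.sum_add_distrib]
  have : ∀ i ∈ t, starRingEnd ℂ (c i) • (modeAnnih i).adjoint * d j • modeAnnih j
      + d j • modeAnnih j * starRingEnd ℂ (c i) • (modeAnnih i).adjoint
      = if i = j then (starRingEnd ℂ (c i) * d j) • (1 : Fock ι →L[ℂ] Fock ι) else 0 := by
    intro i _
    rw [smul_mul_smul_comm, smul_mul_smul_comm, mul_comm (d j), ← smul_add,
      modeAnnih_create_anticomm]
    split_ifs <;> simp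
  rw [Finset.sum_congr rfl this, Finset.sum_ite_eq' t j, if_pos hj]

theorem norm_finsetSum_le (t : Finset ι) (c : ι → ℂ) :
    ‖∑ i ∈ t, c i • modeAnnih i‖ ^ 2 ≤ ∑ i ∈ t, ‖c i‖ ^ 2 := by
  set A := ∑ i ∈ t, c i • modeAnnih i with hA
  have h0 : 0 ≤ ∑ i ∈ t, ‖c i‖ ^ 2 := Finset.sum_nonneg fun _ _ => by positivity
  have key : ∀ f, ‖A f‖ ≤ Real.sqrt (∑ i ∈ t, ‖c i‖ ^ 2) * ‖f‖ := by
    intro f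
    have h := congrArg (fun T : Fock ι →L[ℂ] Fock ι => inner ℂ f (T f))
      (finsetSum_create_anticomm t c c)
    simp only [← hA, add_apply, mul_apply_eq_comp, inner_add_right,
      ContinuousLinearMap.adjoint_inner_right, smul_apply,
      one_apply_eq_self, inner_smul_right] at h
    rw [← ContinuousLinearMap.adjoint_inner_left A (A.adjoint f) f] at h
    simp only [inner_self_eq_norm_sq_to_K, Complex.conj_mul'] at h
    have h' : ‖A f‖ ^ 2 + ‖A.adjoint f‖ ^ 2 = (∑ i ∈ t, ‖c i‖ ^ 2) * ‖f‖ ^ 2 := by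
      apply Complex.ofReal_injective
      simpa using h
    refine abs_le_of_sq_le_sq' ?_ (by positivity) |>.2
    rw [mul_pow, Real.sq_sqrt h0]
    nlinarith [sq_nonneg ‖A.adjoint f‖]
  have := A.opNorm_le_bound (Real.sqrt_nonneg _) key
  calc ‖A‖ ^ 2 ≤ Real.sqrt (∑ i ∈ t, ‖c i‖ ^ 2) ^ 2 := by gcongr
    _ = _ := Real.sq_sqrt h0

variable {L : Type*} [NormedAddCommGroup L] [InnerProductSpace ℂ L]

/-- The annihilation operator `a_ξ`, complex linear in `ξ`. The sum converges in operator norm, see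
`hasSum_annih`; the canonical anticommutation relations are `annih_anticomm` and
`annih_create_anticomm`. -/
def annih (ζ : HilbertBasis ι ℂ L) (ξ : L) : Fock ι →L[ℂ] Fock ι :=
  ∑' i, inner ℂ (ζ i) ξ • modeAnnih i

theorem hasSum_annih (ζ : HilbertBasis ι ℂ L) (ξ : L) :
    HasSum (fun i => inner ℂ (ζ i) ξ • modeAnnih i) (annih ζ ξ) := by
  refine Summable.hasSum (summable_iff_vanishing_norm.2 fun ε hε => ?_)
  have hs : Summable fun i => ‖inner ℂ (ζ i) ξ‖ ^ 2 := ζ.orthonormal.inner_products_summable ξ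
  obtain ⟨s, hs⟩ := summable_iff_vanishing_norm.1 hs (ε ^ 2) (by positivity)
  refine ⟨s, fun t ht => ?_⟩
  have h1 := norm_finsetSum_le t fun i => inner ℂ (ζ i) ξ
  have h2 := (le_abs_self _).trans_lt (hs t ht)
  exact lt_of_pow_lt_pow_left₀ 2 hε.le (h1.trans_lt h2)

theorem annih_vacuum (ζ : HilbertBasis ι ℂ L) (ξ : L) :
    annih ζ ξ (lp.single 2 ∅ (1 : ℂ)) = 0 := by
  have h := (hasSum_annih ζ ξ).mapL
    (ContinuousLinearMap.apply ℂ (Fock ι) (lp.single 2 ∅ (1 : ℂ) : Fock ι))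
  refine h.unique ?_
  have h0 : ∀ i, ContinuousLinearMap.apply ℂ (Fock ι) (lp.single 2 ∅ (1 : ℂ) : Fock ι)
      (inner ℂ (ζ i) ξ • modeAnnih i) = 0 := fun i => by
    rw [ContinuousLinearMap.apply_apply, smul_apply, modeAnnih_single]
    simp
  simp only [h0]
  exact hasSum_zero

theorem annih_anticomm (ζ : HilbertBasis ι ℂ L) (ξ τ : L) :
    annih ζ ξ * annih ζ τ + annih ζ τ * annih ζ ξ = 0 := by
  have h : ∀ j, modeAnnih j * annih ζ ξ + annih ζ ξ * modeAnnih j = 0 := fun j => by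
    have h1 := ((hasSum_annih ζ ξ).mul_left (modeAnnih j)).add
      ((hasSum_annih ζ ξ).mul_right (modeAnnih j))
    refine h1.unique ?_
    convert hasSum_zero using 2 with i
    rw [mul_smul_comm, smul_mul_assoc, ← smul_add, modeAnnih_anticomm, smul_zero]
  have h1 := ((hasSum_annih ζ τ).mul_left (annih ζ ξ)).add
    ((hasSum_annih ζ τ).mul_right (annih ζ ξ))
  refine h1.unique ?_
  convert hasSum_zero using 2 with i
  rw [mul_smul_comm, smul_mul_assoc, ← smul_add, add_comm, h, smul_zero]

theorem annih_create_anticomm (ζ : HilbertBasis ι ℂ L) (ξ τ : L) :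
    (annih ζ ξ).adjoint * annih ζ τ + annih ζ τ * (annih ζ ξ).adjoint
      = inner ℂ ξ τ • (1 : Fock ι →L[ℂ] Fock ι) := by
  have h : ∀ i, (modeAnnih i).adjoint * annih ζ τ + annih ζ τ * (modeAnnih i).adjoint
      = inner ℂ (ζ i) τ • (1 : Fock ι →L[ℂ] Fock ι) := fun i => by
    have h1 := ((hasSum_annih ζ τ).mul_left (modeAnnih i).adjoint).add
      ((hasSum_annih ζ τ).mul_right (modeAnnih i).adjoint)
    refine h1.unique (Eq.mpr (congrArg (fun u => HasSum u _) (funext fun j => ?_))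
      (hasSum_ite_eq i (inner ℂ (ζ i) τ • (1 : Fock ι →L[ℂ] Fock ι))))
    rw [mul_smul_comm, smul_mul_assoc, ← smul_add, modeAnnih_create_anticomm]
    by_cases hij : i = j
    · simp [hij]
    · simp [hij, Ne.symm hij]
  have hadj : HasSum (fun i => inner ℂ ξ (ζ i) • (modeAnnih i).adjoint) (annih ζ ξ).adjoint := by
    have := (hasSum_annih ζ ξ).mapL
      (ContinuousLinearMap.adjoint (𝕜 := ℂ) (E := Fock ι) (F := Fock ι)).toContinuousLinearEquiv.toContinuousLinearMap
    simpa using this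
  have h1 := (hadj.mul_right (annih ζ τ)).add (hadj.mul_left (annih ζ τ))
  refine h1.unique (Eq.mpr (congrArg (fun u => HasSum u _) (funext fun i => ?_))
    ((ζ.hasSum_inner_mul_inner ξ τ).smul_const (1 : Fock ι →L[ℂ] Fock ι)))
  rw [mul_smul_comm, smul_mul_assoc, ← smul_add, h, smul_smul]

/-- The creation operator `a†_ξ`, the Hilbert space adjoint of `a_ξ`. -/
def create (ζ : HilbertBasis ι ℂ L) (ξ : L) : Fock ι →L[ℂ] Fock ι :=
  (annih ζ ξ).adjoint

/-- Trace class operators on a Hilbert space, as the operators `∑ₙ ⟨yₙ, ·⟩ xₙ` with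
`∑ₙ ‖xₙ‖ ‖yₙ‖ < ∞`. -/
def IsTraceClass (T : L →L[ℂ] L) : Prop :=
  ∃ x y : ℕ → L, Summable (fun n => ‖x n‖ * ‖y n‖) ∧
    ∀ v, HasSum (fun n => inner ℂ (y n) v • x n) (T v)

/-- The space `Ξ(L)`: real linear maps `Λ` with `⟨ξ, Λ τ⟩ = -⟨τ, Λ ξ⟩` (hence conjugate linear) such
that `Λ²` is a trace class operator. -/
structure IsXi (Λ : L →ₗ[ℝ] L) : Prop where
  antisymm : ∀ ξ τ, inner ℂ ξ (Λ τ) = -inner ℂ τ (Λ ξ)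
  sq_traceClass : ∃ T : L →L[ℂ] L, (∀ v, T v = Λ (Λ v)) ∧ IsTraceClass T

/-- The current operator of a trace class operator `l`, namely
`1/2 ∑ᵢ (a†(ζᵢ) a(l ζᵢ) - a(l ζᵢ) a†(ζᵢ))`. For trace class `l` the sum converges in operator norm. -/
def hatCurrent (ζ : HilbertBasis ι ℂ L) (l : L →L[ℂ] L) : Fock ι →L[ℂ] Fock ι :=
  ∑' i, (1 / 2 : ℂ) •
    (create ζ (ζ i) * annih ζ (l (ζ i)) - annih ζ (l (ζ i)) * create ζ (ζ i))

/-- The operator `Λ^ = 1/2 ∑ᵢ a(ζᵢ) a(Λ ζᵢ)`. It is unbounded for some `Λ` in `Ξ(L)` if `L` is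
infinite-dimensional, and is evaluated vector by vector. The sum converges on every vector whose
`n`-particle components decrease faster than exponentially in `n`. -/
def hatPair (ζ : HilbertBasis ι ℂ L) (Λ : L →ₗ[ℝ] L) (ψ : Fock ι) : Fock ι :=
  (1 / 2 : ℂ) • ∑' i, annih ζ (ζ i) (annih ζ (Λ (ζ i)) ψ)

/-- The operator `Λ^† = 1/2 ∑ᵢ a†(Λ ζᵢ) a†(ζᵢ)`, evaluated vector by vector like `hatPair`. -/
def hatPairDag (ζ : HilbertBasis ι ℂ L) (Λ : L →ₗ[ℝ] L) (ψ : Fock ι) : Fock ι :=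
  (1 / 2 : ℂ) • ∑' i, create ζ (Λ (ζ i)) (create ζ (ζ i) ψ)

/-- The operator `ξ^ = a_ξ / √2`. -/
def hatVec (ζ : HilbertBasis ι ℂ L) (ξ : L) : Fock ι →L[ℂ] Fock ι :=
  ((1 / Real.sqrt 2 : ℝ) : ℂ) • annih ζ ξ

/-- The operator `ξ^† = a†_ξ / √2`. -/
def hatVecDag (ζ : HilbertBasis ι ℂ L) (ξ : L) : Fock ι →L[ℂ] Fock ι :=
  (hatVec ζ ξ).adjoint

/-- The operators of the complexified full dynamical Lie algebra: sums
`l^ + Λ₁^† + Λ₂^ + ξ₁^† + ξ₂^`. -/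
def IsDynLieElement (ζ : HilbertBasis ι ℂ L) (X : Fock ι → Fock ι) : Prop :=
  ∃ (l : L →L[ℂ] L) (Λ₁ Λ₂ : L →ₗ[ℝ] L) (ξ₁ ξ₂ : L), IsTraceClass l ∧ IsXi Λ₁ ∧ IsXi Λ₂ ∧
    X = fun ψ => hatCurrent ζ l ψ + hatPairDag ζ Λ₁ ψ + hatPair ζ Λ₂ ψ
      + hatVecDag ζ ξ₁ ψ + hatVec ζ ξ₂ ψ

/-- The exponential `e^X ψ = ∑ₖ Xᵏ ψ / k!` of an operator of the dynamical Lie algebra. The series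
converges on every vector whose `n`-particle components decrease faster than exponentially in `n`,
and its value is again such a vector. For bounded `X` it is the usual exponential. -/
def expOp (X : Fock ι → Fock ι) (ψ : Fock ι) : Fock ι :=
  ∑' k : ℕ, ((k.factorial : ℂ)⁻¹) • (X^[k] ψ)

/-- The group of finite products of exponentials of elements of the complexified dynamical Lie
algebra. -/
def algGroup (ζ : HilbertBasis ι ℂ L) : Set (Fock ι → Fock ι) :=
  {S | ∃ l : List (Fock ι → Fock ι), (∀ X ∈ l, IsDynLieElement ζ X) ∧
    S = (l.map expOp).foldr (fun A B => A ∘ B) id}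

/-- The dense space of vectors with finitely many particles, on which all products of exponentials
are defined. -/
def finiteParticle (ι : Type*) : Set (Fock ι) :=
  {ψ | ∃ n : ℕ, ∀ S : Finset ι, n < S.card → (ψ : Finset ι → ℂ) S = 0}

/-- The complexified dynamical group: the invertible bounded operators that are operator norm limits
of finite products of exponentials. -/
def dynGroupC (ζ : HilbertBasis ι ℂ L) : Set (Fock ι →L[ℂ] Fock ι) :=
  {T | IsUnit T ∧ ∀ ε : ℝ, 0 < ε →
    ∃ S ∈ algGroup ζ, ∀ ψ ∈ finiteParticle ι, ‖S ψ - T ψ‖ ≤ ε * ‖ψ‖}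

/-- The dynamical group: the unitary elements of the complexified dynamical group. -/
def dynGroup (ζ : HilbertBasis ι ℂ L) : Set (Fock ι →L[ℂ] Fock ι) :=
  dynGroupC ζ ∩ (unitary (Fock ι →L[ℂ] Fock ι) : Set (Fock ι →L[ℂ] Fock ι))

/-- A densely defined operator, given on the vectors with finitely many particles, is (the
restriction of) an element of the dynamical group. -/
def MemDynGroup (ζ : HilbertBasis ι ℂ L) (g : Fock ι → Fock ι) : Prop :=
  ∃ U ∈ dynGroup ζ, ∀ ψ ∈ finiteParticle ι, g ψ = U ψ

/-- The product `e^(Λ^† + ξ^†) e^(r^) e^(s^) e^(Λ'^ + ξ'^)`. -/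
def decProduct (ζ : HilbertBasis ι ℂ L) (Λ : L →ₗ[ℝ] L) (ξ : L) (r s : L →L[ℂ] L)
    (Λ' : L →ₗ[ℝ] L) (ξ' : L) : Fock ι → Fock ι :=
  expOp (fun ψ => hatPairDag ζ Λ ψ + hatVecDag ζ ξ ψ) ∘ expOp (hatCurrent ζ r) ∘
    expOp (hatCurrent ζ s) ∘ expOp (fun ψ => hatPair ζ Λ' ψ + hatVec ζ ξ' ψ)

/-- `μ` is trace class, `-μ` is a positive operator and `e^(-μ) = 1 - Λ²`. -/
structure IsMu (Λ : L →ₗ[ℝ] L) (μ : L →L[ℂ] L) : Prop where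
  traceClass : IsTraceClass μ
  positive : (-μ).IsPositive
  exp_neg : ∀ v, NormedSpace.exp (-μ) v = v - Λ (Λ v)

/-- The number `b = ⟨ξ, e^μ ξ⟩`. -/
def bCoeff (μ : L →L[ℂ] L) (ξ : L) : ℂ := inner ℂ ξ (NormedSpace.exp μ ξ)

/-- `β` is trace class, `-β` is a positive operator for the inner product `⟨·, e^μ ·⟩` and
`e^(-β/2) = 1 + 1/2 ξ ⟨e^μ ξ, ·⟩`. -/
structure IsBeta (μ : L →L[ℂ] L) (ξ : L) (β : L →L[ℂ] L) : Prop where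
  traceClass : IsTraceClass β
  positive : (NormedSpace.exp μ * (-β)).IsPositive
  exp_neg_half : NormedSpace.exp (-((1 / 2 : ℂ) • β)) =
    1 + (1 / 2 : ℂ) • InnerProductSpace.rankOne ℂ ξ (NormedSpace.exp μ ξ)

/-- The operator `ν = 1/2 e^μ Λ ξ ⟨ξ, ·⟩`. -/
def nuOp (Λ : L →ₗ[ℝ] L) (μ : L →L[ℂ] L) (ξ : L) : L →L[ℂ] L :=
  (1 / 2 : ℂ) • InnerProductSpace.rankOne ℂ (NormedSpace.exp μ (Λ ξ)) ξ

/-- The conjugate linear map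
`e^μ Λ - (2 + b)⁻¹ (e^μ Λ ξ ⟨·, e^μ ξ⟩ - e^μ ξ ⟨·, e^μ Λ ξ⟩)`. -/
def omegaMap (Λ : L →ₗ[ℝ] L) (μ : L →L[ℂ] L) (ξ : L) (η : L) : L :=
  NormedSpace.exp μ (Λ η) - (2 + bCoeff μ ξ)⁻¹ •
    (inner ℂ η (NormedSpace.exp μ ξ) • NormedSpace.exp μ (Λ ξ)
      - inner ℂ η (NormedSpace.exp μ (Λ ξ)) • NormedSpace.exp μ ξ)

end FermiFock

end

open FermiFock

/-! Membership of g in the group reduces to preservation of inner products on the vectors with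
finitely many particles (`memDynGroup_decProduct_iff`). Indeed g is itself a finite product of
exponentials, so nothing has to be approximated, and its range is dense by irreducibility of the
anticommutation relations (`IsXi.eq_zero_of_forall_inner_expOp`); an isometry with dense range
extends to a unitary operator.

It remains to compute a Gram matrix. In the inner product of two vectors e^(Λ^† + ξ^†) ψ the
annihilators stand to the left of the creators. Normal ordering turns it into the form E evaluated
on the vectors e^(Ω^ + ω^) ψ, where E = e^(ν^†) e^(β^) e^(μ^) e^(ν^), Ω is `omegaMap` and ω = 2 (2 +
b)⁻¹ (1 - Λ) e^μ ξ (`IsMu.inner_upperExp`). Two polynomial identities carry this step. Without ξ,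
the canonical form of Λ splits it into two-mode pairs whose even algebras commute, and each pair
obeys `pair_identity`. The vector ξ contributes a factor 1 + ξ^†, since ξ^† has square zero, and
`two_mode_identity` orders it.

Now put Q = e^(r^) e^(s^). It implements the maps p = e^r e^(-s) on creation operators and q =
e^(-r) e^(-s) on annihilation operators. Isometry of g says that e^(Ω^ + ω^) Q e^(Λ'^ + ξ'^) is
isometric for the form E. With the vacuum as one of the two vectors, the one- and two-particle
components force ω = -q ξ' and Ω p = -q Λ', which are the conditions on ξ' and Λ'. Once they hold
the product collapses to Q, and Q† E Q = 1 is left. As e^(s^) is unitary and r^ self-adjoint, this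
is e^(-2 r^) = E (`Implements.isometry_iff`, `adjoint_mul_mul_eq_one_iff`).

In infinite dimension pair operators may be unbounded. The annihilating ones preserve each space of
at most N particles and are bounded there, so their exponentials are taken in a Banach algebra. For
e^(Λ^†) the Gram matrices of finite truncations converge, because in normal order every factor does.
Orthogonality of different particle numbers then gives convergence of the series itself
(`IsCanonical.tendsto_exp_truncC`).

The operator μ is diagonal in the canonical form and β is a multiple of a rank one operator.
Uniqueness is injectivity of the exponential on self-adjoint operators, for β after conjugation by
e^(μ/2). -/

noncomputable section
namespace FermiFock
open Filter Topology ContinuousLinearMap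
set_option linter.unusedSectionVars false

/-! ### Exponentials in a complex Banach algebra. -/

section BanachAlgebra

variable {A : Type*} [NormedRing A] [NormedAlgebra ℂ A] [CompleteSpace A]

theorem hasSum_exp (x : A) :
    HasSum (fun n : ℕ => ((n.factorial : ℂ)⁻¹) • x ^ n) (NormedSpace.exp x) :=
  NormedSpace.exp_series_hasSum_exp' (𝕂 := ℂ) x

theorem exp_mul_exp_neg (x : A) : NormedSpace.exp x * NormedSpace.exp (-x) = 1 := by
  let _ : NormedAlgebra ℚ A := NormedAlgebra.restrictScalars ℚ ℂ A
  rw [← NormedSpace.exp_add_of_commute (Commute.neg_right (Commute.refl x)), add_neg_cancel,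
    NormedSpace.exp_zero]

theorem exp_neg_mul_exp (x : A) : NormedSpace.exp (-x) * NormedSpace.exp x = 1 := by
  simpa using exp_mul_exp_neg (-x)

theorem exp_add_of_commute {x y : A} (h : Commute x y) :
    NormedSpace.exp (x + y) = NormedSpace.exp x * NormedSpace.exp y := by
  let _ : NormedAlgebra ℚ A := NormedAlgebra.restrictScalars ℚ ℂ A
  exact NormedSpace.exp_add_of_commute h

theorem tendsto_exp {α : Type*} {l : Filter α} {f : α → A} {a : A} (h : Tendsto f l (𝓝 a)) :
    Tendsto (fun i => NormedSpace.exp (f i)) l (𝓝 (NormedSpace.exp a)) := by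
  let _ : NormedAlgebra ℚ A := NormedAlgebra.restrictScalars ℚ ℂ A
  exact ((NormedSpace.exp_continuous (𝔸 := A)).tendsto a).comp h

theorem commute_exp {x y : A} (h : Commute x y) : Commute (NormedSpace.exp x) (NormedSpace.exp y) := by
  let _ : NormedAlgebra ℚ A := NormedAlgebra.restrictScalars ℚ ℂ A
  exact h.exp

/-- Beyond the constant term the series is the scalar series of e^(c b) times t / b. This evaluates
exponentials of rank one and of number operators. -/
theorem exp_smul_of_mul_self {t : A} {b : ℂ} (h : t * t = b • t) (hb : b ≠ 0) (c : ℂ) :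
    NormedSpace.exp (c • t) = 1 + ((Complex.exp (c * b) - 1) / b) • t := by
  have hp : ∀ n : ℕ, t ^ (n + 1) = b ^ n • t := by
    intro n
    induction n with
    | zero => simp
    | succ n ih => rw [pow_succ, ih, smul_mul_assoc, h, smul_smul, pow_succ]
  have h1 : HasSum (fun n : ℕ => (((n.factorial : ℂ)⁻¹) • (c * b) ^ n) • (b⁻¹ • t))
      (Complex.exp (c * b) • (b⁻¹ • t)) := by
    rw [Complex.exp_eq_exp_ℂ]
    exact (hasSum_exp (c * b)).smul_const _
  have h2 := (hasSum_ite_eq (0 : ℕ) (1 - b⁻¹ • t)).add h1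
  have h3 := hasSum_exp (c • t)
  refine (h3.unique (Eq.mpr (congrArg (fun u => HasSum u _) (funext fun n => ?_)) h2)).trans ?_
  · cases n with
    | zero => simp
    | succ n =>
      rw [smul_pow, hp]
      simp only [smul_smul, Nat.add_eq_zero_iff, one_ne_zero, and_false, if_false, zero_add,
        smul_eq_mul]
      congr 1
      rw [mul_pow, pow_succ b]
      field_simp
  · module

theorem exp_of_mul_self_eq_zero {t : A} (h : t * t = 0) : NormedSpace.exp t = 1 + t := by
  refine (hasSum_exp t).unique ?_
  have := hasSum_sum_of_ne_finset_zero (L := .unconditional ℕ) (f := fun n : ℕ => ((n.factorial : ℂ)⁻¹) • t ^ n)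
    (s := Finset.range 2) (fun n hn => ?_)
  · simpa [Finset.sum_range_succ] using this
  · obtain ⟨k, rfl⟩ := Nat.exists_eq_add_of_le (not_lt.1 (Finset.mem_range.not.1 hn))
    simp [pow_add, pow_two, h]

end BanachAlgebra

/-! ### Exponentials of operators and intertwining relations. -/

section Operators

variable {U V : Type*} [NormedAddCommGroup U] [NormedSpace ℂ U] [CompleteSpace U]
  [NormedAddCommGroup V] [NormedSpace ℂ V] [CompleteSpace V]

theorem hasSum_exp_apply (T : U →L[ℂ] U) (v : U) :
    HasSum (fun n : ℕ => ((n.factorial : ℂ)⁻¹) • (T ^ n) v) (NormedSpace.exp T v) := by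
  simpa using (hasSum_exp T).mapL (ContinuousLinearMap.apply ℂ U v)

theorem exp_apply_of_eigenvector {T : U →L[ℂ] U} {v : U} {c : ℂ} (h : T v = c • v) :
    NormedSpace.exp T v = Complex.exp c • v := by
  have hp : ∀ n : ℕ, (T ^ n) v = c ^ n • v := by
    intro n
    induction n with
    | zero => simp
    | succ n ih => rw [pow_succ', mul_apply_eq_comp, ih, map_smul, h, smul_smul, pow_succ]
  refine (hasSum_exp_apply T v).unique ?_
  rw [Complex.exp_eq_exp_ℂ]
  simpa [hp, smul_smul] using (hasSum_exp c).smul_const v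

theorem exp_apply_mem {T : U →L[ℂ] U} {S : Submodule ℂ U} (hS : IsClosed (S : Set U))
    (h : ∀ v ∈ S, T v ∈ S) {v : U} (hv : v ∈ S) : NormedSpace.exp T v ∈ S := by
  have hp : ∀ n : ℕ, (T ^ n) v ∈ S := by
    intro n
    induction n with
    | zero => simpa
    | succ n ih => rw [pow_succ', mul_apply_eq_comp]; exact h _ ih
  exact hS.mem_of_tendsto (hasSum_exp_apply T v)
    (Eventually.of_forall fun s => S.sum_mem fun n _ => S.smul_mem _ (hp n))

/-- If `l T = T k + y` where `y` intertwines `k` and `l`, then `e^l T = (T + y) e^k`. -/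
theorem exp_comp_of_comp_eq_add {k : U →L[ℂ] U} {l : V →L[ℂ] V} {T y : U →L[ℂ] V}
    (h : ∀ v, l (T v) = T (k v) + y v) (hy : ∀ v, l (y v) = y (k v)) (v : U) :
    NormedSpace.exp l (T v) = T (NormedSpace.exp k v) + y (NormedSpace.exp k v) := by
  have hyn : ∀ (n : ℕ) v, (l ^ n) (y v) = y ((k ^ n) v) := by
    intro n
    induction n with
    | zero => simp
    | succ n ih => intro v; rw [pow_succ, pow_succ, mul_apply_eq_comp, mul_apply_eq_comp, hy, ih]
  -- Each of the n + 1 passages of l across T leaves one y, and all of them equal y k^n because y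
  -- intertwines. Division by (n + 1)! turns n + 1 into 1 / n!.
  have hn : ∀ (n : ℕ) v, (l ^ (n + 1)) (T v) = T ((k ^ (n + 1)) v) + (n + 1 : ℂ) • y ((k ^ n) v) := by
    intro n
    induction n with
    | zero => intro v; simp [h]
    | succ n ih =>
      intro v
      rw [pow_succ, mul_apply_eq_comp, h, map_add, ih, hyn, pow_succ k (n + 1), mul_apply_eq_comp,
        ← mul_apply_eq_comp (k ^ n), ← pow_succ]
      push_cast
      module
  have h1 := (hasSum_exp_apply l (T v))
  have h2 := (hasSum_exp_apply k v).mapL T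
  have h3 := (hasSum_exp_apply k v).mapL y
  have e1 := (hasSum_nat_add_iff' 1).2 h1
  have e2 := ((hasSum_nat_add_iff' 1).2 h2).add h3
  have := e1.unique (Eq.mpr (congrArg (fun u => HasSum u _) (funext fun n => ?_)) e2)
  · simp at this
    rw [sub_eq_iff_eq_add] at this
    rw [this]
    abel
  · rw [hn, map_smul, map_smul, smul_add, smul_smul]
    congr 2
    rw [Nat.factorial_succ]
    push_cast
    have : ((n : ℂ) + 1) ≠ 0 := by exact_mod_cast n.succ_ne_zero
    have h' : (n.factorial : ℂ) ≠ 0 := by exact_mod_cast n.factorial_ne_zero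
    field_simp

theorem exp_comp_of_semiconj {k : U →L[ℂ] U} {l : V →L[ℂ] V} {T : U →L[ℂ] V}
    (h : ∀ v, l (T v) = T (k v)) (v : U) :
    NormedSpace.exp l (T v) = T (NormedSpace.exp k v) := by
  simpa using exp_comp_of_comp_eq_add (y := 0) (by simpa using h) (by simp) v

/-- If `k a(v) - a(v) k = -a(l v)`, then `e^k a(v) = a(e^(-l) v) e^k`. -/
theorem exp_mul_of_commutator {A : Type*} [NormedRing A] [NormedAlgebra ℂ A] [CompleteSpace A]
    (a : U →L[ℂ] A) (l : U →L[ℂ] U) (k : A) (h : ∀ v, k * a v - a v * k = -a (l v)) (v : U) :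
    NormedSpace.exp k * a v = a (NormedSpace.exp (-l) v) * NormedSpace.exp k := by
  -- The hypothesis says that `a` intertwines -l with x ↦ k x - x k. That map is the sum of two
  -- commuting operators, left multiplication by k and right multiplication by -k, so its
  -- exponential is x ↦ e^k x e^(-k).
  set Lk := ContinuousLinearMap.mul ℂ A k
  set Rk := (ContinuousLinearMap.mul ℂ A).flip (-k)
  have hL : ∀ x, NormedSpace.exp Lk x = NormedSpace.exp k * x := fun x => by
    have hp : ∀ n : ℕ, (Lk ^ n) x = k ^ n * x := by
      intro n
      induction n with
      | zero => simp
      | succ n ih =>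
        rw [pow_succ', mul_apply_eq_comp, ih, pow_succ', mul_assoc]; rfl
    refine (hasSum_exp_apply Lk x).unique ?_
    simpa [hp] using (hasSum_exp k).mul_right x
  have hR : ∀ x, NormedSpace.exp Rk x = x * NormedSpace.exp (-k) := fun x => by
    have hp : ∀ n : ℕ, (Rk ^ n) x = x * (-k) ^ n := by
      intro n
      induction n with
      | zero => simp
      | succ n ih =>
        rw [pow_succ', mul_apply_eq_comp, ih, pow_succ, ← mul_assoc]; rfl
    refine (hasSum_exp_apply Rk x).unique ?_
    simpa [hp] using (hasSum_exp (-k)).mul_left x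
  have hc : Commute Lk Rk := by
    ext x
    simp [Lk, Rk, mul_assoc]
  have h1 := exp_comp_of_semiconj (k := -l) (l := Lk + Rk) (T := a) (fun v => by
    simp only [Lk, Rk, add_apply, mul_apply', flip_apply, neg_apply, map_neg]
    rw [← h v, sub_eq_add_neg]) v
  rw [exp_add_of_commute hc, mul_apply_eq_comp, hR, hL] at h1
  rw [← h1, mul_assoc, mul_assoc, exp_neg_mul_exp, mul_one]

end Operators

/-! ### The exponential series evaluated on vectors. -/

section ExpOp

variable {ι : Type*} {E : Type*} [NormedAddCommGroup E] [NormedSpace ℂ E] [CompleteSpace E]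

/-- With j the inclusion of the vectors of bounded particle number, this replaces the exponential of
an unbounded operator by that of a bounded one. -/
theorem expOp_of_semiconj {j : E →L[ℂ] Fock ι} {Y : Fock ι → Fock ι} {T : E →L[ℂ] E}
    (h : ∀ v, Y (j v) = j (T v)) (v : E) : expOp Y (j v) = j (NormedSpace.exp T v) := by
  have hp : ∀ (n : ℕ) (v : E), Y^[n] (j v) = j ((T ^ n) v) := by
    intro n
    induction n with
    | zero => intro v; rfl
    | succ n ih =>
      intro v
      rw [Function.iterate_succ_apply, h, ih, pow_succ, mul_apply_eq_comp]
  refine HasSum.tsum_eq (Eq.mpr (congrArg (fun u => HasSum u _) (funext fun n => ?_))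
    ((hasSum_exp_apply T v).mapL j))
  rw [hp, map_smul]

theorem expOp_clm (T : Fock ι →L[ℂ] Fock ι) (v : Fock ι) :
    expOp T v = NormedSpace.exp T v :=
  expOp_of_semiconj (j := .id ℂ (Fock ι)) (T := T) (fun _ => rfl) v

end ExpOp

/-! ### Anticommutation relations and norm bounds for creation and annihilation operators. -/

section CAR

variable {ι : Type*} [LinearOrder ι] {L : Type*} [NormedAddCommGroup L] [InnerProductSpace ℂ L]
  (ζ : HilbertBasis ι ℂ L)

theorem annih_add (ξ τ : L) : annih ζ (ξ + τ) = annih ζ ξ + annih ζ τ := by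
  refine (hasSum_annih ζ (ξ + τ)).unique ?_
  simpa [inner_add_right, add_smul] using (hasSum_annih ζ ξ).add (hasSum_annih ζ τ)

theorem annih_smul (c : ℂ) (ξ : L) : annih ζ (c • ξ) = c • annih ζ ξ := by
  refine (hasSum_annih ζ (c • ξ)).unique ?_
  simpa [inner_smul_right, smul_smul] using (hasSum_annih ζ ξ).const_smul c

/-- The expectation in ψ of the anticommutator of a†_ξ and a_ξ. Hence both operators have norm at
most ‖ξ‖. -/
theorem norm_sq_annih_add_norm_sq_create (ξ : L) (ψ : Fock ι) :
    ‖annih ζ ξ ψ‖ ^ 2 + ‖create ζ ξ ψ‖ ^ 2 = ‖ξ‖ ^ 2 * ‖ψ‖ ^ 2 := by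
  have h := congrArg (fun T : Fock ι →L[ℂ] Fock ι => inner ℂ ψ (T ψ))
    (annih_create_anticomm ζ ξ ξ)
  simp only [add_apply, mul_apply_eq_comp, inner_add_right, adjoint_inner_right, smul_apply,
    one_apply_eq_self, inner_smul_right] at h
  rw [← adjoint_inner_left (annih ζ ξ) ((annih ζ ξ).adjoint ψ) ψ] at h
  simp only [inner_self_eq_norm_sq_to_K] at h
  apply Complex.ofReal_injective
  simpa [create] using h

theorem norm_annih_apply_le (ξ : L) (ψ : Fock ι) : ‖annih ζ ξ ψ‖ ≤ ‖ξ‖ * ‖ψ‖ := by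
  refine abs_le_of_sq_le_sq' ?_ (by positivity) |>.2
  rw [mul_pow, ← norm_sq_annih_add_norm_sq_create ζ]
  nlinarith [sq_nonneg ‖create ζ ξ ψ‖]

theorem norm_create_apply_le (ξ : L) (ψ : Fock ι) : ‖create ζ ξ ψ‖ ≤ ‖ξ‖ * ‖ψ‖ := by
  refine abs_le_of_sq_le_sq' ?_ (by positivity) |>.2
  rw [mul_pow, ← norm_sq_annih_add_norm_sq_create ζ]
  nlinarith [sq_nonneg ‖annih ζ ξ ψ‖]

theorem norm_annih_le (ξ : L) : ‖annih ζ ξ‖ ≤ ‖ξ‖ :=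
  opNorm_le_bound _ (norm_nonneg _) (norm_annih_apply_le ζ ξ)

theorem norm_create_le (ξ : L) : ‖create ζ ξ‖ ≤ ‖ξ‖ :=
  opNorm_le_bound _ (norm_nonneg _) (norm_create_apply_le ζ ξ)

/-- The annihilation operator as a continuous linear map of its argument. -/
def annihL : L →L[ℂ] (Fock ι →L[ℂ] Fock ι) :=
  LinearMap.mkContinuous ⟨⟨annih ζ, annih_add ζ⟩, annih_smul ζ⟩ 1
    (fun ξ => by rw [one_mul]; exact norm_annih_le ζ ξ)

@[simp] theorem annihL_apply (ξ : L) : annihL ζ ξ = annih ζ ξ := rfl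

theorem annih_zero : annih ζ 0 = 0 := (annihL ζ).map_zero
theorem annih_neg (ξ : L) : annih ζ (-ξ) = -annih ζ ξ := (annihL ζ).map_neg ξ
theorem annih_sub (ξ τ : L) : annih ζ (ξ - τ) = annih ζ ξ - annih ζ τ := (annihL ζ).map_sub ξ τ

/-- The creation operator as a continuous conjugate linear map of its argument. -/
def createL : L →L⋆[ℂ] (Fock ι →L[ℂ] Fock ι) :=
  LinearMap.mkContinuous
    ⟨⟨create ζ, fun ξ τ => by simp [create, annih_add]⟩,
      fun c ξ => by
        change (annih ζ (c • ξ)).adjoint = _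
        rw [annih_smul]
        exact map_smulₛₗ _ _ _⟩ 1
    (fun ξ => by rw [one_mul]; exact norm_create_le ζ ξ)

@[simp] theorem createL_apply (ξ : L) : createL ζ ξ = create ζ ξ := rfl

theorem create_add (ξ τ : L) : create ζ (ξ + τ) = create ζ ξ + create ζ τ := (createL ζ).map_add ξ τ
theorem create_smul (c : ℂ) (ξ : L) : create ζ (c • ξ) = starRingEnd ℂ c • create ζ ξ :=
  (createL ζ).map_smulₛₗ c ξ
theorem create_zero : create ζ 0 = 0 := (createL ζ).map_zero
theorem create_sub (ξ τ : L) : create ζ (ξ - τ) = create ζ ξ - create ζ τ :=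
  (createL ζ).map_sub ξ τ

theorem adjoint_annih (ξ : L) : (annih ζ ξ).adjoint = create ζ ξ := rfl
theorem adjoint_create (ξ : L) : (create ζ ξ).adjoint = annih ζ ξ := adjoint_adjoint _

theorem annih_mul_annih (ξ τ : L) : annih ζ ξ * annih ζ τ = -(annih ζ τ * annih ζ ξ) :=
  eq_neg_of_add_eq_zero_left (annih_anticomm ζ ξ τ)

theorem eq_zero_of_eq_neg_self {x : Fock ι →L[ℂ] Fock ι} (h : x = -x) : x = 0 := by
  have h2 : (2 : ℂ) • x = 0 := by
    rw [two_smul]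
    nth_rewrite 1 [h]
    exact neg_add_cancel x
  exact (smul_eq_zero.1 h2).resolve_left two_ne_zero

theorem annih_mul_self (ξ : L) : annih ζ ξ * annih ζ ξ = 0 :=
  eq_zero_of_eq_neg_self (annih_mul_annih ζ ξ ξ)

theorem annih_mul_create (ξ τ : L) : annih ζ τ * create ζ ξ =
    inner ℂ ξ τ • (1 : Fock ι →L[ℂ] Fock ι) - create ζ ξ * annih ζ τ := by
  rw [← annih_create_anticomm ζ ξ τ]
  simp [create]

theorem create_mul_create (ξ τ : L) : create ζ ξ * create ζ τ = -(create ζ τ * create ζ ξ) := by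
  have h := congrArg (fun T : Fock ι →L[ℂ] Fock ι => star T) (annih_mul_annih ζ τ ξ)
  simpa [star_mul, ContinuousLinearMap.star_eq_adjoint, adjoint_annih] using h

theorem create_mul_self (ξ : L) : create ζ ξ * create ζ ξ = 0 :=
  eq_zero_of_eq_neg_self (create_mul_create ζ ξ ξ)

theorem annih_annih_apply (ξ τ : L) (ψ : Fock ι) :
    annih ζ ξ (annih ζ τ ψ) = -annih ζ τ (annih ζ ξ ψ) :=
  congrArg (fun T : Fock ι →L[ℂ] Fock ι => T ψ) (annih_mul_annih ζ ξ τ)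

theorem create_create_apply (ξ τ : L) (ψ : Fock ι) :
    create ζ ξ (create ζ τ ψ) = -create ζ τ (create ζ ξ ψ) :=
  congrArg (fun T : Fock ι →L[ℂ] Fock ι => T ψ) (create_mul_create ζ ξ τ)

theorem annih_create_apply (ξ τ : L) (ψ : Fock ι) :
    annih ζ τ (create ζ ξ ψ) = inner ℂ ξ τ • ψ - create ζ ξ (annih ζ τ ψ) :=
  congrArg (fun T : Fock ι →L[ℂ] Fock ι => T ψ) (annih_mul_create ζ ξ τ)

theorem annih_basis (i : ι) : annih ζ (ζ i) = modeAnnih i := by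
  refine (hasSum_annih ζ (ζ i)).unique ?_
  refine Eq.mpr (congrArg (fun u => HasSum u _) (funext fun j => ?_))
    (hasSum_ite_eq i (modeAnnih i : Fock ι →L[ℂ] Fock ι))
  rw [orthonormal_iff_ite.1 ζ.orthonormal j i]
  split_ifs with h
  · rw [h, one_smul]
  · rw [zero_smul]

theorem hasSum_create (ξ : L) :
    HasSum (fun i => inner ℂ ξ (ζ i) • create ζ (ζ i)) (create ζ ξ) := by
  have := (hasSum_annih ζ ξ).mapL (ContinuousLinearMap.adjoint (𝕜 := ℂ) (E := Fock ι)
    (F := Fock ι)).toContinuousLinearEquiv.toContinuousLinearMap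
  simpa [annih_basis, create] using this

/-- The vacuum vector. -/
def vac (ι : Type*) [LinearOrder ι] : Fock ι := lp.single 2 ∅ (1 : ℂ)

@[simp] theorem annih_vac (ξ : L) : annih ζ ξ (vac ι) = 0 := annih_vacuum ζ ξ

@[simp] theorem inner_vac_vac : inner ℂ (vac ι) (vac ι) = (1 : ℂ) := by
  rw [vac, lp.inner_single_left]; simp

@[simp] theorem inner_vac_create (ξ : L) (ψ : Fock ι) : inner ℂ (vac ι) (create ζ ξ ψ) = (0 : ℂ) := by
  rw [create, adjoint_inner_right, annih_vac, inner_zero_left]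

end CAR

/-! ### Particle number bounds. -/

section Number

variable {ι : Type*} [LinearOrder ι]

/-- The vectors with at most `N` particles. -/
def upTo (ι : Type*) (N : ℕ) : Submodule ℂ (Fock ι) where
  carrier := {ψ | ∀ S : Finset ι, N < S.card → (ψ : Finset ι → ℂ) S = 0}
  add_mem' := fun {a b} ha hb S hS => by
    change (a : Finset ι → ℂ) S + (b : Finset ι → ℂ) S = 0
    rw [ha S hS, hb S hS, add_zero]
  zero_mem' := fun _ _ => rfl
  smul_mem' := fun c a ha S hS => by
    change c * (a : Finset ι → ℂ) S = 0
    rw [ha S hS, mul_zero]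

theorem mem_upTo {N : ℕ} {ψ : Fock ι} :
    ψ ∈ upTo ι N ↔ ∀ S : Finset ι, N < S.card → (ψ : Finset ι → ℂ) S = 0 := Iff.rfl

theorem coeff_eq_inner (S : Finset ι) (ψ : Fock ι) :
    (ψ : Finset ι → ℂ) S = inner ℂ (lp.single 2 S (1 : ℂ) : Fock ι) ψ := by
  rw [lp.inner_single_left]; simp

theorem isClosed_upTo (N : ℕ) : IsClosed (upTo ι N : Set (Fock ι)) := by
  have : (upTo ι N : Set (Fock ι)) =
      ⋂ S : Finset ι, ⋂ _ : N < S.card, {ψ | inner ℂ (lp.single 2 S (1 : ℂ) : Fock ι) ψ = 0} := by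
    ext ψ
    simp [mem_upTo, coeff_eq_inner]
  rw [this]
  exact isClosed_iInter fun S => isClosed_iInter fun _ =>
    isClosed_eq (continuous_const.inner continuous_id) continuous_const

theorem upTo_mono {M N : ℕ} (h : M ≤ N) : upTo ι M ≤ upTo ι N := fun _ hψ S hS =>
  hψ S (h.trans_lt hS)

theorem single_mem_upTo {N : ℕ} (S : Finset ι) (hS : S.card ≤ N) (c : ℂ) :
    (lp.single 2 S c : Fock ι) ∈ upTo ι N := fun T hT => by
  have : T ≠ S := fun h => by subst h; omega
  simp [this]

theorem vac_mem_upTo (N : ℕ) : vac ι ∈ upTo ι N := single_mem_upTo ∅ (by simp) 1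

theorem modeAnnih_mem_upTo {N : ℕ} (i : ι) {ψ : Fock ι} (hψ : ψ ∈ upTo ι N) :
    modeAnnih i ψ ∈ upTo ι N := fun S hS => by
  rw [modeAnnih_apply]
  split_ifs with h
  · rfl
  · rw [hψ _ (by rw [Finset.card_insert_of_notMem h]; omega), mul_zero]

theorem modeAnnih_mem_upTo_pred {N : ℕ} (i : ι) {ψ : Fock ι} (hψ : ψ ∈ upTo ι (N + 1)) :
    modeAnnih i ψ ∈ upTo ι N := fun S hS => by
  rw [modeAnnih_apply]
  split_ifs with h
  · rfl
  · rw [hψ _ (by rw [Finset.card_insert_of_notMem h]; omega), mul_zero]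

theorem modeCreate_mem_upTo {N : ℕ} (i : ι) {ψ : Fock ι} (hψ : ψ ∈ upTo ι N) :
    (modeAnnih i).adjoint ψ ∈ upTo ι (N + 1) := fun S hS => by
  rw [modeCreate_apply]
  split_ifs with h
  · rw [hψ _ (by rw [Finset.card_erase_of_mem h]; omega), mul_zero]
  · rfl

/-- The i-th term is the total weight in ψ of the configurations S that contain i. In the sum each S
is therefore counted at most `S.card` times, and `S.card` is at most N where ψ does not vanish. -/
theorem sum_norm_sq_modeAnnih_le {N : ℕ} {ψ : Fock ι} (hψ : ψ ∈ upTo ι N) (t : Finset ι) :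
    ∑ i ∈ t, ‖modeAnnih i ψ‖ ^ 2 ≤ N * ‖ψ‖ ^ 2 := by
  have h1 : ∀ i, HasSum (fun S : Finset ι => if i ∈ S then ‖(ψ : Finset ι → ℂ) S‖ ^ 2 else 0)
      (‖modeAnnih i ψ‖ ^ 2) := fun i => by
    have h := lp.hasSum_inner (𝕜 := ℂ) ψ ((modeAnnih i).adjoint (modeAnnih i ψ))
    rw [adjoint_inner_right, inner_self_eq_norm_sq_to_K] at h
    have h' := Complex.hasSum_re h
    have e : Complex.re ((‖modeAnnih i ψ‖ : ℂ) ^ 2) = ‖modeAnnih i ψ‖ ^ 2 := by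
      rw [← Complex.ofReal_pow, Complex.ofReal_re]
    rw [← e]
    refine Eq.mpr (congrArg (fun u => HasSum u _) (funext fun S : Finset ι => ?_)) h'
    rw [modeCreate_apply]
    split_ifs with hS
    · rw [modeAnnih_apply]
      simp only [Finset.mem_erase, ne_eq, not_true_eq_false, false_and, if_false,
        Finset.insert_erase hS]
      rw [← mul_assoc, sgn_erase _ _ _ hS]
      simp [sgn_mul_self, ← Complex.ofReal_pow]
    · simp
  have h0 : HasSum (fun S : Finset ι => ‖(ψ : Finset ι → ℂ) S‖ ^ 2) (‖ψ‖ ^ 2) := by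
    have h := Complex.hasSum_re (lp.hasSum_inner (𝕜 := ℂ) ψ ψ)
    rw [inner_self_eq_norm_sq_to_K] at h
    have e : Complex.re ((‖ψ‖ : ℂ) ^ 2) = ‖ψ‖ ^ 2 := by
      rw [← Complex.ofReal_pow, Complex.ofReal_re]
    rw [← e]
    refine Eq.mpr (congrArg (fun u => HasSum u _) (funext fun S : Finset ι => ?_)) h
    simp [← Complex.ofReal_pow]
  refine hasSum_le (fun S => ?_) (hasSum_sum fun i _ => h1 i) (h0.mul_left (N : ℝ))
  rw [← Finset.sum_filter, Finset.sum_const, nsmul_eq_mul]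
  by_cases hS : N < S.card
  · simp [hψ S hS]
  · refine mul_le_mul_of_nonneg_right ?_ (by positivity)
    have : (t.filter (· ∈ S)).card ≤ S.card :=
      Finset.card_le_card fun i hi => (Finset.mem_filter.1 hi).2
    exact_mod_cast this.trans (not_lt.1 hS)

variable {L : Type*} [NormedAddCommGroup L] [InnerProductSpace ℂ L] (ζ : HilbertBasis ι ℂ L)

theorem annih_mem_upTo {N : ℕ} (ξ : L) {ψ : Fock ι} (hψ : ψ ∈ upTo ι N) :
    annih ζ ξ ψ ∈ upTo ι N := by
  have h := (hasSum_annih ζ ξ).mapL (ContinuousLinearMap.apply ℂ (Fock ι) ψ)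
  exact (isClosed_upTo N).mem_of_tendsto h (Eventually.of_forall fun s =>
    Submodule.sum_mem _ fun i _ => Submodule.smul_mem _ _ (modeAnnih_mem_upTo i hψ))

theorem annih_mem_upTo_pred {N : ℕ} (ξ : L) {ψ : Fock ι} (hψ : ψ ∈ upTo ι (N + 1)) :
    annih ζ ξ ψ ∈ upTo ι N := by
  have h := (hasSum_annih ζ ξ).mapL (ContinuousLinearMap.apply ℂ (Fock ι) ψ)
  exact (isClosed_upTo N).mem_of_tendsto h (Eventually.of_forall fun s =>
    Submodule.sum_mem _ fun i _ => Submodule.smul_mem _ _ (modeAnnih_mem_upTo_pred i hψ))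

theorem create_mem_upTo {N : ℕ} (ξ : L) {ψ : Fock ι} (hψ : ψ ∈ upTo ι N) :
    create ζ ξ ψ ∈ upTo ι (N + 1) := by
  have h := (hasSum_create ζ ξ).mapL (ContinuousLinearMap.apply ℂ (Fock ι) ψ)
  refine (isClosed_upTo (N + 1)).mem_of_tendsto h (Eventually.of_forall fun s =>
    Submodule.sum_mem _ fun i _ => Submodule.smul_mem _ _ ?_)
  rw [create, annih_basis]
  exact modeCreate_mem_upTo i hψ

theorem sum_norm_sq_annih_le {N : ℕ} {ψ : Fock ι} (hψ : ψ ∈ upTo ι N) (t : Finset ι) :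
    ∑ i ∈ t, ‖annih ζ (ζ i) ψ‖ ^ 2 ≤ N * ‖ψ‖ ^ 2 := by
  simpa only [annih_basis] using sum_norm_sq_modeAnnih_le hψ t

theorem le_of_sq_le_mul {x c : ℝ} (hx : 0 ≤ x) (hc : 0 ≤ c) (h : x ^ 2 ≤ c * x) : x ≤ c := by
  rcases hx.eq_or_lt with h0 | h0
  · rwa [← h0]
  · rw [pow_two] at h
    exact le_of_mul_le_mul_right h h0

/-- Duality: pair the sum Φ with itself, move the creators over as annihilators, and apply
Cauchy-Schwarz with the number bound for Φ, which has at most N + 1 particles. Only square sums of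
the φ i enter, which is what Hilbert-Schmidt maps provide. -/
theorem norm_sq_sum_create_le {N : ℕ} (t : Finset ι) (φ : ι → Fock ι) (hφ : ∀ i, φ i ∈ upTo ι N) :
    ‖∑ i ∈ t, create ζ (ζ i) (φ i)‖ ^ 2 ≤ (N + 1) * ∑ i ∈ t, ‖φ i‖ ^ 2 := by
  set Φ := ∑ i ∈ t, create ζ (ζ i) (φ i) with hΦ
  have hmem : Φ ∈ upTo ι (N + 1) := Submodule.sum_mem _ fun i _ => create_mem_upTo ζ _ (hφ i)
  have h1 : ‖Φ‖ ^ 2 ≤ ∑ i ∈ t, ‖annih ζ (ζ i) Φ‖ * ‖φ i‖ := by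
    have : (‖Φ‖ : ℂ) ^ 2 = ∑ i ∈ t, inner ℂ (annih ζ (ζ i) Φ) (φ i) := by
      have h := inner_self_eq_norm_sq_to_K (𝕜 := ℂ) Φ
      conv_lhs at h => rw [hΦ, inner_sum]
      rw [← hΦ] at h
      refine (h.symm).trans (Finset.sum_congr rfl fun i _ => ?_)
      rw [create, adjoint_inner_right]
    have h2 : ‖(‖Φ‖ : ℂ) ^ 2‖ ≤ _ := this ▸ norm_sum_le _ _
    rw [norm_pow, Complex.norm_real, norm_norm] at h2
    exact h2.trans (Finset.sum_le_sum fun i _ => norm_inner_le_norm _ _)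
  have h2 := Finset.sum_mul_sq_le_sq_mul_sq t (fun i => ‖annih ζ (ζ i) Φ‖) fun i => ‖φ i‖
  have h3 := sum_norm_sq_annih_le ζ hmem t
  have h4 : 0 ≤ ∑ i ∈ t, ‖φ i‖ ^ 2 := Finset.sum_nonneg fun _ _ => by positivity
  have h5 : (‖Φ‖ ^ 2) ^ 2 ≤ ((N + 1) * ∑ i ∈ t, ‖φ i‖ ^ 2) * ‖Φ‖ ^ 2 := by
    push_cast at h3
    calc (‖Φ‖ ^ 2) ^ 2 ≤ (∑ i ∈ t, ‖annih ζ (ζ i) Φ‖ * ‖φ i‖) ^ 2 :=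
          pow_le_pow_left₀ (sq_nonneg _) h1 2
      _ ≤ _ := h2
      _ ≤ ((N + 1) * ‖Φ‖ ^ 2) * ∑ i ∈ t, ‖φ i‖ ^ 2 :=
          mul_le_mul_of_nonneg_right h3 h4
      _ = _ := by ring
  exact le_of_sq_le_mul (sq_nonneg _) (mul_nonneg (by positivity) h4) h5

end Number

/-! ### Current operators of trace class operators. -/

section Current

variable {ι : Type*} [LinearOrder ι] {L : Type*} [NormedAddCommGroup L] [InnerProductSpace ℂ L]
  (ζ : HilbertBasis ι ℂ L)

/-- The current operator of the rank one operator `⟨y, ·⟩ x`. -/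
def current (y x : L) : Fock ι →L[ℂ] Fock ι :=
  create ζ y * annih ζ x - ((1 / 2 : ℂ) * inner ℂ y x) • 1

theorem current_sum_left {α : Type*} (s : Finset α) (y : α → L) (x : L) :
    current ζ (∑ i ∈ s, y i) x = ∑ i ∈ s, current ζ (y i) x := by
  have : create ζ (∑ i ∈ s, y i) = ∑ i ∈ s, create ζ (y i) := map_sum (createL ζ) y s
  simp only [current, this, sum_inner, Finset.sum_mul, Finset.mul_sum, Finset.sum_smul,
    Finset.sum_sub_distrib]

theorem current_smul_left (c : ℂ) (y x : L) :
    current ζ (c • y) x = starRingEnd ℂ c • current ζ y x := by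
  rw [current, current, create_smul, inner_smul_left, smul_mul_assoc, smul_sub, smul_smul]
  congr 2
  ring

theorem norm_current_le (y x : L) : ‖current ζ y x‖ ≤ 2 * (‖x‖ * ‖y‖) := by
  have h1 : ‖create ζ y * annih ζ x‖ ≤ ‖y‖ * ‖x‖ :=
    (norm_mul_le _ _).trans (mul_le_mul (norm_create_le ζ y) (norm_annih_le ζ x)
      (norm_nonneg _) (norm_nonneg _))
  have h2 : ‖((1 / 2 : ℂ) * inner ℂ y x) • (1 : Fock ι →L[ℂ] Fock ι)‖ ≤ 1 / 2 * (‖y‖ * ‖x‖) * 1 := by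
    rw [norm_smul]
    refine mul_le_mul ?_ ContinuousLinearMap.norm_id_le (norm_nonneg _) (by positivity)
    rw [norm_mul]
    simpa using norm_inner_le_norm (𝕜 := ℂ) y x
  have h3 : 0 ≤ ‖y‖ * ‖x‖ := by positivity
  refine (norm_sub_le _ _).trans ((add_le_add h1 h2).trans ?_)
  nlinarith

theorem continuous_current_left (x : L) : Continuous fun y => current ζ y x := by
  have h : Continuous fun y => create ζ y := (createL ζ).continuous
  have h2 : Continuous fun y : L => inner ℂ y x := continuous_id.inner continuous_const
  exact (h.mul continuous_const).sub ((continuous_const.mul h2).smul continuous_const)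

theorem adjoint_current (y x : L) : (current ζ y x).adjoint = current ζ x y := by
  rw [← ContinuousLinearMap.star_eq_adjoint, current, current, star_sub, star_mul, star_smul,
    star_one, ContinuousLinearMap.star_eq_adjoint, ContinuousLinearMap.star_eq_adjoint,
    adjoint_annih, adjoint_create]
  congr 2
  rw [star_mul']
  have : star (inner ℂ y x : ℂ) = inner ℂ x y := inner_conj_symm x y
  rw [this]
  congr 1
  simp

theorem current_mul_annih (y x v : L) :
    current ζ y x * annih ζ v - annih ζ v * current ζ y x = -(inner ℂ y v • annih ζ x) := by
  rw [current, sub_mul, mul_sub, mul_assoc, annih_mul_annih ζ x v, ← mul_assoc, annih_mul_create]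
  simp only [smul_mul_assoc, mul_smul_comm, one_mul, mul_one, mul_neg, sub_mul]
  rw [← mul_assoc]
  abel

theorem current_vac (y x : L) : current ζ y x (vac ι) = (-((1 / 2 : ℂ) * inner ℂ y x)) • vac ι := by
  simp [current]

theorem current_mem_upTo {N : ℕ} (y x : L) {ψ : Fock ι} (hψ : ψ ∈ upTo ι N) :
    current ζ y x ψ ∈ upTo ι N := by
  refine Submodule.sub_mem _ ?_ (Submodule.smul_mem _ _ hψ)
  change create ζ y (annih ζ x ψ) ∈ upTo ι N
  cases N with
  -- There is no lower space to land in here; ψ is a multiple of the vacuum and is annihilated.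
  | zero =>
    have : annih ζ x ψ = 0 := by
      have h : ψ = (ψ : Finset ι → ℂ) ∅ • vac ι := by
        refine Subtype.ext (funext fun S => ?_)
        change (ψ : Finset ι → ℂ) S = (ψ : Finset ι → ℂ) ∅ * (vac ι : Finset ι → ℂ) S
        by_cases hS : S = ∅
        · subst hS; simp [vac]
        · rw [hψ S (Finset.card_pos.2 (Finset.nonempty_iff_ne_empty.2 hS))]
          simp [vac, hS]
      rw [h, map_smul, annih_vac, smul_zero]
    rw [this, map_zero]
    exact Submodule.zero_mem _
  | succ N =>
    exact create_mem_upTo ζ y (annih_mem_upTo_pred ζ x hψ)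

theorem norm_partial_le {κ : Type*} {d : κ → L} (hd : Orthonormal ℂ d) (F : Finset κ) (y : L) :
    ‖∑ i ∈ F, inner ℂ (d i) y • d i‖ ≤ ‖y‖ := by
  refine abs_le_of_sq_le_sq' ?_ (norm_nonneg _) |>.2
  have := hd.sum_inner_products_le (s := F) y
  refine le_trans (le_of_eq ?_) this
  have h := hd.inner_sum (fun i => inner ℂ (d i) y) (fun i => inner ℂ (d i) y) F
  rw [inner_self_eq_norm_sq_to_K] at h
  apply Complex.ofReal_injective
  push_cast
  refine h.trans (Finset.sum_congr rfl fun i _ => ?_)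
  exact Complex.conj_mul' _

theorem hasSum_expansion (y : L) : HasSum (fun i => inner ℂ (ζ i) y • ζ i) y := by
  simpa only [HilbertBasis.repr_apply_apply] using ζ.hasSum_repr y

variable {κ : Type*} {l : L →L[ℂ] L} {x y : κ → L}

/-- Reduces every question about l^ to rank one currents. The partial sum over a finite set F of
basis vectors amounts to replacing each y n by its projection to the span of F; projections converge
and do not increase norms, so dominated convergence applies. -/
theorem hasSum_hatCurrent (hs : Summable fun n => ‖x n‖ * ‖y n‖)
    (hl : ∀ v, HasSum (fun n => inner ℂ (y n) v • x n) (l v)) :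
    HasSum (fun n => current ζ (y n) (x n)) (hatCurrent ζ l) := by
  have hsum : ∀ z : κ → L, (∀ n, ‖z n‖ ≤ ‖y n‖) → Summable fun n => current ζ (z n) (x n) :=
    fun z hz => Summable.of_norm_bounded (hs.mul_left 2) fun n =>
      (norm_current_le ζ _ _).trans (by have := hz n; gcongr)
  have hterm : ∀ i, HasSum (fun n => current ζ (inner ℂ (ζ i) (y n) • ζ i) (x n))
      ((1 / 2 : ℂ) • (create ζ (ζ i) * annih ζ (l (ζ i)) - annih ζ (l (ζ i)) * create ζ (ζ i))) := by
    intro i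
    have h1 : HasSum (fun n => inner ℂ (y n) (ζ i) • annih ζ (x n)) (annih ζ (l (ζ i))) := by
      simpa only [map_smul, annihL_apply] using (hl (ζ i)).mapL (annihL ζ)
    have h2 : HasSum (fun n => (1 / 2 : ℂ) * (inner ℂ (y n) (ζ i) * inner ℂ (ζ i) (x n)))
        ((1 / 2 : ℂ) * inner ℂ (ζ i) (l (ζ i))) := by
      have := ((hl (ζ i)).mapL (innerSL ℂ (ζ i))).mul_left (1 / 2)
      simpa only [map_smul, smul_eq_mul, innerSL_apply_apply] using this
    have h3 := (h1.mul_left (create ζ (ζ i))).sub (h2.smul_const (1 : Fock ι →L[ℂ] Fock ι))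
    have e : (1 / 2 : ℂ) • (create ζ (ζ i) * annih ζ (l (ζ i)) - annih ζ (l (ζ i)) * create ζ (ζ i))
        = create ζ (ζ i) * annih ζ (l (ζ i)) - ((1 / 2 : ℂ) * inner ℂ (ζ i) (l (ζ i))) • 1 := by
      rw [annih_mul_create]
      module
    rw [e]
    refine Eq.mpr (congrArg (fun u => HasSum u _) (funext fun n => ?_)) h3
    rw [current_smul_left, inner_conj_symm, current, smul_sub, mul_smul_comm, smul_smul]
    congr 2
    ring
  have hF : ∀ F : Finset ι, ∑ i ∈ F, (1 / 2 : ℂ) • (create ζ (ζ i) * annih ζ (l (ζ i))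
      - annih ζ (l (ζ i)) * create ζ (ζ i))
      = ∑' n, current ζ (∑ i ∈ F, inner ℂ (ζ i) (y n) • ζ i) (x n) := fun F => by
    refine ((hasSum_sum fun i (_ : i ∈ F) => hterm i).tsum_eq).symm.trans ?_
    simp only [current_sum_left]
  have hmain : HasSum (fun i => (1 / 2 : ℂ) • (create ζ (ζ i) * annih ζ (l (ζ i))
      - annih ζ (l (ζ i)) * create ζ (ζ i))) (∑' n, current ζ (y n) (x n)) := by
    change Tendsto _ _ _
    simp only [hF]
    refine tendsto_tsum_of_dominated_convergence (hs.mul_left 2) (fun n => ?_)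
      (Eventually.of_forall fun F n => (norm_current_le ζ _ _).trans ?_)
    · exact ((continuous_current_left ζ (x n)).tendsto _).comp (hasSum_expansion ζ (y n))
    · have := norm_partial_le ζ.orthonormal F (y n)
      gcongr
  rw [hatCurrent, hmain.tsum_eq]
  exact (hsum y fun _ => le_rfl).hasSum

section Adjoint

variable [CompleteSpace L]

theorem hasSum_adjoint (hs : Summable fun n => ‖x n‖ * ‖y n‖)
    (hl : ∀ v, HasSum (fun n => inner ℂ (y n) v • x n) (l v)) (v : L) :
    HasSum (fun n => inner ℂ (x n) v • y n) (l.adjoint v) := by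
  have hsum : Summable fun n => inner ℂ (x n) v • y n := by
    refine Summable.of_norm_bounded (hs.mul_right ‖v‖) fun n => ?_
    rw [norm_smul]
    have := norm_inner_le_norm (𝕜 := ℂ) (x n) v
    calc _ ≤ ‖x n‖ * ‖v‖ * ‖y n‖ := by gcongr
      _ = _ := by ring
  convert hsum.hasSum
  refine ext_inner_left ℂ fun w => ?_
  rw [adjoint_inner_right]
  have h1 := hsum.hasSum.mapL (innerSL ℂ w)
  have h2 := (((hl w).mapL (innerSL ℂ v))).star
  have e1 : star ((innerSL ℂ v) (l w)) = inner ℂ (l w) v := inner_conj_symm _ _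
  rw [e1] at h2
  refine h2.unique (Eq.mpr (congrArg (fun u => HasSum u _) (funext fun n => ?_)) h1)
  simp only [innerSL_apply_apply, inner_smul_right, star_mul']
  have e2 : star (inner ℂ v (x n) : ℂ) = inner ℂ (x n) v := inner_conj_symm _ _
  have e3 : star (inner ℂ (y n) w : ℂ) = inner ℂ w (y n) := inner_conj_symm _ _
  rw [e2, e3, mul_comm]

theorem IsTraceClass.adjoint {l : L →L[ℂ] L} (hl : IsTraceClass l) : IsTraceClass l.adjoint := by
  obtain ⟨x, y, hs, hl⟩ := hl
  exact ⟨y, x, by simpa only [mul_comm] using hs, hasSum_adjoint hs hl⟩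

theorem hatCurrent_adjoint (hl : IsTraceClass l) :
    hatCurrent ζ l.adjoint = (hatCurrent ζ l).adjoint := by
  obtain ⟨x, y, hs, hl⟩ := hl
  have h1 := hasSum_hatCurrent ζ (x := y) (y := x) (by simpa only [mul_comm] using hs)
    (hasSum_adjoint hs hl)
  have h2 := (hasSum_hatCurrent ζ hs hl).mapL (ContinuousLinearMap.adjoint (𝕜 := ℂ) (E := Fock ι)
    (F := Fock ι)).toContinuousLinearEquiv.toContinuousLinearMap
  refine h1.unique (Eq.mpr (congrArg (fun u => HasSum u _) (funext fun n => ?_)) h2)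
  exact (adjoint_current ζ _ _).symm

end Adjoint

theorem hatCurrent_commutator (hl : IsTraceClass l) (v : L) :
    hatCurrent ζ l * annih ζ v - annih ζ v * hatCurrent ζ l = -annih ζ (l v) := by
  obtain ⟨x, y, hs, hl⟩ := hl
  have h := hasSum_hatCurrent ζ hs hl
  have h1 := (h.mul_right (annih ζ v)).sub (h.mul_left (annih ζ v))
  refine h1.unique ?_
  simp only [current_mul_annih]
  simpa only [map_smul, annihL_apply] using ((hl v).mapL (annihL ζ)).neg

theorem exp_hatCurrent_mul_annih [CompleteSpace L] (hl : IsTraceClass l) (v : L) :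
    NormedSpace.exp (hatCurrent ζ l) * annih ζ v =
      annih ζ (NormedSpace.exp (-l) v) * NormedSpace.exp (hatCurrent ζ l) :=
  exp_mul_of_commutator (annihL ζ) l _ (hatCurrent_commutator ζ hl) v

theorem hatCurrent_vac (hl : IsTraceClass l) : ∃ c : ℂ, hatCurrent ζ l (vac ι) = c • vac ι := by
  obtain ⟨x, y, hs, hl⟩ := hl
  have h := (hasSum_hatCurrent ζ hs hl).mapL (ContinuousLinearMap.apply ℂ (Fock ι) (vac ι))
  have h' : hatCurrent ζ l (vac ι) ∈ Submodule.span ℂ {vac ι} := by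
    refine (Submodule.closed_of_finiteDimensional (Submodule.span ℂ {vac ι})).mem_of_tendsto h
      (Eventually.of_forall fun s => Submodule.sum_mem _ fun n _ => ?_)
    rw [apply_apply, current_vac]
    exact Submodule.smul_mem _ _ (Submodule.mem_span_singleton_self _)
  obtain ⟨c, hc⟩ := Submodule.mem_span_singleton.1 h'
  exact ⟨c, hc.symm⟩

theorem hatCurrent_mem_upTo {N : ℕ} (hl : IsTraceClass l) {ψ : Fock ι} (hψ : ψ ∈ upTo ι N) :
    hatCurrent ζ l ψ ∈ upTo ι N := by
  obtain ⟨x, y, hs, hl⟩ := hl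
  have h := (hasSum_hatCurrent ζ hs hl).mapL (ContinuousLinearMap.apply ℂ (Fock ι) ψ)
  exact (isClosed_upTo N).mem_of_tendsto h
    (Eventually.of_forall fun s => Submodule.sum_mem _ fun n _ => current_mem_upTo ζ _ _ hψ)

/-- The definition is indexed by ℕ; a countable family is carried along an injection into ℕ and
extended by zero. -/
theorem isTraceClass_of_hasSum [Countable κ] (hs : Summable fun n => ‖x n‖ * ‖y n‖)
    (hl : ∀ v, HasSum (fun n => inner ℂ (y n) v • x n) (l v)) : IsTraceClass l := by
  obtain ⟨e, he⟩ := exists_injective_nat κ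
  refine ⟨Function.extend e x 0, Function.extend e y 0, ?_, fun v => ?_⟩
  · have : (fun n => ‖Function.extend e x 0 n‖ * ‖Function.extend e y 0 n‖)
        = Function.extend e (fun n => ‖x n‖ * ‖y n‖) 0 := by
      funext n
      by_cases hn : ∃ k, e k = n
      · obtain ⟨k, rfl⟩ := hn
        simp [he.extend_apply]
      · simp [Function.extend_apply' _ _ _ hn]
    rw [this]
    exact ((hasSum_extend_zero he).2 hs.hasSum).summable
  · have : (fun n => inner ℂ (Function.extend e y 0 n) v • Function.extend e x 0 n)
        = Function.extend e (fun n => inner ℂ (y n) v • x n) 0 := by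
      funext n
      by_cases hn : ∃ k, e k = n
      · obtain ⟨k, rfl⟩ := hn
        simp [he.extend_apply]
      · simp [Function.extend_apply' _ _ _ hn]
    rw [this]
    exact (hasSum_extend_zero he).2 (hl v)

theorem hasSum_rankOne (c : ℂ) (x y v : L) : HasSum (fun _ : Unit => inner ℂ y v • (c • x))
    ((c • InnerProductSpace.rankOne ℂ x y) v) := by
  have e : (c • InnerProductSpace.rankOne ℂ x y) v = inner ℂ y v • (c • x) := by
    simp [smul_comm c]
  rw [e]
  exact hasSum_unique _

theorem isTraceClass_smul_rankOne (c : ℂ) (x y : L) :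
    IsTraceClass (c • InnerProductSpace.rankOne ℂ x y) :=
  isTraceClass_of_hasSum (κ := Unit) (Summable.of_finite) (hasSum_rankOne c x y)

theorem hatCurrent_smul_rankOne (c : ℂ) (x y : L) :
    hatCurrent ζ (c • InnerProductSpace.rankOne ℂ x y) = c • current ζ y x := by
  have h := hasSum_hatCurrent ζ (κ := Unit) (Summable.of_finite) (hasSum_rankOne c x y)
  rw [h.unique (hasSum_unique _), current, current, annih_smul, inner_smul_right, mul_smul_comm,
    smul_sub, smul_smul]
  congr 2
  ring

end Current

/-! ### The Banach spaces of vectors with at most N particles. -/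

section Sector

variable {ι : Type*} [LinearOrder ι]

/-- The Banach space of vectors with at most `N` particles. -/
def Sector (ι : Type*) (N : ℕ) : Type _ := upTo ι N

instance (N : ℕ) : NormedAddCommGroup (Sector ι N) := inferInstanceAs (NormedAddCommGroup (upTo ι N))
instance (N : ℕ) : NormedSpace ℂ (Sector ι N) := inferInstanceAs (NormedSpace ℂ (upTo ι N))
instance (N : ℕ) : CompleteSpace (Sector ι N) := (isClosed_upTo N).completeSpace_coe

/-- The inclusion of the vectors with at most `N` particles in the Fock space. -/
def incl (ι : Type*) (N : ℕ) : Sector ι N →L[ℂ] Fock ι := (upTo ι N).subtypeL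

/-- A vector of the Fock space with at most `N` particles, as an element of `Sector ι N`. -/
def toSector {N : ℕ} (ψ : Fock ι) (h : ψ ∈ upTo ι N) : Sector ι N := ⟨ψ, h⟩

theorem incl_toSector {N : ℕ} (ψ : Fock ι) (h : ψ ∈ upTo ι N) : incl ι N (toSector ψ h) = ψ := rfl

theorem incl_mem {N : ℕ} (v : Sector ι N) : incl ι N v ∈ upTo ι N := Subtype.property v

theorem norm_incl {N : ℕ} (v : Sector ι N) : ‖incl ι N v‖ = ‖v‖ := rfl

theorem incl_injective {N : ℕ} : Function.Injective (incl ι N) := Subtype.val_injective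

/-- A bounded operator between sectors, from an operator which is linear and bounded on a sector. -/
def sectorMap {M N : ℕ} (Y : Fock ι → Fock ι) (hmem : ∀ ψ ∈ upTo ι M, Y ψ ∈ upTo ι N)
    (hadd : ∀ ψ ∈ upTo ι M, ∀ φ ∈ upTo ι M, Y (ψ + φ) = Y ψ + Y φ)
    (hsmul : ∀ (c : ℂ), ∀ ψ ∈ upTo ι M, Y (c • ψ) = c • Y ψ) (C : ℝ)
    (hC : ∀ ψ ∈ upTo ι M, ‖Y ψ‖ ≤ C * ‖ψ‖) : Sector ι M →L[ℂ] Sector ι N :=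
  LinearMap.mkContinuous
    { toFun := fun v => toSector (Y (incl ι M v)) (hmem _ (incl_mem v))
      map_add' := fun v w => incl_injective (hadd _ (incl_mem v) _ (incl_mem w))
      map_smul' := fun c v => incl_injective (hsmul c _ (incl_mem v)) } C
    (fun v => hC _ (incl_mem v))

theorem norm_sectorMap_le {M N : ℕ} {Y : Fock ι → Fock ι} (hmem : ∀ ψ ∈ upTo ι M, Y ψ ∈ upTo ι N)
    (hadd : ∀ ψ ∈ upTo ι M, ∀ φ ∈ upTo ι M, Y (ψ + φ) = Y ψ + Y φ)
    (hsmul : ∀ (c : ℂ), ∀ ψ ∈ upTo ι M, Y (c • ψ) = c • Y ψ) {C : ℝ} (h0 : 0 ≤ C)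
    (hC : ∀ ψ ∈ upTo ι M, ‖Y ψ‖ ≤ C * ‖ψ‖) : ‖sectorMap Y hmem hadd hsmul C hC‖ ≤ C :=
  LinearMap.mkContinuous_norm_le _ h0 _

/-- The restriction to a sector of a bounded operator of the Fock space. -/
def sectorRestrict {M N : ℕ} (T : Fock ι →L[ℂ] Fock ι) (hmem : ∀ ψ ∈ upTo ι M, T ψ ∈ upTo ι N) :
    Sector ι M →L[ℂ] Sector ι N :=
  sectorMap T hmem (fun ψ _ φ _ => T.map_add ψ φ) (fun c ψ _ => T.map_smul c ψ) ‖T‖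
    (fun ψ _ => T.le_opNorm ψ)

theorem incl_sectorRestrict {M N : ℕ} (T : Fock ι →L[ℂ] Fock ι)
    (hmem : ∀ ψ ∈ upTo ι M, T ψ ∈ upTo ι N) (v : Sector ι M) :
    incl ι N (sectorRestrict T hmem v) = T (incl ι M v) := rfl

end Sector

/-! ### Antisymmetric conjugate linear Hilbert-Schmidt maps. -/

section HilbertSchmidt

variable {ι : Type*} [LinearOrder ι] {L : Type*} [NormedAddCommGroup L] [InnerProductSpace ℂ L]
  (ζ : HilbertBasis ι ℂ L)

theorem hasSum_norm_sq_inner (v : L) : HasSum (fun i => ‖inner ℂ (ζ i) v‖ ^ 2) (‖v‖ ^ 2) := by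
  have h := Complex.hasSum_re (ζ.hasSum_inner_mul_inner v v)
  rw [inner_self_eq_norm_sq_to_K] at h
  have e : Complex.re ((‖v‖ : ℂ) ^ 2) = ‖v‖ ^ 2 := by
    rw [← Complex.ofReal_pow, Complex.ofReal_re]
  rw [← e]
  refine Eq.mpr (congrArg (fun u => HasSum u _) (funext fun i => ?_)) h
  rw [← inner_conj_symm v, Complex.conj_mul', ← Complex.ofReal_pow, Complex.ofReal_re]

/-- Antisymmetric conjugate linear Hilbert-Schmidt maps. -/
structure IsHS (Λ : L →ₗ[ℝ] L) : Prop where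
  antisymm : ∀ ξ τ, inner ℂ ξ (Λ τ) = -inner ℂ τ (Λ ξ)
  summable : Summable fun i => ‖Λ (ζ i)‖ ^ 2

/-- The square of the Hilbert-Schmidt norm. -/
def hsSq (Λ : L →ₗ[ℝ] L) : ℝ := ∑' i, ‖Λ (ζ i)‖ ^ 2

theorem hsSq_nonneg (Λ : L →ₗ[ℝ] L) : 0 ≤ hsSq ζ Λ := tsum_nonneg fun _ => by positivity

theorem conj_smul_of_antisymm {Λ : L →ₗ[ℝ] L} (h : ∀ ξ τ, inner ℂ ξ (Λ τ) = -inner ℂ τ (Λ ξ))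
    (c : ℂ) (v : L) : Λ (c • v) = starRingEnd ℂ c • Λ v := by
  refine ext_inner_left ℂ fun w => ?_
  rw [h, inner_smul_left, inner_smul_right, h v w]
  ring

variable {ζ}

/-- By antisymmetry ‖Λ ζᵢ‖² = -⟨ζᵢ, Λ² ζᵢ⟩, so a finite sum of these numbers is a partial trace of
-Λ², bounded by ∑ ‖x n‖ ‖y n‖ for any nuclear representation of Λ². -/
theorem IsXi.isHS {Λ : L →ₗ[ℝ] L} (h : IsXi Λ) : IsHS ζ Λ := by
  refine ⟨h.antisymm, ?_⟩
  obtain ⟨T, hT, x, y, hs, hl⟩ := h.sq_traceClass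
  refine summable_of_sum_le (c := ∑' n, ‖x n‖ * ‖y n‖) (fun _ => by positivity) fun F => ?_
  have h1 : ∀ i, HasSum (fun n => -(inner ℂ (y n) (ζ i) * inner ℂ (ζ i) (x n)))
      ((‖Λ (ζ i)‖ ^ 2 : ℝ) : ℂ) := fun i => by
    have h2 := ((hl (ζ i)).mapL (innerSL ℂ (ζ i))).neg
    have e : ((‖Λ (ζ i)‖ ^ 2 : ℝ) : ℂ) = -(innerSL ℂ (ζ i)) (T (ζ i)) := by
      rw [innerSL_apply_apply, hT, h.antisymm, neg_neg, inner_self_eq_norm_sq_to_K]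
      push_cast
      rfl
    rw [e]
    simpa only [map_smul, smul_eq_mul, innerSL_apply_apply] using h2
  have h3 := hasSum_sum fun i (_ : i ∈ F) => h1 i
  have hb : ∀ n, ‖∑ i ∈ F, -(inner ℂ (y n) (ζ i) * inner ℂ (ζ i) (x n))‖ ≤ ‖x n‖ * ‖y n‖ := by
    intro n
    have e : ∑ i ∈ F, -(inner ℂ (y n) (ζ i) * inner ℂ (ζ i) (x n))
        = -inner ℂ (∑ i ∈ F, inner ℂ (ζ i) (y n) • ζ i) (x n) := by
      rw [sum_inner, Finset.sum_neg_distrib]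
      simp only [inner_smul_left, inner_conj_symm]
    rw [e, norm_neg, mul_comm]
    exact (norm_inner_le_norm _ _).trans
      (mul_le_mul_of_nonneg_right (norm_partial_le ζ.orthonormal F (y n)) (norm_nonneg _))
  have h4 := tsum_of_norm_bounded hs.hasSum hb
  rw [h3.tsum_eq, ← Complex.ofReal_sum, Complex.norm_real] at h4
  exact (le_abs_self _).trans h4

variable {Λ M : L →ₗ[ℝ] L}

theorem IsHS.map_smul (h : IsHS ζ Λ) (c : ℂ) (v : L) : Λ (c • v) = starRingEnd ℂ c • Λ v :=
  conj_smul_of_antisymm h.antisymm c v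

theorem IsHS.sum_le (h : IsHS ζ Λ) (t : Finset ι) : ∑ i ∈ t, ‖Λ (ζ i)‖ ^ 2 ≤ hsSq ζ Λ :=
  h.summable.sum_le_tsum t fun _ _ => by positivity

theorem IsHS.norm_apply_sq_le (h : IsHS ζ Λ) (v : L) : ‖Λ v‖ ^ 2 ≤ hsSq ζ Λ * ‖v‖ ^ 2 := by
  refine hasSum_le (fun i => ?_) (hasSum_norm_sq_inner ζ (Λ v)) (h.summable.hasSum.mul_right _)
  rw [h.antisymm, norm_neg, ← mul_pow, mul_comm]
  gcongr
  exact norm_inner_le_norm _ _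

theorem IsHS.continuous (h : IsHS ζ Λ) : Continuous Λ := by
  refine AddMonoidHomClass.continuous_of_bound Λ (Real.sqrt (hsSq ζ Λ)) fun v => ?_
  refine abs_le_of_sq_le_sq' ?_ (by positivity) |>.2
  rw [mul_pow, Real.sq_sqrt (hsSq_nonneg ζ Λ)]
  exact h.norm_apply_sq_le v

/-- Antisymmetry exchanges the roles of the two families in the matrix elements of Λ, and Bessel's
inequality is then applied to d. This makes the singular values of Λ square summable. -/
theorem IsHS.sum_orthonormal_le (h : IsHS ζ Λ) {κ : Type*} {d : κ → L} (hd : Orthonormal ℂ d)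
    (F : Finset κ) : ∑ k ∈ F, ‖Λ (d k)‖ ^ 2 ≤ hsSq ζ Λ := by
  refine hasSum_le (fun i => ?_) (hasSum_sum fun k (_ : k ∈ F) => hasSum_norm_sq_inner ζ (Λ (d k)))
    h.summable.hasSum
  simp only [h.antisymm (ζ i), norm_neg]
  exact hd.sum_inner_products_le _

theorem IsHS.add (h : IsHS ζ Λ) (h' : IsHS ζ M) : IsHS ζ (Λ + M) := by
  refine ⟨fun ξ τ => ?_, ?_⟩
  · simp only [LinearMap.add_apply, inner_add_right, h.antisymm ξ τ, h'.antisymm ξ τ]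
    ring
  · refine Summable.of_nonneg_of_le (fun _ => by positivity) (fun i => ?_)
      ((h.summable.add h'.summable).mul_left 2)
    have := norm_add_le (Λ (ζ i)) (M (ζ i))
    calc ‖(Λ + M) (ζ i)‖ ^ 2 ≤ (‖Λ (ζ i)‖ + ‖M (ζ i)‖) ^ 2 := by
          rw [LinearMap.add_apply]; gcongr
      _ ≤ _ := by nlinarith [sq_nonneg (‖Λ (ζ i)‖ - ‖M (ζ i)‖)]

theorem IsHS.smul (h : IsHS ζ Λ) (c : ℝ) : IsHS ζ (c • Λ) := by
  refine ⟨fun ξ τ => ?_, ?_⟩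
  · have e : ∀ v : L, c • v = (c : ℂ) • v := fun v => (Complex.coe_smul c v).symm
    rw [LinearMap.smul_apply, LinearMap.smul_apply, e, e, inner_smul_right, inner_smul_right,
      h.antisymm]
    ring
  · simpa [norm_smul, mul_pow] using h.summable.mul_left (c ^ 2)

theorem IsHS.neg (h : IsHS ζ Λ) : IsHS ζ (-Λ) := by
  have := h.smul (-1)
  rwa [neg_smul, one_smul] at this

theorem IsHS.sub (h : IsHS ζ Λ) (h' : IsHS ζ M) : IsHS ζ (Λ - M) := by
  simpa [sub_eq_add_neg] using h.add h'.neg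

theorem isHS_zero : IsHS ζ (0 : L →ₗ[ℝ] L) := ⟨by simp, by simp⟩

/-- The antisymmetric conjugate linear map `η ↦ ⟨η, e⟩ f - ⟨η, f⟩ e`. -/
def rankTwo (e f : L) : L →ₗ[ℝ] L where
  toFun η := inner ℂ η e • f - inner ℂ η f • e
  map_add' η η' := by simp only [inner_add_left]; module
  map_smul' c η := by
    rw [← Complex.coe_smul c η, inner_smul_left, inner_smul_left, Complex.conj_ofReal,
      RingHom.id_apply, smul_sub, mul_smul, mul_smul, Complex.coe_smul, Complex.coe_smul]

theorem rankTwo_apply (e f η : L) : rankTwo e f η = inner ℂ η e • f - inner ℂ η f • e := rfl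

theorem isHS_rankTwo (e f : L) : IsHS ζ (rankTwo e f) := by
  refine ⟨fun ξ τ => ?_, ?_⟩
  · simp only [rankTwo_apply, inner_sub_right, inner_smul_right]
    ring
  · refine Summable.of_nonneg_of_le (fun _ => by positivity) (fun i => ?_)
      ((((hasSum_norm_sq_inner ζ e).summable.mul_right (‖f‖ ^ 2)).add
        ((hasSum_norm_sq_inner ζ f).summable.mul_right (‖e‖ ^ 2))).mul_left 2)
    have h := norm_sub_le (inner ℂ (ζ i) e • f) (inner ℂ (ζ i) f • e)
    rw [norm_smul, norm_smul] at h
    rw [rankTwo_apply]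
    calc _ ≤ (‖inner ℂ (ζ i) e‖ * ‖f‖ + ‖inner ℂ (ζ i) f‖ * ‖e‖) ^ 2 := by gcongr
      _ ≤ _ := by
        nlinarith [sq_nonneg (‖inner ℂ (ζ i) e‖ * ‖f‖ - ‖inner ℂ (ζ i) f‖ * ‖e‖)]

end HilbertSchmidt

/-! ### Pair annihilation and pair creation operators. -/

section Pair

variable {ι : Type*} [LinearOrder ι] {L : Type*} [NormedAddCommGroup L] [InnerProductSpace ℂ L]
  {ζ : HilbertBasis ι ℂ L} {Λ M : L →ₗ[ℝ] L} {N : ℕ} {ψ : Fock ι}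

/-- Anticommuting brings a(ζᵢ) next to ψ. The norms are then bounded by products of the square
summable sequences ‖Λ ζᵢ‖ and ‖a(ζᵢ) ψ‖. -/
theorem IsHS.summable_pair (h : IsHS ζ Λ) (hψ : ψ ∈ upTo ι N) :
    Summable fun i => annih ζ (ζ i) (annih ζ (Λ (ζ i)) ψ) := by
  have h2 : Summable fun i => ‖annih ζ (ζ i) ψ‖ ^ 2 :=
    summable_of_sum_le (fun _ => by positivity) (sum_norm_sq_annih_le ζ hψ)
  refine Summable.of_norm_bounded (h.summable.add h2) fun i => ?_
  rw [annih_annih_apply, norm_neg]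
  refine (norm_annih_apply_le ζ _ _).trans ?_
  nlinarith [sq_nonneg (‖Λ (ζ i)‖ - ‖annih ζ (ζ i) ψ‖), sq_nonneg ‖Λ (ζ i)‖,
    sq_nonneg ‖annih ζ (ζ i) ψ‖]

theorem IsHS.hasSum_pair (h : IsHS ζ Λ) (hψ : ψ ∈ upTo ι N) :
    HasSum (fun i => (1 / 2 : ℂ) • annih ζ (ζ i) (annih ζ (Λ (ζ i)) ψ)) (hatPair ζ Λ ψ) :=
  (h.summable_pair hψ).hasSum.const_smul _

theorem norm_half_smul_sq_le {E : Type*} [NormedAddCommGroup E] [NormedSpace ℂ E] (v : E) :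
    ‖(1 / 2 : ℂ) • v‖ ^ 2 ≤ ‖v‖ ^ 2 := by
  rw [norm_smul, mul_pow]
  norm_num
  nlinarith [sq_nonneg ‖v‖]

theorem IsHS.norm_hatPair_sq_le (h : IsHS ζ Λ) (hψ : ψ ∈ upTo ι N) :
    ‖hatPair ζ Λ ψ‖ ^ 2 ≤ N * hsSq ζ Λ * ‖ψ‖ ^ 2 := by
  refine (norm_half_smul_sq_le _).trans ?_
  refine le_of_tendsto ((h.summable_pair hψ).hasSum.norm.pow 2) (Eventually.of_forall fun t => ?_)
  have h1 : ‖∑ i ∈ t, annih ζ (ζ i) (annih ζ (Λ (ζ i)) ψ)‖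
      ≤ ∑ i ∈ t, ‖Λ (ζ i)‖ * ‖annih ζ (ζ i) ψ‖ :=
    (norm_sum_le _ _).trans (Finset.sum_le_sum fun i _ => by
      rw [annih_annih_apply, norm_neg]
      exact norm_annih_apply_le ζ _ _)
  have h2 := Finset.sum_mul_sq_le_sq_mul_sq t (fun i => ‖Λ (ζ i)‖) fun i => ‖annih ζ (ζ i) ψ‖
  calc _ ≤ (∑ i ∈ t, ‖Λ (ζ i)‖ * ‖annih ζ (ζ i) ψ‖) ^ 2 := pow_le_pow_left₀ (norm_nonneg _) h1 2
    _ ≤ _ := h2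
    _ ≤ hsSq ζ Λ * (N * ‖ψ‖ ^ 2) := mul_le_mul (h.sum_le t) (sum_norm_sq_annih_le ζ hψ t)
        (Finset.sum_nonneg fun _ _ => by positivity) (hsSq_nonneg ζ Λ)
    _ = _ := by ring

theorem IsHS.hatPair_mem_upTo (h : IsHS ζ Λ) (hψ : ψ ∈ upTo ι N) : hatPair ζ Λ ψ ∈ upTo ι N :=
  (isClosed_upTo N).mem_of_tendsto (h.hasSum_pair hψ) (Eventually.of_forall fun _ =>
    Submodule.sum_mem _ fun _ _ =>
      Submodule.smul_mem _ _ (annih_mem_upTo ζ _ (annih_mem_upTo ζ _ hψ)))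

theorem IsHS.hatPair_add (h : IsHS ζ Λ) {φ : Fock ι} (hψ : ψ ∈ upTo ι N) (hφ : φ ∈ upTo ι N) :
    hatPair ζ Λ (ψ + φ) = hatPair ζ Λ ψ + hatPair ζ Λ φ := by
  refine (h.hasSum_pair (Submodule.add_mem _ hψ hφ)).unique ?_
  simpa only [map_add, smul_add] using (h.hasSum_pair hψ).add (h.hasSum_pair hφ)

theorem IsHS.hatPair_smul (h : IsHS ζ Λ) (c : ℂ) (hψ : ψ ∈ upTo ι N) :
    hatPair ζ Λ (c • ψ) = c • hatPair ζ Λ ψ := by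
  refine (h.hasSum_pair (Submodule.smul_mem _ c hψ)).unique ?_
  simpa only [_root_.map_smul, smul_comm c] using (h.hasSum_pair hψ).const_smul c

theorem IsHS.add_hatPair (h : IsHS ζ Λ) (h' : IsHS ζ M) (hψ : ψ ∈ upTo ι N) :
    hatPair ζ (Λ + M) ψ = hatPair ζ Λ ψ + hatPair ζ M ψ := by
  refine ((h.add h').hasSum_pair hψ).unique ?_
  simpa only [LinearMap.add_apply, annih_add, map_add, smul_add, add_apply]
    using (h.hasSum_pair hψ).add (h'.hasSum_pair hψ)

theorem real_smul_eq {E : Type*} [NormedAddCommGroup E] [NormedSpace ℂ E] (c : ℝ) (v : E) :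
    c • v = (c : ℂ) • v := (Complex.coe_smul c v).symm

theorem IsHS.smul_hatPair (h : IsHS ζ Λ) (c : ℝ) (hψ : ψ ∈ upTo ι N) :
    hatPair ζ (c • Λ) ψ = (c : ℂ) • hatPair ζ Λ ψ := by
  refine ((h.smul c).hasSum_pair hψ).unique ?_
  have e : ∀ i, annih ζ ((c • Λ) (ζ i)) = (c : ℂ) • annih ζ (Λ (ζ i)) := fun i => by
    rw [LinearMap.smul_apply, ← Complex.coe_smul, annih_smul]
  simpa only [e, smul_apply, _root_.map_smul, smul_comm (c : ℂ)]
    using (h.hasSum_pair hψ).const_smul (c : ℂ)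

theorem IsHS.neg_hatPair (h : IsHS ζ Λ) (hψ : ψ ∈ upTo ι N) :
    hatPair ζ (-Λ) ψ = -hatPair ζ Λ ψ := by
  simpa using h.smul_hatPair (-1) hψ

theorem IsHS.sub_hatPair (h : IsHS ζ Λ) (h' : IsHS ζ M) (hψ : ψ ∈ upTo ι N) :
    hatPair ζ (Λ - M) ψ = hatPair ζ Λ ψ - hatPair ζ M ψ := by
  rw [sub_eq_add_neg, h.add_hatPair h'.neg hψ, h'.neg_hatPair hψ, sub_eq_add_neg]

theorem hatPair_rankTwo (e f : L) (ψ : Fock ι) :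
    hatPair ζ (rankTwo e f) ψ = annih ζ e (annih ζ f ψ) := by
  have h1 := ((hasSum_annih ζ e).mapL (ContinuousLinearMap.apply ℂ (Fock ι) (annih ζ f ψ))).sub
    ((hasSum_annih ζ f).mapL (ContinuousLinearMap.apply ℂ (Fock ι) (annih ζ e ψ)))
  rw [hatPair]
  have h2 : HasSum (fun i => annih ζ (ζ i) (annih ζ (rankTwo e f (ζ i)) ψ))
      ((2 : ℂ) • annih ζ e (annih ζ f ψ)) := by
    convert h1 using 1
    · funext i
      simp only [rankTwo_apply, annih_sub, annih_smul, sub_apply, smul_apply, map_sub,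
        _root_.map_smul, apply_apply, annih_basis]
    · rw [apply_apply, apply_apply, annih_annih_apply ζ f e, two_smul, sub_neg_eq_add]
  rw [h2.tsum_eq, smul_smul]
  norm_num

theorem IsHS.hatPair_annih (h : IsHS ζ Λ) (α : L) (hψ : ψ ∈ upTo ι N) :
    hatPair ζ Λ (annih ζ α ψ) = annih ζ α (hatPair ζ Λ ψ) := by
  refine (h.hasSum_pair (annih_mem_upTo ζ α hψ)).unique ?_
  refine Eq.mpr (congrArg (fun u => HasSum u _) (funext fun i => ?_))
    ((h.hasSum_pair hψ).mapL (annih ζ α))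
  rw [annih_annih_apply ζ _ α, map_neg, annih_annih_apply ζ _ α, neg_neg, _root_.map_smul]

/-- The creator is contracted with either of the two annihilators. By antisymmetry of Λ the two
contractions are equal, which uses up the factor 1/2. -/
theorem IsHS.hatPair_create (h : IsHS ζ Λ) (α : L) (hψ : ψ ∈ upTo ι N) :
    hatPair ζ Λ (create ζ α ψ) = create ζ α (hatPair ζ Λ ψ) - annih ζ (Λ α) ψ := by
  refine (h.hasSum_pair (create_mem_upTo ζ α hψ)).unique ?_
  have h1 := (h.hasSum_pair hψ).mapL (create ζ α)
  have h2 : HasSum (fun i => inner ℂ α (Λ (ζ i)) • annih ζ (ζ i) ψ) (-annih ζ (Λ α) ψ) := by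
    have := ((hasSum_annih ζ (Λ α)).mapL (ContinuousLinearMap.apply ℂ (Fock ι) ψ)).neg
    refine Eq.mpr (congrArg (fun u => HasSum u _) (funext fun i => ?_)) this
    rw [h.antisymm, apply_apply, smul_apply, annih_basis, neg_smul]
  have h3 : HasSum (fun i => inner ℂ α (ζ i) • annih ζ (Λ (ζ i)) ψ) (annih ζ (Λ α) ψ) := by
    have h4 : HasSum (fun i => Λ (inner ℂ (ζ i) α • ζ i)) (Λ α) :=
      (hasSum_expansion ζ α).map Λ h.continuous
    have := (h4.mapL (annihL ζ)).mapL (ContinuousLinearMap.apply ℂ (Fock ι) ψ)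
    refine Eq.mpr (congrArg (fun u => HasSum u _) (funext fun i => ?_)) this
    rw [h.map_smul, inner_conj_symm, annihL_apply, apply_apply, annih_smul, smul_apply]
  have h5 := h1.add ((h2.sub h3).const_smul (1 / 2 : ℂ))
  convert h5 using 1
  · funext i
    rw [annih_create_apply, map_sub, annih_create_apply, _root_.map_smul, _root_.map_smul]
    module
  · module

theorem sum_pairDag_le (hψ : ψ ∈ upTo ι N) (t : Finset ι) :
    ‖∑ i ∈ t, create ζ (Λ (ζ i)) (create ζ (ζ i) ψ)‖ ^ 2
      ≤ (N + 2) * (∑ i ∈ t, ‖Λ (ζ i)‖ ^ 2) * ‖ψ‖ ^ 2 := by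
  have h1 := norm_sq_sum_create_le ζ t (fun i => create ζ (Λ (ζ i)) ψ)
    (fun i => create_mem_upTo ζ _ hψ)
  have e : ∑ i ∈ t, create ζ (Λ (ζ i)) (create ζ (ζ i) ψ)
      = -∑ i ∈ t, create ζ (ζ i) (create ζ (Λ (ζ i)) ψ) := by
    rw [← Finset.sum_neg_distrib]
    exact Finset.sum_congr rfl fun i _ => create_create_apply ζ _ _ _
  rw [e, norm_neg]
  refine h1.trans ?_
  rw [mul_assoc, Finset.sum_mul]
  push_cast
  have h2 : ((N : ℝ) + 1 + 1) = N + 2 := by ring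
  rw [h2]
  refine mul_le_mul_of_nonneg_left (Finset.sum_le_sum fun i _ => ?_) (by positivity)
  rw [← mul_pow]
  exact pow_le_pow_left₀ (norm_nonneg _) (norm_create_apply_le ζ _ _) 2

theorem IsHS.summable_pairDag (h : IsHS ζ Λ) (hψ : ψ ∈ upTo ι N) :
    Summable fun i => create ζ (Λ (ζ i)) (create ζ (ζ i) ψ) := by
  refine summable_iff_vanishing_norm.2 fun ε hε => ?_
  have hC : 0 < ((N : ℝ) + 2) * (‖ψ‖ ^ 2 + 1) := by positivity
  obtain ⟨s, hs⟩ := summable_iff_vanishing_norm.1 h.summable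
    (ε ^ 2 / (((N : ℝ) + 2) * (‖ψ‖ ^ 2 + 1))) (by positivity)
  refine ⟨s, fun t ht => ?_⟩
  have h1 := sum_pairDag_le (ζ := ζ) (Λ := Λ) hψ t
  have h2 := (le_abs_self _).trans_lt (hs t ht)
  rw [lt_div_iff₀ hC] at h2
  have h3 : 0 ≤ ∑ i ∈ t, ‖Λ (ζ i)‖ ^ 2 := Finset.sum_nonneg fun _ _ => by positivity
  have h4 : 0 ≤ ((N : ℝ) + 2) * ∑ i ∈ t, ‖Λ (ζ i)‖ ^ 2 := by positivity
  refine lt_of_pow_lt_pow_left₀ 2 hε.le (h1.trans_lt (lt_of_le_of_lt ?_ h2))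
  nlinarith

theorem IsHS.hasSum_pairDag (h : IsHS ζ Λ) (hψ : ψ ∈ upTo ι N) :
    HasSum (fun i => (1 / 2 : ℂ) • create ζ (Λ (ζ i)) (create ζ (ζ i) ψ)) (hatPairDag ζ Λ ψ) :=
  (h.summable_pairDag hψ).hasSum.const_smul _

theorem IsHS.norm_hatPairDag_sq_le (h : IsHS ζ Λ) (hψ : ψ ∈ upTo ι N) :
    ‖hatPairDag ζ Λ ψ‖ ^ 2 ≤ (N + 2) * hsSq ζ Λ * ‖ψ‖ ^ 2 := by
  refine (norm_half_smul_sq_le _).trans ?_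
  refine le_of_tendsto ((h.summable_pairDag hψ).hasSum.norm.pow 2)
    (Eventually.of_forall fun t => (sum_pairDag_le (ζ := ζ) (Λ := Λ) hψ t).trans ?_)
  have := h.sum_le t
  gcongr

theorem IsHS.hatPairDag_mem_upTo (h : IsHS ζ Λ) (hψ : ψ ∈ upTo ι N) :
    hatPairDag ζ Λ ψ ∈ upTo ι (N + 2) :=
  (isClosed_upTo (N + 2)).mem_of_tendsto (h.hasSum_pairDag hψ) (Eventually.of_forall fun _ =>
    Submodule.sum_mem _ fun _ _ =>
      Submodule.smul_mem _ _ (create_mem_upTo ζ _ (create_mem_upTo ζ _ hψ)))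

theorem IsHS.hatPairDag_add (h : IsHS ζ Λ) {φ : Fock ι} (hψ : ψ ∈ upTo ι N) (hφ : φ ∈ upTo ι N) :
    hatPairDag ζ Λ (ψ + φ) = hatPairDag ζ Λ ψ + hatPairDag ζ Λ φ := by
  refine (h.hasSum_pairDag (Submodule.add_mem _ hψ hφ)).unique ?_
  simpa only [map_add, smul_add] using (h.hasSum_pairDag hψ).add (h.hasSum_pairDag hφ)

theorem IsHS.hatPairDag_smul (h : IsHS ζ Λ) (c : ℂ) (hψ : ψ ∈ upTo ι N) :
    hatPairDag ζ Λ (c • ψ) = c • hatPairDag ζ Λ ψ := by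
  refine (h.hasSum_pairDag (Submodule.smul_mem _ c hψ)).unique ?_
  simpa only [_root_.map_smul, smul_comm c] using (h.hasSum_pairDag hψ).const_smul c

theorem IsHS.sub_hatPairDag (h : IsHS ζ Λ) (h' : IsHS ζ M) (hψ : ψ ∈ upTo ι N) :
    hatPairDag ζ (Λ - M) ψ = hatPairDag ζ Λ ψ - hatPairDag ζ M ψ := by
  refine ((h.sub h').hasSum_pairDag hψ).unique ?_
  simpa only [LinearMap.sub_apply, create_sub, smul_sub, sub_apply]
    using (h.hasSum_pairDag hψ).sub (h'.hasSum_pairDag hψ)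

theorem IsHS.add_hatPairDag (h : IsHS ζ Λ) (h' : IsHS ζ M) (hψ : ψ ∈ upTo ι N) :
    hatPairDag ζ (Λ + M) ψ = hatPairDag ζ Λ ψ + hatPairDag ζ M ψ := by
  refine ((h.add h').hasSum_pairDag hψ).unique ?_
  simpa only [LinearMap.add_apply, create_add, smul_add, add_apply]
    using (h.hasSum_pairDag hψ).add (h'.hasSum_pairDag hψ)

theorem hatPairDag_rankTwo (e f : L) (ψ : Fock ι) :
    hatPairDag ζ (rankTwo e f) ψ = create ζ f (create ζ e ψ) := by
  have h1 := (((hasSum_create ζ e).mapL (ContinuousLinearMap.apply ℂ (Fock ι) ψ)).mapL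
    (create ζ f)).sub
    (((hasSum_create ζ f).mapL (ContinuousLinearMap.apply ℂ (Fock ι) ψ)).mapL (create ζ e))
  rw [hatPairDag]
  have h2 : HasSum (fun i => create ζ (rankTwo e f (ζ i)) (create ζ (ζ i) ψ))
      ((2 : ℂ) • create ζ f (create ζ e ψ)) := by
    convert h1 using 1
    · funext i
      simp only [rankTwo_apply, create_sub, create_smul, sub_apply, smul_apply, inner_conj_symm,
        _root_.map_smul, apply_apply]
    · rw [apply_apply, apply_apply, create_create_apply ζ e f, two_smul, sub_neg_eq_add]
  rw [h2.tsum_eq, smul_smul]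
  norm_num

theorem IsHS.hatPairDag_create (h : IsHS ζ Λ) (α : L) (hψ : ψ ∈ upTo ι N) :
    hatPairDag ζ Λ (create ζ α ψ) = create ζ α (hatPairDag ζ Λ ψ) := by
  refine (h.hasSum_pairDag (create_mem_upTo ζ α hψ)).unique ?_
  refine Eq.mpr (congrArg (fun u => HasSum u _) (funext fun i => ?_))
    ((h.hasSum_pairDag hψ).mapL (create ζ α))
  rw [create_create_apply ζ _ α, map_neg, create_create_apply ζ _ α, neg_neg, _root_.map_smul]

/-- The pair annihilation operator on the vectors with at most `N` particles. -/
def pairN (N : ℕ) (h : IsHS ζ Λ) : Sector ι N →L[ℂ] Sector ι N :=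
  sectorMap (hatPair ζ Λ) (fun _ hψ => h.hatPair_mem_upTo hψ)
    (fun _ hψ _ hφ => h.hatPair_add hψ hφ) (fun c _ hψ => h.hatPair_smul c hψ)
    (Real.sqrt (N * hsSq ζ Λ)) (fun ψ hψ => by
      have h0 : 0 ≤ (N : ℝ) * hsSq ζ Λ := mul_nonneg N.cast_nonneg (hsSq_nonneg ζ Λ)
      refine abs_le_of_sq_le_sq' ?_ (by positivity) |>.2
      rw [mul_pow, Real.sq_sqrt h0]
      exact h.norm_hatPair_sq_le hψ)

theorem incl_pairN (h : IsHS ζ Λ) (v : Sector ι N) :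
    incl ι N (pairN N h v) = hatPair ζ Λ (incl ι N v) := rfl

theorem norm_pairN_le (h : IsHS ζ Λ) : ‖pairN N h‖ ≤ Real.sqrt (N * hsSq ζ Λ) :=
  norm_sectorMap_le _ _ _ (Real.sqrt_nonneg _) _

end Pair

/-! ### Canonical form of the maps in Ξ(L). -/

section Canonical

variable {L : Type*} [NormedAddCommGroup L] [InnerProductSpace ℂ L] [CompleteSpace L]

theorem IsTraceClass.isCompactOperator {T : L →L[ℂ] L} (h : IsTraceClass T) :
    IsCompactOperator T := by
  obtain ⟨x, y, hs, hl⟩ := h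
  have hsum : Summable fun n => InnerProductSpace.rankOne ℂ (x n) (y n) :=
    Summable.of_norm (by simpa using hs)
  have hT : HasSum (fun n => InnerProductSpace.rankOne ℂ (x n) (y n)) T := by
    convert hsum.hasSum
    ext v
    refine (hl v).unique ?_
    simpa using hsum.hasSum.mapL (ContinuousLinearMap.apply ℂ L v)
  refine isCompactOperator_of_tendsto hT (Eventually.of_forall fun s => ?_)
  refine (Submodule.sum_mem (compactOperator (RingHom.id ℂ) L L) fun n _ => ?_ :
    ∑ n ∈ s, InnerProductSpace.rankOne ℂ (x n) (y n) ∈ compactOperator (RingHom.id ℂ) L L)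
  change IsCompactOperator _
  rw [InnerProductSpace.rankOne_def']
  exact (isCompactOperator_of_locallyCompactSpace_rng (toSpanSingleton ℂ (x n))).comp_clm _

/-- A canonical form of an antisymmetric conjugate linear map: an orthonormal family of pairs
`e k, f k` with `Λ (e k) = lam k • f k`, `Λ (f k) = -lam k • e k`, and `Λ = 0` on the orthogonal
complement. -/
structure IsCanonical (Λ : L →ₗ[ℝ] L) {κ : Type*} (e f : κ → L) (lam : κ → ℝ) : Prop where
  pos : ∀ k, 0 < lam k
  orthonormal : Orthonormal ℂ (Sum.elim e f)
  map_e : ∀ k, Λ (e k) = (lam k : ℂ) • f k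
  map_f : ∀ k, Λ (f k) = -((lam k : ℂ) • e k)
  map_perp : ∀ v, (∀ k, inner ℂ (e k) v = 0) → (∀ k, inner ℂ (f k) v = 0) → Λ v = 0

/-- The sets of pairwise compatible eigenvectors of the square of `Λ`. -/
def PairSet (Λ : L →ₗ[ℝ] L) (E : Set L) : Prop :=
  (∀ e ∈ E, ‖e‖ = 1 ∧ Λ e ≠ 0 ∧ Λ (Λ e) = -((‖Λ e‖ ^ 2 : ℝ) : ℂ) • e) ∧
    ∀ e ∈ E, ∀ e' ∈ E, e ≠ e' → inner ℂ e e' = 0 ∧ inner ℂ e (Λ e') = 0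

theorem exists_maximal_pairSet (Λ : L →ₗ[ℝ] L) : ∃ E, Maximal (PairSet Λ) E := by
  refine zorn_subset {E | PairSet Λ E} fun c hc hchain => ⟨⋃₀ c, ⟨?_, ?_⟩, fun s hs =>
    Set.subset_sUnion_of_mem hs⟩
  · rintro e ⟨s, hs, he⟩
    exact (hc hs).1 e he
  · rintro e ⟨s, hs, he⟩ e' ⟨s', hs', he'⟩ hne
    rcases hchain.total hs hs' with h | h
    · exact (hc hs').2 e (h he) e' he' hne
    · exact (hc hs).2 e he e' (h he') hne

variable {Λ : L →ₗ[ℝ] L}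

theorem IsXi.map_smul (h : IsXi Λ) (c : ℂ) (v : L) : Λ (c • v) = starRingEnd ℂ c • Λ v :=
  conj_smul_of_antisymm h.antisymm c v

theorem IsXi.inner_self_map (h : IsXi Λ) (v : L) : inner ℂ v (Λ v) = 0 :=
  self_eq_neg.1 (h.antisymm v v)

theorem IsXi.inner_sq (h : IsXi Λ) (v w : L) : inner ℂ v (Λ (Λ w)) = -inner ℂ (Λ w) (Λ v) :=
  h.antisymm _ _

/-- On W the operator Λ² is compact and self-adjoint, and nonzero since ⟨w, Λ² w⟩ = -‖Λ w‖². It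
therefore has a nonzero eigenvalue, and the same formula identifies that eigenvalue at a unit
eigenvector. -/
theorem exists_eigenvector_of_invariant (h : IsXi Λ) {W : Submodule ℂ L} (hW : IsClosed (W : Set L))
    (hΛ : ∀ v ∈ W, Λ v ∈ W) {w : L} (hw : w ∈ W) (hw0 : Λ w ≠ 0) :
    ∃ e ∈ W, ‖e‖ = 1 ∧ Λ e ≠ 0 ∧ Λ (Λ e) = -((‖Λ e‖ ^ 2 : ℝ) : ℂ) • e := by
  obtain ⟨T, hT, hTc⟩ := h.sq_traceClass
  have hTW : ∀ v ∈ W, (T : L →ₗ[ℂ] L) v ∈ W := fun v hv => by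
    change T v ∈ W
    rw [hT]
    exact hΛ _ (hΛ _ hv)
  have hcW : CompleteSpace W := hW.completeSpace_coe
  have hsymm : (T : L →ₗ[ℂ] L).IsSymmetric := fun v w => by
    change inner ℂ (T v) w = inner ℂ v (T w)
    rw [hT, hT, h.inner_sq, ← inner_conj_symm, h.inner_sq, map_neg, inner_conj_symm]
  have hS : IsCompactOperator (T.restrict hTW) :=
    (hTc.isCompactOperator).restrict' hTW
  have hSs : ((T.restrict hTW : W →L[ℂ] W) : W →ₗ[ℂ] W).IsSymmetric := hsymm.restrict_invariant hTW
  have hne : T.restrict hTW ≠ 0 := fun h0 => by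
    have h1 : T w = 0 := congrArg Subtype.val (congrArg (fun S : W →L[ℂ] W => S ⟨w, hw⟩) h0)
    have h2 := h.inner_sq w w
    rw [← hT, h1, inner_zero_right, zero_eq_neg] at h2
    exact hw0 (inner_self_eq_zero.1 h2)
  have := mt (eq_zero_of_forall_hasEigenvalue_eq_zero hS hSs).1 hne
  push Not at this
  obtain ⟨m, hm, hm0⟩ := this
  obtain ⟨⟨u, huW⟩, hu⟩ := hm.exists_hasEigenvector
  have hu0 : u ≠ 0 := fun h0 => hu.2 (Subtype.ext h0)
  have hTu : Λ (Λ u) = m • u := by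
    rw [← hT]
    exact congrArg Subtype.val hu.apply_eq_smul
  set c : ℂ := ((‖u‖⁻¹ : ℝ) : ℂ) with hc
  have hu1 : ‖c • u‖ = 1 := by
    rw [hc, norm_smul, Complex.norm_real, norm_inv, norm_norm, inv_mul_cancel₀ (norm_ne_zero_iff.2 hu0)]
  have hTe : Λ (Λ (c • u)) = m • (c • u) := by
    rw [h.map_smul, h.map_smul, hTu, smul_comm m]
    congr 1
    simp
  have hm' : m = -((‖Λ (c • u)‖ ^ 2 : ℝ) : ℂ) := by
    have h1 := h.inner_sq (c • u) (c • u)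
    rw [hTe, inner_smul_right, inner_self_eq_norm_sq_to_K, inner_self_eq_norm_sq_to_K, hu1] at h1
    simpa using h1
  refine ⟨c • u, W.smul_mem c huW, hu1, fun h0 => hm0 ?_, by rw [hTe, ← hm']⟩
  rw [hm', h0]
  simp

/-- The partner of e is Λ e / ‖Λ e‖, orthogonal to e by antisymmetry. For a maximal compatible
family the orthogonal complement of all pairs is invariant under Λ, and Λ vanishes there, since
otherwise the complement would contain a further eigenvector. -/
theorem IsXi.exists_canonical (h : IsXi Λ) :
    ∃ (E : Set L) (f : E → L) (lam : E → ℝ), IsCanonical Λ (fun e : E => (e : L)) f lam := by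
  classical
  obtain ⟨E, hE⟩ := exists_maximal_pairSet Λ
  have hpos : ∀ e : E, 0 < ‖Λ e‖ := fun e => norm_pos_iff.2 (hE.prop.1 e e.2).2.1
  have hne : ∀ e : E, ((‖Λ e‖ : ℝ) : ℂ) ≠ 0 := fun e => by exact_mod_cast (hpos e).ne'
  have hef : ∀ e e' : E, inner ℂ (e : L) (Λ e') = 0 := fun e e' => by
    by_cases hee : (e : L) = e'
    · rw [hee]; exact h.inner_self_map _
    · exact (hE.prop.2 e e.2 e' e'.2 hee).2
  have hff : ∀ e e' : E, inner ℂ (Λ e) (Λ e') = ((‖Λ e‖ ^ 2 : ℝ) : ℂ) * inner ℂ (e' : L) e := by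
    intro e e'
    rw [← neg_inj, ← h.inner_sq, (hE.prop.1 e e.2).2.2, inner_smul_right, neg_mul]
  refine ⟨E, fun e => ((‖Λ e‖ : ℂ))⁻¹ • Λ e, fun e => ‖Λ e‖, hpos, ?_, fun e => ?_, fun e => ?_, ?_⟩
  · rw [orthonormal_iff_ite]
    have hee : ∀ e e' : E, inner ℂ (e : L) e' = if e = e' then (1 : ℂ) else 0 := fun e e' => by
      split_ifs with hh
      · rw [hh, inner_self_eq_norm_sq_to_K, (hE.prop.1 e' e'.2).1]; simp
      · exact (hE.prop.2 e e.2 e' e'.2 fun h' => hh (Subtype.ext h')).1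
    rintro (e | e) (e' | e')
    · simp [hee]
    · simp [inner_smul_right, hef]
    · simp only [Sum.elim_inl, Sum.elim_inr, inner_smul_left]
      rw [← inner_conj_symm, hef]
      simp
    · simp only [Sum.elim_inr, inner_smul_left, inner_smul_right, hff, hee, Sum.inr.injEq]
      by_cases hh : e = e'
      · subst hh
        have := hne e
        simp
        field_simp
      · simp [hh, Ne.symm hh]
  · rw [smul_smul, mul_inv_cancel₀ (hne e), one_smul]
  · rw [h.map_smul, (hE.prop.1 e e.2).2.2, smul_smul, ← neg_smul]
    congr 1
    have := hne e
    simp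
    field_simp
  · intro v he hf
    by_contra hv
    let W : Submodule ℂ L :=
      { carrier := {v | ∀ e : E, inner ℂ (e : L) v = 0 ∧ inner ℂ (Λ e) v = 0}
        add_mem' := fun {a b} ha hb e => by simp [ha e, hb e]
        zero_mem' := fun e => by simp
        smul_mem' := fun c a ha e => by simp [ha e] }
    have hW : IsClosed (W : Set L) := by
      have : (W : Set L) = ⋂ e : E, ({v | inner ℂ (e : L) v = 0} ∩ {v | inner ℂ (Λ e) v = 0}) := by
        ext v
        simp only [Set.mem_iInter]
        rfl
      rw [this]
      exact isClosed_iInter fun e => (isClosed_eq (continuous_const.inner continuous_id)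
        continuous_const).inter (isClosed_eq (continuous_const.inner continuous_id) continuous_const)
    have hΛW : ∀ w ∈ W, Λ w ∈ W := fun w hw e => by
      refine ⟨?_, ?_⟩
      · rw [h.antisymm, ← inner_conj_symm, (hw e).2]
        simp
      · rw [← neg_inj, ← h.inner_sq, (hE.prop.1 e e.2).2.2, inner_smul_right, ← inner_conj_symm,
          (hw e).1]
        simp
    have hvW : v ∈ W := fun e => by
      refine ⟨he e, ?_⟩
      have := hf e
      rw [inner_smul_left] at this
      refine (mul_eq_zero.1 this).resolve_left ?_
      simpa using hne e
    obtain ⟨u, huW, hu1, hu0, hu⟩ := exists_eigenvector_of_invariant h hW hΛW hvW hv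
    have hmem : u ∈ E := by
      refine hE.le_of_ge (y := insert u E) ⟨?_, ?_⟩ (Set.subset_insert u E) (Set.mem_insert u E)
      · rintro e (rfl | he)
        · exact ⟨hu1, hu0, hu⟩
        · exact hE.prop.1 e he
      · rintro e (rfl | he) e' (rfl | he') hne'
        · exact absurd rfl hne'
        · have := huW ⟨e', he'⟩
          exact ⟨by rw [← inner_conj_symm, this.1, map_zero], by rw [← inner_conj_symm, this.2, map_zero]⟩
        · have := huW ⟨e, he⟩
          exact ⟨this.1, by rw [h.antisymm, ← inner_conj_symm, this.2, map_zero, neg_zero]⟩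
        · exact hE.prop.2 e he e' he' hne'
    -- Being both in E and orthogonal to E, the unit vector u is orthogonal to itself.
    have := (huW ⟨u, hmem⟩).1
    rw [inner_self_eq_norm_sq_to_K, hu1] at this
    simp at this

end Canonical

/-! ### Existence and uniqueness of μ and β. -/

section MuBeta

variable {L : Type*} [NormedAddCommGroup L] [InnerProductSpace ℂ L] [CompleteSpace L]
  {Λ : L →ₗ[ℝ] L}

theorem eq_of_exp_eq {a b : L →L[ℂ] L} (ha : IsSelfAdjoint a) (hb : IsSelfAdjoint b)
    (h : NormedSpace.exp a = NormedSpace.exp b) : a = b := by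
  rw [← CFC.log_exp a ha, h, CFC.log_exp b hb]

theorem IsMu.ext {μ μ' : L →L[ℂ] L} (h : IsMu Λ μ) (h' : IsMu Λ μ') : μ = μ' := by
  refine neg_injective (eq_of_exp_eq h.positive.isSelfAdjoint h'.positive.isSelfAdjoint ?_)
  ext v
  rw [h.exp_neg, h'.exp_neg]

theorem clm_ext_of_orthonormal {κ : Type*} {d : κ → L} {A B : L →L[ℂ] L}
    (h : ∀ k, A (d k) = B (d k)) (hp : ∀ v, (∀ k, inner ℂ (d k) v = 0) → A v = B v) : A = B := by
  set K : Submodule ℂ L := (Submodule.span ℂ (Set.range d)).topologicalClosure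
  have hK : IsClosed (K : Set L) := Submodule.isClosed_topologicalClosure _
  have : CompleteSpace K := hK.completeSpace_coe
  ext v
  obtain ⟨y, hy, z, hz, rfl⟩ := K.exists_add_mem_mem_orthogonal v
  rw [map_add, map_add]
  congr 1
  · have hle : K ≤ LinearMap.eqLocus (A : L →ₗ[ℂ] L) (B : L →ₗ[ℂ] L) := by
      refine Submodule.topologicalClosure_minimal _ (Submodule.span_le.2 ?_)
        (isClosed_eq A.continuous B.continuous)
      rintro _ ⟨k, rfl⟩
      exact h k
    exact hle hy
  · refine hp z fun k => hz _ (Submodule.le_topologicalClosure _ (Submodule.subset_span ⟨k, rfl⟩))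

variable {κ : Type*} {e f : κ → L} {lam : κ → ℝ}

/-- The eigenvalue of `μ` on both vectors of the pair `k`. -/
def muEig (lam : κ → ℝ) (p : κ ⊕ κ) : ℝ := -Real.log (1 + lam (Sum.elim id id p) ^ 2)

theorem muEig_nonpos (lam : κ → ℝ) (p : κ ⊕ κ) : muEig lam p ≤ 0 :=
  neg_nonpos.2 (Real.log_nonneg (by nlinarith [sq_nonneg (lam (Sum.elim id id p))]))

theorem abs_muEig_le (lam : κ → ℝ) (p : κ ⊕ κ) : |muEig lam p| ≤ lam (Sum.elim id id p) ^ 2 := by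
  rw [abs_of_nonpos (muEig_nonpos lam p), muEig, neg_neg]
  have := Real.log_le_sub_one_of_pos (show 0 < 1 + lam (Sum.elim id id p) ^ 2 by positivity)
  linarith

theorem exp_neg_muEig (lam : κ → ℝ) (p : κ ⊕ κ) :
    Complex.exp (-(muEig lam p : ℂ)) = 1 + (lam (Sum.elim id id p) : ℂ) ^ 2 := by
  rw [muEig, Complex.ofReal_neg, neg_neg, ← Complex.ofReal_exp, Real.exp_log (by positivity)]
  push_cast
  rfl

variable {ι : Type*} [LinearOrder ι] {ζ : HilbertBasis ι ℂ L}

theorem IsCanonical.norm_f (hc : IsCanonical Λ e f lam) (k : κ) : ‖f k‖ = 1 :=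
  hc.orthonormal.1 (Sum.inr k)

theorem IsCanonical.summable_sq (hc : IsCanonical Λ e f lam) (h : IsHS ζ Λ) :
    Summable fun k => lam k ^ 2 := by
  refine summable_of_sum_le (c := hsSq ζ Λ) (fun _ => by positivity) fun F => ?_
  have he : Orthonormal ℂ e := hc.orthonormal.comp Sum.inl Sum.inl_injective
  refine le_trans (le_of_eq ?_) (h.sum_orthonormal_le he F)
  refine Finset.sum_congr rfl fun k _ => ?_
  rw [hc.map_e, norm_smul, hc.norm_f, mul_one, Complex.norm_real, Real.norm_eq_abs, sq_abs]

theorem IsCanonical.countable (hc : IsCanonical Λ e f lam) (hs : Summable fun k => lam k ^ 2) :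
    Countable κ := by
  have := hs.countable_support
  have hu : (Function.support fun k => lam k ^ 2) = Set.univ := by
    ext k
    simp [(hc.pos k).ne']
  rw [hu] at this
  exact Set.countable_univ_iff.1 this

theorem summable_muEig (hs : Summable fun k => lam k ^ 2) : Summable fun p => |muEig lam p| := by
  have : Summable fun p : κ ⊕ κ => lam (Sum.elim id id p) ^ 2 := Summable.sum _ hs hs
  exact Summable.of_nonneg_of_le (fun _ => abs_nonneg _) (abs_muEig_le lam) this

/-- The operator `μ` in terms of a canonical form. -/
def muCan (e f : κ → L) (lam : κ → ℝ) : L →L[ℂ] L :=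
  ∑' p, (muEig lam p : ℂ) • InnerProductSpace.rankOne ℂ (Sum.elim e f p) (Sum.elim e f p)

theorem IsCanonical.hasSum_muCan (hc : IsCanonical Λ e f lam) (hs : Summable fun k => lam k ^ 2) :
    HasSum (fun p => (muEig lam p : ℂ) •
      InnerProductSpace.rankOne ℂ (Sum.elim e f p) (Sum.elim e f p)) (muCan e f lam) := by
  refine Summable.hasSum (Summable.of_norm_bounded (summable_muEig hs) fun p => ?_)
  rw [norm_smul, InnerProductSpace.norm_rankOne, hc.orthonormal.1 p]
  simp

theorem IsCanonical.hasSum_muCan_apply (hc : IsCanonical Λ e f lam)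
    (hs : Summable fun k => lam k ^ 2) (v : L) :
    HasSum (fun p => inner ℂ (Sum.elim e f p) v • ((muEig lam p : ℂ) • Sum.elim e f p))
      (muCan e f lam v) := by
  have := (hc.hasSum_muCan hs).mapL (ContinuousLinearMap.apply ℂ L v)
  refine Eq.mpr (congrArg (fun u => HasSum u _) (funext fun p => ?_)) this
  rw [apply_apply, smul_apply, InnerProductSpace.rankOne_apply, smul_comm]

theorem IsCanonical.summable_norm_muCan (hc : IsCanonical Λ e f lam)
    (hs : Summable fun k => lam k ^ 2) :
    Summable fun p => ‖(muEig lam p : ℂ) • Sum.elim e f p‖ * ‖Sum.elim e f p‖ := by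
  refine Eq.mpr (congrArg Summable (funext fun p => ?_)) (summable_muEig hs)
  rw [norm_smul, hc.orthonormal.1 p]
  simp

theorem IsCanonical.muCan_apply (hc : IsCanonical Λ e f lam) (hs : Summable fun k => lam k ^ 2)
    (p : κ ⊕ κ) : muCan e f lam (Sum.elim e f p) = (muEig lam p : ℂ) • Sum.elim e f p := by
  classical
  refine (hc.hasSum_muCan_apply hs _).unique ?_
  refine Eq.mpr (congrArg (fun u => HasSum u _) (funext fun q => ?_))
    (hasSum_ite_eq p ((muEig lam p : ℂ) • Sum.elim e f p))
  rw [orthonormal_iff_ite.1 hc.orthonormal q p]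
  split_ifs with h
  · rw [h, one_smul]
  · rw [zero_smul]

theorem IsCanonical.muCan_perp (hc : IsCanonical Λ e f lam) (hs : Summable fun k => lam k ^ 2)
    {v : L} (hv : ∀ p, inner ℂ (Sum.elim e f p) v = 0) : muCan e f lam v = 0 := by
  refine (hc.hasSum_muCan_apply hs v).unique ?_
  simp only [hv, zero_smul]
  exact hasSum_zero

theorem IsCanonical.map_map (hc : IsCanonical Λ e f lam)
    (ha : ∀ ξ τ, inner ℂ ξ (Λ τ) = -inner ℂ τ (Λ ξ)) (p : κ ⊕ κ) :
    Λ (Λ (Sum.elim e f p)) = -((lam (Sum.elim id id p) : ℂ) ^ 2 • Sum.elim e f p) := by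
  rcases p with k | k
  · simp only [Sum.elim_inl, hc.map_e, conj_smul_of_antisymm ha, hc.map_f, Complex.conj_ofReal, id]
    module
  · simp only [Sum.elim_inr, hc.map_f, map_neg, conj_smul_of_antisymm ha, hc.map_e,
      Complex.conj_ofReal, id]
    module

theorem IsCanonical.isMu (hc : IsCanonical Λ e f lam) (hs : Summable fun k => lam k ^ 2)
    (h : IsXi Λ) : IsMu Λ (muCan e f lam) := by
  have := hc.countable hs
  refine ⟨isTraceClass_of_hasSum (hc.summable_norm_muCan hs) (hc.hasSum_muCan_apply hs), ?_, ?_⟩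
  · rw [isPositive_iff_complex]
    intro v
    have h1 : HasSum (fun p => ((-muEig lam p * ‖inner ℂ (Sum.elim e f p) v‖ ^ 2 : ℝ) : ℂ))
        (inner ℂ ((-muCan e f lam) v) v) := by
      have h2 := (((hc.hasSum_muCan_apply hs v).mapL (innerSL ℂ v)).neg).star
      have e1 : star (-(innerSL ℂ v) (muCan e f lam v)) = inner ℂ ((-muCan e f lam) v) v := by
        rw [neg_apply, inner_neg_left, innerSL_apply_apply, star_neg]
        exact congrArg Neg.neg (inner_conj_symm _ _)
      rw [e1] at h2
      refine Eq.mpr (congrArg (fun u => HasSum u _) (funext fun p => ?_)) h2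
      rw [innerSL_apply_apply, inner_smul_right, inner_smul_right]
      have e2 : inner ℂ v (Sum.elim e f p) = star (inner ℂ (Sum.elim e f p) v : ℂ) :=
        (inner_conj_symm _ _).symm
      rw [e2]
      simp only [star_neg, star_mul', star_star]
      push_cast
      rw [← Complex.conj_mul', starRingEnd_apply]
      have e3 : star (muEig lam p : ℂ) = muEig lam p := Complex.conj_ofReal _
      rw [e3]
      change _ = -(star _ * _)
      ring
    have hre := Complex.hasSum_re h1
    have him := Complex.hasSum_im h1
    simp only [Complex.ofReal_im, Complex.ofReal_re] at hre him
    refine ⟨Complex.ext rfl ?_, hre.nonneg fun p => ?_⟩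
    · rw [Complex.ofReal_im]
      exact hasSum_zero.unique him
    · exact mul_nonneg (neg_nonneg.2 (muEig_nonpos lam p)) (by positivity)
  · obtain ⟨T, hT, -⟩ := h.sq_traceClass
    have : NormedSpace.exp (-muCan e f lam) = 1 - T := by
      refine clm_ext_of_orthonormal (d := Sum.elim e f) (fun p => ?_) fun v hv => ?_
      · rw [exp_apply_of_eigenvector (c := -(muEig lam p : ℂ)), exp_neg_muEig, sub_apply, hT,
          hc.map_map h.antisymm, one_apply_eq_self]
        · module
        · rw [neg_apply, hc.muCan_apply hs, neg_smul]
      · rw [exp_apply_of_eigenvector (c := 0), Complex.exp_zero, sub_apply, hT,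
          hc.map_perp v (fun k => hv (Sum.inl k)) (fun k => hv (Sum.inr k)), map_zero,
          one_apply_eq_self, one_smul, sub_zero]
        rw [neg_apply, hc.muCan_perp hs hv, neg_zero, zero_smul]
    intro v
    rw [this, sub_apply, hT, one_apply_eq_self]

theorem existsUnique_isMu (ζ : HilbertBasis ι ℂ L) (h : IsXi Λ) : ∃! μ : L →L[ℂ] L, IsMu Λ μ := by
  obtain ⟨E, f, lam, hc⟩ := h.exists_canonical
  exact ⟨_, hc.isMu (hc.summable_sq (h.isHS (ζ := ζ))) h, fun μ' h' =>
    h'.ext (hc.isMu (hc.summable_sq (h.isHS (ζ := ζ))) h)⟩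

variable {μ : L →L[ℂ] L}

theorem IsMu.isSelfAdjoint (hμ : IsMu Λ μ) : IsSelfAdjoint μ := by
  simpa using hμ.positive.isSelfAdjoint.neg

theorem inner_exp_left {μ : L →L[ℂ] L} (h : IsSelfAdjoint μ) (v w : L) :
    inner ℂ (NormedSpace.exp μ v) w = inner ℂ v (NormedSpace.exp μ w) := by
  have := h.exp
  rw [← adjoint_inner_right, ← ContinuousLinearMap.star_eq_adjoint, this.star_eq]

theorem exp_neg_exp_apply (μ : L →L[ℂ] L) (v : L) :
    NormedSpace.exp (-μ) (NormedSpace.exp μ v) = v := by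
  rw [← mul_apply_eq_comp, exp_neg_mul_exp, one_apply_eq_self]

theorem exp_exp_neg_apply (μ : L →L[ℂ] L) (v : L) :
    NormedSpace.exp μ (NormedSpace.exp (-μ) v) = v := by
  rw [← mul_apply_eq_comp, exp_mul_exp_neg, one_apply_eq_self]

/-- Since e^(-μ) = 1 - Λ² commutes with Λ, so does its inverse. Hence e^μ Λ is again antisymmetric.
-/
theorem IsMu.comm (hμ : IsMu Λ μ) (v : L) :
    Λ (NormedSpace.exp μ v) = NormedSpace.exp μ (Λ v) := by
  have h1 : NormedSpace.exp (-μ) (Λ (NormedSpace.exp μ v)) = Λ v := by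
    rw [hμ.exp_neg, ← map_sub, ← hμ.exp_neg, exp_neg_exp_apply]
  rw [← h1, exp_exp_neg_apply]

theorem IsMu.antisymm (hμ : IsMu Λ μ) (h : IsXi Λ) (v w : L) :
    inner ℂ v (NormedSpace.exp μ (Λ w)) = -inner ℂ w (NormedSpace.exp μ (Λ v)) := by
  rw [← inner_exp_left hμ.isSelfAdjoint, h.antisymm, hμ.comm]

theorem exp_half_mul_exp_half (μ : L →L[ℂ] L) :
    NormedSpace.exp ((1 / 2 : ℂ) • μ) * NormedSpace.exp ((1 / 2 : ℂ) • μ) = NormedSpace.exp μ := by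
  rw [← exp_add_of_commute (Commute.refl _), ← add_smul]
  norm_num

theorem isSelfAdjoint_half {μ : L →L[ℂ] L} (h : IsSelfAdjoint μ) :
    IsSelfAdjoint ((1 / 2 : ℂ) • μ) := by
  rw [IsSelfAdjoint, star_smul, h.star_eq]
  congr 1
  simp

/-- The real number underlying `b`. -/
def bReal (μ : L →L[ℂ] L) (ξ : L) : ℝ := ‖NormedSpace.exp ((1 / 2 : ℂ) • μ) ξ‖ ^ 2

theorem bReal_nonneg (μ : L →L[ℂ] L) (ξ : L) : 0 ≤ bReal μ ξ := sq_nonneg _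

theorem bCoeff_eq {μ : L →L[ℂ] L} (h : IsSelfAdjoint μ) (ξ : L) : bCoeff μ ξ = bReal μ ξ := by
  rw [bCoeff, ← exp_half_mul_exp_half, mul_apply_eq_comp, ← inner_exp_left (isSelfAdjoint_half h),
    inner_self_eq_norm_sq_to_K, bReal]
  push_cast
  rfl

theorem eq_zero_of_bReal {ξ : L} (h : bReal μ ξ = 0) : ξ = 0 := by
  have : NormedSpace.exp ((1 / 2 : ℂ) • μ) ξ = 0 := by simpa [bReal] using h
  rw [← exp_neg_exp_apply ((1 / 2 : ℂ) • μ) ξ, this, map_zero]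

/-- The number `κ` with `β = -2 κ ξ ⟨e^μ ξ, ·⟩`. -/
def betaCoeff (μ : L →L[ℂ] L) (ξ : L) : ℝ := Real.log (1 + bReal μ ξ / 2) / bReal μ ξ

theorem betaCoeff_nonneg (μ : L →L[ℂ] L) (ξ : L) : 0 ≤ betaCoeff μ ξ :=
  div_nonneg (Real.log_nonneg (by have := bReal_nonneg μ ξ; linarith)) (bReal_nonneg μ ξ)

/-- The operator `β` in closed form. -/
def betaOp (μ : L →L[ℂ] L) (ξ : L) : L →L[ℂ] L :=
  (-2 * betaCoeff μ ξ : ℂ) • InnerProductSpace.rankOne ℂ ξ (NormedSpace.exp μ ξ)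

theorem exp_betaCoeff_mul {μ : L →L[ℂ] L} {ξ : L} (hb : bReal μ ξ ≠ 0) :
    Complex.exp ((betaCoeff μ ξ : ℂ) * bReal μ ξ) = 1 + (bReal μ ξ : ℂ) / 2 := by
  rw [← Complex.ofReal_mul, betaCoeff, div_mul_cancel₀ _ hb, ← Complex.ofReal_exp, Real.exp_log]
  · push_cast; rfl
  · have := bReal_nonneg μ ξ
    positivity

/-- For t = ξ ⟨e^μ ξ, ·⟩ one has t² = b t, so e^(κ t) = 1 + ((e^(κ b) - 1) / b) t. The coefficient
is 1/2 for κ = log(1 + b/2) / b. If b = 0, then ξ = 0 and both sides are the identity. -/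
theorem isBeta_betaOp {μ : L →L[ℂ] L} (h : IsSelfAdjoint μ) (ξ : L) : IsBeta μ ξ (betaOp μ ξ) := by
  refine ⟨isTraceClass_smul_rankOne _ _ _, ?_, ?_⟩
  · have e1 : NormedSpace.exp μ * -betaOp μ ξ = ((2 * betaCoeff μ ξ : ℝ) : ℂ) •
        InnerProductSpace.rankOne ℂ (NormedSpace.exp μ ξ) (NormedSpace.exp μ ξ) := by
      ext v
      simp only [betaOp, mul_apply_eq_comp, neg_apply, smul_apply, InnerProductSpace.rankOne_apply,
        map_neg, map_smul]
      push_cast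
      module
    rw [e1]
    refine (InnerProductSpace.isPositive_rankOne_self _).smul_of_nonneg ?_
    have := betaCoeff_nonneg μ ξ
    exact RCLike.ofReal_nonneg.2 (mul_nonneg zero_le_two this)
  · set t := InnerProductSpace.rankOne ℂ ξ (NormedSpace.exp μ ξ) with ht
    have e1 : -((1 / 2 : ℂ) • betaOp μ ξ) = (betaCoeff μ ξ : ℂ) • t := by
      rw [betaOp]
      module
    have e2 : t * t = (bReal μ ξ : ℂ) • t := by
      ext v
      rw [← bCoeff_eq h, bCoeff, ← inner_exp_left h]
      simp only [ht, mul_apply_eq_comp, smul_apply, InnerProductSpace.rankOne_apply, map_smul]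
      rw [smul_comm]
    rw [e1]
    by_cases hb : bReal μ ξ = 0
    · have : t = 0 := by rw [ht, eq_zero_of_bReal hb]; simp
      rw [this, smul_zero, smul_zero, NormedSpace.exp_zero, add_zero]
    · rw [exp_smul_of_mul_self e2 (by exact_mod_cast hb), exp_betaCoeff_mul hb]
      congr 2
      have : (bReal μ ξ : ℂ) ≠ 0 := by exact_mod_cast hb
      field_simp
      ring

/-- Conjugation by e^(μ/2) turns operators symmetric for ⟨·, e^μ ·⟩ into self-adjoint ones, and on
those the exponential is injective. -/
theorem IsBeta.ext {μ : L →L[ℂ] L} (h : IsSelfAdjoint μ) {ξ : L} {β β' : L →L[ℂ] L}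
    (hβ : IsBeta μ ξ β) (hβ' : IsBeta μ ξ β') : β = β' := by
  let _ : NormedAlgebra ℚ (L →L[ℂ] L) := NormedAlgebra.restrictScalars ℚ ℂ _
  set a := NormedSpace.exp ((1 / 2 : ℂ) • μ) with ha
  set a' := NormedSpace.exp (-((1 / 2 : ℂ) • μ)) with ha'
  have haa' : a * a' = 1 := exp_mul_exp_neg _
  have ha'a : a' * a = 1 := exp_neg_mul_exp _
  have hsa : IsSelfAdjoint a' := (isSelfAdjoint_half h).neg.exp
  let u : (L →L[ℂ] L)ˣ := ⟨a, a', haa', ha'a⟩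
  have hconj : ∀ γ : L →L[ℂ] L, (NormedSpace.exp μ * -γ).IsPositive →
      IsSelfAdjoint (a * -((1 / 2 : ℂ) • γ) * a') := by
    intro γ hγ
    have e1 : a * -((1 / 2 : ℂ) • γ) * a' = (1 / 2 : ℂ) • (a' * (NormedSpace.exp μ * -γ) * a') := by
      rw [← exp_half_mul_exp_half, ← ha, mul_assoc a a, ← mul_assoc a', ha'a, one_mul,
        ← smul_neg, mul_smul_comm, smul_mul_assoc]
    rw [e1]
    refine isSelfAdjoint_half ?_
    rw [IsSelfAdjoint, star_mul, star_mul, hsa.star_eq, hγ.isSelfAdjoint.star_eq, ← mul_assoc]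
  have h1 := NormedSpace.exp_units_conj u (-((1 / 2 : ℂ) • β))
  have h2 := NormedSpace.exp_units_conj u (-((1 / 2 : ℂ) • β'))
  rw [hβ.exp_neg_half] at h1
  rw [hβ'.exp_neg_half, ← h1] at h2
  have h3 : a * -((1 / 2 : ℂ) • β) * a' = a * -((1 / 2 : ℂ) • β') * a' :=
    eq_of_exp_eq (hconj β hβ.positive) (hconj β' hβ'.positive) h2.symm
  have h4 := congrArg (fun x => a' * x * a) h3
  simp only [mul_assoc, ha'a, mul_one] at h4
  rw [← mul_assoc, ← mul_assoc, ha'a, one_mul, one_mul, neg_inj] at h4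
  exact smul_right_injective _ (by norm_num : (1 / 2 : ℂ) ≠ 0) h4

theorem existsUnique_isBeta {μ : L →L[ℂ] L} (h : IsSelfAdjoint μ) (ξ : L) :
    ∃! β : L →L[ℂ] L, IsBeta μ ξ β :=
  ⟨_, isBeta_betaOp h ξ, fun _ h' => h'.ext h (isBeta_betaOp h ξ)⟩

end MuBeta

/-! ### Normal ordering for one pair of modes. -/

section PairAlgebra

variable {A : Type*} [Ring A] [Algebra ℂ A]

/-- E, F stand for the annihilators of the two modes of a pair and E', F' for the creators. Pair
operators have square zero, so their exponentials are linear; the middle factor is e^(μ^) on the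
pair, and l / (1 + l²) is the coefficient of e^μ Λ there. -/
theorem pair_identity {E F E' F' : A} (hEE : E * E = 0) (hFF : F * F = 0) (hEE' : E' * E' = 0)
    (hFF' : F' * F' = 0) (hFE : F * E = -(E * F)) (h1 : E * E' = 1 - E' * E)
    (h2 : F * F' = 1 - F' * F) (h3 : E * F' = -(F' * E)) (h4 : F * E' = -(E' * F))
    (h5 : E' * F' = -(F' * E')) {l : ℂ} (hl : 1 + l ^ 2 ≠ 0) :
    (1 + l • (E * F)) * (1 + l • (F' * E')) =
      (1 + (l / (1 + l ^ 2)) • (F' * E')) *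
        ((1 + l ^ 2) • ((1 + ((1 + l ^ 2)⁻¹ - 1) • (E' * E)) * (1 + ((1 + l ^ 2)⁻¹ - 1) • (F' * F))))
        * (1 + (l / (1 + l ^ 2)) • (E * F)) := by
  have a1 : ∀ x, E * (E * x) = 0 := fun x => by rw [← mul_assoc, hEE, zero_mul]
  have a3 : ∀ x, E' * (E' * x) = 0 := fun x => by rw [← mul_assoc, hEE', zero_mul]
  have a4 : ∀ x, F' * (F' * x) = 0 := fun x => by rw [← mul_assoc, hFF', zero_mul]
  have a5 : ∀ x, F * (E * x) = -(E * (F * x)) := fun x => by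
    rw [← mul_assoc, hFE, neg_mul, mul_assoc]
  have b1 : ∀ x, E * (E' * x) = x - E' * (E * x) := fun x => by
    rw [← mul_assoc, h1, sub_mul, one_mul, mul_assoc]
  have b2 : ∀ x, F * (F' * x) = x - F' * (F * x) := fun x => by
    rw [← mul_assoc, h2, sub_mul, one_mul, mul_assoc]
  have b3 : ∀ x, E * (F' * x) = -(F' * (E * x)) := fun x => by
    rw [← mul_assoc, h3, neg_mul, mul_assoc]
  have b5 : ∀ x, E' * (F' * x) = -(F' * (E' * x)) := fun x => by
    rw [← mul_assoc, h5, neg_mul, mul_assoc]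
  -- Both sides become combinations of the same normally ordered words, creators to the left; only
  -- the coefficients remain to be compared.
  simp only [mul_add, add_mul, mul_one, one_mul, smul_mul_assoc, mul_smul_comm, mul_assoc, h1, h4,
    hFF, a1, a3, a4, a5, b1, b2, b3, b5, mul_neg, neg_neg, mul_sub, smul_add, smul_sub, smul_zero,
    mul_zero, neg_zero, add_zero]
  match_scalars <;> field_simp <;> ring

theorem commute_mul_of_anticommute {a b c d : A} (hac : a * c = -(c * a)) (had : a * d = -(d * a))
    (hbc : b * c = -(c * b)) (hbd : b * d = -(d * b)) : Commute (a * b) (c * d) := by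
  change a * b * (c * d) = c * d * (a * b)
  rw [mul_assoc, ← mul_assoc b, hbc, neg_mul, mul_neg, mul_assoc c, hbd, mul_neg, mul_neg, neg_neg,
    ← mul_assoc, hac, neg_mul, mul_assoc, ← mul_assoc a, had, neg_mul, mul_neg, neg_neg, mul_assoc,
    mul_assoc]

end PairAlgebra

/-! ### From one pair to finitely many commuting pairs. -/

section BanachPair

variable {A : Type*} [NormedRing A] [NormedAlgebra ℂ A] [CompleteSpace A]

theorem exp_idempotent {t : A} (h : t * t = t) (c : ℂ) :
    NormedSpace.exp (c • t) = 1 + (Complex.exp c - 1) • t := by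
  rw [exp_smul_of_mul_self (b := 1) (by rw [h, one_smul]) one_ne_zero, mul_one, div_one]

theorem exp_smul_one (c : ℂ) : NormedSpace.exp (c • (1 : A)) = Complex.exp c • 1 := by
  rw [exp_idempotent (mul_one 1)]
  module

/-- Operators of different pairs commute, so exponentials of sums are products of exponentials and
can be regrouped pair by pair. -/
theorem exp_sum_pairs {κ : Type*} (F : Finset κ) {p p' y y' m : κ → A} (𝒮 : κ → Subalgebra ℂ A)
    (h𝒮 : ∀ j k, j ≠ k → ∀ a ∈ 𝒮 j, ∀ b ∈ 𝒮 k, Commute a b)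
    (hp : ∀ k, p k ∈ 𝒮 k) (hp' : ∀ k, p' k ∈ 𝒮 k) (hy : ∀ k, y k ∈ 𝒮 k) (hy' : ∀ k, y' k ∈ 𝒮 k)
    (hm : ∀ k, m k ∈ 𝒮 k)
    (h : ∀ k, NormedSpace.exp (p k) * NormedSpace.exp (p' k) =
      NormedSpace.exp (y' k) * NormedSpace.exp (m k) * NormedSpace.exp (y k)) :
    NormedSpace.exp (∑ k ∈ F, p k) * NormedSpace.exp (∑ k ∈ F, p' k) =
      NormedSpace.exp (∑ k ∈ F, y' k) * NormedSpace.exp (∑ k ∈ F, m k) *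
        NormedSpace.exp (∑ k ∈ F, y k) := by
  classical
  induction F using Finset.induction_on with
  | empty => simp
  | insert a F ha ih =>
    have hc : ∀ u v : κ → A, (∀ k, u k ∈ 𝒮 k) → (∀ k, v k ∈ 𝒮 k) →
        Commute (u a) (∑ k ∈ F, v k) := fun u v hu hv =>
      Commute.sum_right _ _ _ fun k hk => h𝒮 a k (fun e => ha (e ▸ hk)) _ (hu a) _ (hv k)
    simp only [Finset.sum_insert ha]
    rw [exp_add_of_commute (hc p p hp hp), exp_add_of_commute (hc p' p' hp' hp'),
      exp_add_of_commute (hc y' y' hy' hy'), exp_add_of_commute (hc m m hm hm),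
      exp_add_of_commute (hc y y hy hy), (commute_exp (hc p p hp hp)).eq]
    have e1 := (commute_exp (hc y' p hy' hp)).eq
    have e2 := (commute_exp (hc m p hm hp)).eq
    have e3 := (commute_exp (hc y p' hy hp')).eq
    have e4 := (commute_exp (hc m y' hm hy')).eq
    have e5 := (commute_exp (hc y y hy hy)).eq
    calc _ = NormedSpace.exp (∑ k ∈ F, p k) * (NormedSpace.exp (p a) * NormedSpace.exp (p' a)) *
          NormedSpace.exp (∑ k ∈ F, p' k) := by simp only [mul_assoc]
      _ = NormedSpace.exp (∑ k ∈ F, p k) * NormedSpace.exp (y' a) * NormedSpace.exp (m a) *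
          (NormedSpace.exp (y a) * NormedSpace.exp (∑ k ∈ F, p' k)) := by
        rw [h]; simp only [mul_assoc]
      _ = NormedSpace.exp (y' a) * (NormedSpace.exp (∑ k ∈ F, p k) * NormedSpace.exp (m a)) *
          (NormedSpace.exp (∑ k ∈ F, p' k) * NormedSpace.exp (y a)) := by
        rw [← e1, e3]; simp only [mul_assoc]
      _ = NormedSpace.exp (y' a) * NormedSpace.exp (m a) * (NormedSpace.exp (∑ k ∈ F, p k) *
          NormedSpace.exp (∑ k ∈ F, p' k)) * NormedSpace.exp (y a) := by
        rw [← e2]; simp only [mul_assoc]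
      _ = NormedSpace.exp (y' a) * (NormedSpace.exp (m a) * NormedSpace.exp (∑ k ∈ F, y' k)) *
          NormedSpace.exp (∑ k ∈ F, m k) * (NormedSpace.exp (∑ k ∈ F, y k) *
          NormedSpace.exp (y a)) := by
        rw [ih]; simp only [mul_assoc]
      _ = _ := by rw [e4, ← e5]; simp only [mul_assoc]

end BanachPair

/-! ### Pairs of a canonical form on the Fock space. -/

section FockPairs

variable {ι : Type*} [LinearOrder ι] {L : Type*} [NormedAddCommGroup L] [InnerProductSpace ℂ L]
  (ζ : HilbertBasis ι ℂ L) {κ : Type*} (e f : κ → L) (lam : κ → ℝ)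

/-- The pair annihilation operator of the pair `k`. -/
def pairA (k : κ) : Fock ι →L[ℂ] Fock ι := annih ζ (e k) * annih ζ (f k)

/-- The pair creation operator of the pair `k`. -/
def pairC (k : κ) : Fock ι →L[ℂ] Fock ι := create ζ (f k) * create ζ (e k)

/-- The contribution of the pair `k` to the current operator of `μ`. -/
def muPair (k : κ) : Fock ι →L[ℂ] Fock ι :=
  (muEig lam (Sum.inl k) : ℂ) • current ζ (e k) (e k)
    + (muEig lam (Sum.inr k) : ℂ) • current ζ (f k) (f k)

theorem adjoint_pairC (k : κ) : (pairC ζ e f k).adjoint = pairA ζ e f k := by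
  rw [← ContinuousLinearMap.star_eq_adjoint, pairC, star_mul, ContinuousLinearMap.star_eq_adjoint,
    ContinuousLinearMap.star_eq_adjoint, adjoint_create, adjoint_create, pairA]

variable {ζ e f}

theorem mul_self_pairC (k : κ) : pairC ζ e f k * pairC ζ e f k = 0 := by
  rw [pairC, mul_assoc, ← mul_assoc (create ζ (e k)), create_mul_create ζ (e k), neg_mul,
    mul_assoc, create_mul_self, mul_zero, neg_zero, mul_zero]

theorem mul_self_pairA (k : κ) : pairA ζ e f k * pairA ζ e f k = 0 := by
  rw [pairA, mul_assoc, ← mul_assoc (annih ζ (f k)), annih_mul_annih ζ (f k), neg_mul,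
    mul_assoc, annih_mul_self, mul_zero, neg_zero, mul_zero]

theorem annih_mul_create_of_inner_eq_zero {ξ τ : L} (h : inner ℂ τ ξ = 0) :
    annih ζ ξ * create ζ τ = -(create ζ τ * annih ζ ξ) := by
  rw [annih_mul_create, h, zero_smul, zero_sub]

theorem annih_mul_create_of_norm_eq_one {ξ : L} (h : ‖ξ‖ = 1) :
    annih ζ ξ * create ζ ξ = 1 - create ζ ξ * annih ζ ξ := by
  rw [annih_mul_create, inner_self_eq_norm_sq_to_K, h]
  simp

theorem number_idempotent {ξ : L} (h : ‖ξ‖ = 1) :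
    create ζ ξ * annih ζ ξ * (create ζ ξ * annih ζ ξ) = create ζ ξ * annih ζ ξ := by
  rw [mul_assoc, ← mul_assoc (annih ζ ξ), annih_mul_create_of_norm_eq_one h, sub_mul, one_mul,
    mul_assoc, annih_mul_self, mul_zero, sub_zero]

/-- The symmetrization constants of the two currents add up to minus the common eigenvalue, which
gives the prefactor 1 + λ². The rest is the exponential of two commuting idempotents. -/
theorem exp_muPair (hd : Orthonormal ℂ (Sum.elim e f)) (k : κ) :
    NormedSpace.exp (muPair ζ e f lam k) = (1 + (lam k : ℂ) ^ 2) •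
      ((1 + ((1 + (lam k : ℂ) ^ 2)⁻¹ - 1) • (create ζ (e k) * annih ζ (e k))) *
        (1 + ((1 + (lam k : ℂ) ^ 2)⁻¹ - 1) • (create ζ (f k) * annih ζ (f k)))) := by
  have he : ‖e k‖ = 1 := hd.1 (Sum.inl k)
  have hf : ‖f k‖ = 1 := hd.1 (Sum.inr k)
  have hef : inner ℂ (e k) (f k) = 0 := hd.2 (Sum.inl_ne_inr : (Sum.inl k : κ ⊕ κ) ≠ Sum.inr k)
  have hfe : inner ℂ (f k) (e k) = 0 := hd.2 (Sum.inr_ne_inl : (Sum.inr k : κ ⊕ κ) ≠ Sum.inl k)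
  set c : ℂ := (muEig lam (Sum.inl k) : ℂ) with hc
  have hc' : (muEig lam (Sum.inr k) : ℂ) = c := rfl
  have hexp : Complex.exp (-c) = 1 + (lam k : ℂ) ^ 2 := exp_neg_muEig lam (Sum.inl k)
  have hexp' : Complex.exp c = (1 + (lam k : ℂ) ^ 2)⁻¹ := by rw [← hexp, Complex.exp_neg, inv_inv]
  have e1 : muPair ζ e f lam k = (-c) • (1 : Fock ι →L[ℂ] Fock ι) +
      (c • (create ζ (e k) * annih ζ (e k)) + c • (create ζ (f k) * annih ζ (f k))) := by
    rw [muPair, current, current, inner_self_eq_norm_sq_to_K, inner_self_eq_norm_sq_to_K, he, hf,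
      hc', ← hc]
    simp only [RCLike.ofReal_one, one_pow, mul_one]
    module
  have h1 : Commute (create ζ (e k) * annih ζ (e k)) (create ζ (f k) * annih ζ (f k)) :=
    commute_mul_of_anticommute (create_mul_create ζ _ _)
      (by rw [annih_mul_create_of_inner_eq_zero hef, neg_neg])
      (annih_mul_create_of_inner_eq_zero hfe) (annih_mul_annih ζ _ _)
  have h2 := exp_idempotent (number_idempotent (ζ := ζ) he) c
  have h3 := exp_idempotent (number_idempotent (ζ := ζ) hf) c
  rw [e1, exp_add_of_commute ((Commute.one_left _).smul_left _), exp_smul_one, hexp,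
    exp_add_of_commute ((h1.smul_left _).smul_right _), h2, h3, hexp', smul_mul_assoc, one_mul]

theorem exp_pair_identity (hd : Orthonormal ℂ (Sum.elim e f)) (k : κ) :
    NormedSpace.exp ((lam k : ℂ) • pairA ζ e f k) * NormedSpace.exp ((lam k : ℂ) • pairC ζ e f k) =
      NormedSpace.exp (((lam k / (1 + lam k ^ 2) : ℝ) : ℂ) • pairC ζ e f k) *
        NormedSpace.exp (muPair ζ e f lam k) *
        NormedSpace.exp (((lam k / (1 + lam k ^ 2) : ℝ) : ℂ) • pairA ζ e f k) := by
  have he : ‖e k‖ = 1 := hd.1 (Sum.inl k)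
  have hf : ‖f k‖ = 1 := hd.1 (Sum.inr k)
  have hef : inner ℂ (e k) (f k) = 0 := hd.2 (Sum.inl_ne_inr : (Sum.inl k : κ ⊕ κ) ≠ Sum.inr k)
  have hfe : inner ℂ (f k) (e k) = 0 := hd.2 (Sum.inr_ne_inl : (Sum.inr k : κ ⊕ κ) ≠ Sum.inl k)
  have hA : ∀ c : ℂ, NormedSpace.exp (c • pairA ζ e f k) = 1 + c • pairA ζ e f k := fun c =>
    exp_of_mul_self_eq_zero (by rw [smul_mul_smul_comm, mul_self_pairA, smul_zero])
  have hC : ∀ c : ℂ, NormedSpace.exp (c • pairC ζ e f k) = 1 + c • pairC ζ e f k := fun c =>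
    exp_of_mul_self_eq_zero (by rw [smul_mul_smul_comm, mul_self_pairC, smul_zero])
  rw [hA, hA, hC, hC, exp_muPair lam hd]
  push_cast
  refine pair_identity (annih_mul_self ζ _) (annih_mul_self ζ _) (create_mul_self ζ _)
    (create_mul_self ζ _) (annih_mul_annih ζ _ _) (annih_mul_create_of_norm_eq_one he)
    (annih_mul_create_of_norm_eq_one hf) (annih_mul_create_of_inner_eq_zero hfe)
    (annih_mul_create_of_inner_eq_zero hef) (create_mul_create ζ _ _) ?_
  have : (1 + lam k ^ 2 : ℝ) ≠ 0 := by positivity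
  exact_mod_cast this

variable (ζ) in
/-- The one-particle creation and annihilation operators of the vectors of a set. -/
def modeOps (s : Set L) : Set (Fock ι →L[ℂ] Fock ι) :=
  {a | ∃ v ∈ s, a = annih ζ v ∨ a = create ζ v}

variable (ζ e f) in
/-- The even algebra of the pair `k`. -/
def pairAlg (k : κ) : Subalgebra ℂ (Fock ι →L[ℂ] Fock ι) :=
  Algebra.adjoin ℂ (Set.image2 (· * ·) (modeOps ζ {e k, f k}) (modeOps ζ {e k, f k}))

theorem anticommute_modeOps {s t : Set L} (h : ∀ v ∈ s, ∀ w ∈ t, inner ℂ v w = 0)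
    {a b : Fock ι →L[ℂ] Fock ι} (ha : a ∈ modeOps ζ s) (hb : b ∈ modeOps ζ t) :
    a * b = -(b * a) := by
  obtain ⟨v, hv, hav⟩ := ha
  obtain ⟨w, hw, hbw⟩ := hb
  have h1 := h v hv w hw
  have h2 : inner ℂ w v = 0 := by rw [← inner_conj_symm, h1, map_zero]
  rcases hav with hav | hav <;> rcases hbw with hbw | hbw <;> rw [hav, hbw]
  · exact annih_mul_annih ζ _ _
  · exact annih_mul_create_of_inner_eq_zero h2
  · rw [annih_mul_create_of_inner_eq_zero h1, neg_neg]
  · exact create_mul_create ζ _ _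

/-- Field operators of orthogonal vectors anticommute, so products of two of them commute, and so do
the algebras generated by such products. -/
theorem commute_pairAlg (hd : Orthonormal ℂ (Sum.elim e f)) (j k : κ) (hjk : j ≠ k) :
    ∀ a ∈ pairAlg ζ e f j, ∀ b ∈ pairAlg ζ e f k, Commute a b := by
  have hanti : ∀ v ∈ ({e j, f j} : Set L), ∀ w ∈ ({e k, f k} : Set L), inner ℂ v w = 0 := by
    have h1 : ∀ p q : κ ⊕ κ, p ≠ q → inner ℂ (Sum.elim e f p) (Sum.elim e f q) = 0 :=
      fun p q hpq => hd.2 hpq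
    rintro v hv w hw
    rcases hv with hv | hv <;> rcases hw with hw | hw <;> rw [hv, hw]
    · exact h1 (Sum.inl j) (Sum.inl k) (by simpa using hjk)
    · exact h1 (Sum.inl j) (Sum.inr k) (by simp)
    · exact h1 (Sum.inr j) (Sum.inl k) (by simp)
    · exact h1 (Sum.inr j) (Sum.inr k) (by simpa using hjk)
  intro a ha b hb
  refine Algebra.commute_of_mem_adjoin_of_forall_mem_commute hb ?_
  rintro _ ⟨c, hc, d, hd', rfl⟩
  refine (Algebra.commute_of_mem_adjoin_of_forall_mem_commute ha ?_).symm
  rintro _ ⟨c', hc', d', hd'', rfl⟩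
  have h := fun a ha b hb => anticommute_modeOps (ζ := ζ) hanti (a := a) (b := b) ha hb
  exact (commute_mul_of_anticommute (h _ hc' _ hc) (h _ hc' _ hd') (h _ hd'' _ hc)
    (h _ hd'' _ hd')).symm

theorem mul_mem_pairAlg {k : κ} {a b : Fock ι →L[ℂ] Fock ι}
    (ha : a ∈ modeOps ζ {e k, f k}) (hb : b ∈ modeOps ζ {e k, f k}) :
    a * b ∈ pairAlg ζ e f k := Algebra.subset_adjoin ⟨a, ha, b, hb, rfl⟩

theorem exp_sum_pair_identity (hd : Orthonormal ℂ (Sum.elim e f)) (F : Finset κ) :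
    NormedSpace.exp (∑ k ∈ F, (lam k : ℂ) • pairA ζ e f k) *
      NormedSpace.exp (∑ k ∈ F, (lam k : ℂ) • pairC ζ e f k) =
      NormedSpace.exp (∑ k ∈ F, ((lam k / (1 + lam k ^ 2) : ℝ) : ℂ) • pairC ζ e f k) *
        NormedSpace.exp (∑ k ∈ F, muPair ζ e f lam k) *
        NormedSpace.exp (∑ k ∈ F, ((lam k / (1 + lam k ^ 2) : ℝ) : ℂ) • pairA ζ e f k) := by
  have ha : ∀ k, ∀ v ∈ ({e k, f k} : Set L), annih ζ v ∈ modeOps ζ {e k, f k} := fun k v hv =>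
    ⟨v, hv, Or.inl rfl⟩
  have hc : ∀ k, ∀ v ∈ ({e k, f k} : Set L), create ζ v ∈ modeOps ζ {e k, f k} := fun k v hv =>
    ⟨v, hv, Or.inr rfl⟩
  have hA : ∀ k, pairA ζ e f k ∈ pairAlg ζ e f k := fun k =>
    mul_mem_pairAlg (ha k _ (by simp)) (ha k _ (by simp))
  have hC : ∀ k, pairC ζ e f k ∈ pairAlg ζ e f k := fun k =>
    mul_mem_pairAlg (hc k _ (by simp)) (hc k _ (by simp))
  have hcur : ∀ k, ∀ v ∈ ({e k, f k} : Set L), current ζ v v ∈ pairAlg ζ e f k := fun k v hv =>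
    Subalgebra.sub_mem _ (mul_mem_pairAlg (hc k v hv) (ha k v hv))
      (Subalgebra.smul_mem _ (Subalgebra.one_mem _) _)
  exact exp_sum_pairs F (pairAlg ζ e f) (commute_pairAlg hd)
    (fun k => Subalgebra.smul_mem _ (hA k) _) (fun k => Subalgebra.smul_mem _ (hC k) _)
    (fun k => Subalgebra.smul_mem _ (hA k) _) (fun k => Subalgebra.smul_mem _ (hC k) _)
    (fun k => Subalgebra.add_mem _ (Subalgebra.smul_mem _ (hcur k _ (by simp)) _)
      (Subalgebra.smul_mem _ (hcur k _ (by simp)) _)) (exp_pair_identity lam hd)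

end FockPairs

theorem tendsto_clm_apply {α U V : Type*} [NormedAddCommGroup U] [NormedSpace ℂ U]
    [NormedAddCommGroup V] [NormedSpace ℂ V] {l : Filter α} {T : α → U →L[ℂ] V} {T₀ : U →L[ℂ] V}
    {x : α → U} {x₀ : U} (hT : Tendsto T l (𝓝 T₀)) (hx : Tendsto x l (𝓝 x₀)) :
    Tendsto (fun i => T i (x i)) l (𝓝 (T₀ x₀)) :=
  ((isBoundedBilinearMap_apply (𝕜 := ℂ) (E := U) (F := V)).continuous.tendsto (T₀, x₀)).comp
    (hT.prodMk_nhds hx)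

/-! ### Finite truncations of the canonical form. -/

section Truncation

variable {L : Type*} [NormedAddCommGroup L] [InnerProductSpace ℂ L]

/-- The hypothesis on w expresses membership in the closed span of d. The difference of w and the
sum of its expansion is orthogonal to every d k, hence to that sum and to w, hence to itself. -/
theorem hasSum_of_orthonormal_of_forall_perp [CompleteSpace L] {κ : Type*} {d : κ → L}
    (hd : Orthonormal ℂ d) {w : L} (hw : ∀ z, (∀ k, inner ℂ (d k) z = 0) → inner ℂ z w = 0) :
    HasSum (fun k => inner ℂ (d k) w • d k) w := by
  classical
  have hs : Summable fun k => inner ℂ (d k) w • d k := by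
    have := (hd.orthogonalFamily.summable_iff_norm_sq_summable fun k => inner ℂ (d k) w).2
      (by simpa using hd.inner_products_summable w)
    simpa using this
  obtain ⟨S, hS⟩ := hs
  have h1 : ∀ k, inner ℂ (d k) (w - S) = 0 := fun k => by
    have h2 := hS.mapL (innerSL ℂ (d k))
    have h3 : inner ℂ (d k) S = inner ℂ (d k) w := by
      refine h2.unique (Eq.mpr (congrArg (fun u => HasSum u _) (funext fun j => ?_))
        (hasSum_ite_eq k (inner ℂ (d k) w)))
      rw [_root_.map_smul, innerSL_apply_apply, orthonormal_iff_ite.1 hd k j]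
      by_cases hjk : j = k
      · simp [hjk]
      · simp [hjk, Ne.symm hjk]
    rw [inner_sub_right, h3, sub_self]
  have h4 : inner ℂ (w - S) S = 0 := by
    refine (hS.mapL (innerSL ℂ (w - S))).unique ?_
    refine Eq.mpr (congrArg (fun u => HasSum u _) (funext fun k => ?_)) hasSum_zero
    rw [_root_.map_smul, innerSL_apply_apply, ← inner_conj_symm (w - S), h1, map_zero, smul_zero]
  have h5 : w - S = 0 := by
    rw [← inner_self_eq_zero (𝕜 := ℂ), inner_sub_right, hw _ h1, h4, sub_zero]
  rwa [← sub_eq_zero.1 h5] at hS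

variable {κ : Type*} (e f : κ → L) (lam : κ → ℝ)

/-- The finite rank truncations of a map in canonical form. -/
def canTrunc (F : Finset κ) : L →ₗ[ℝ] L := ∑ k ∈ F, lam k • rankTwo (e k) (f k)

variable {e f lam} {Λ : L →ₗ[ℝ] L}

/-- The truncation is Λ followed by the orthogonal projection to finitely many pairs. Domination by
Λ and convergence to Λ both follow from this form. -/
theorem IsCanonical.canTrunc_apply (hc : IsCanonical Λ e f lam)
    (ha : ∀ ξ τ, inner ℂ ξ (Λ τ) = -inner ℂ τ (Λ ξ)) (F : Finset κ) (v : L) :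
    canTrunc e f lam F v =
      ∑ p ∈ F.disjSum F, inner ℂ (Sum.elim e f p) (Λ v) • Sum.elim e f p := by
  rw [Finset.sum_disjSum, ← Finset.sum_add_distrib, canTrunc, LinearMap.sum_apply]
  refine Finset.sum_congr rfl fun k _ => ?_
  rw [LinearMap.smul_apply, rankTwo_apply, Sum.elim_inl, Sum.elim_inr, ha, hc.map_e, ha, hc.map_f,
    inner_neg_right, inner_smul_right, inner_smul_right, real_smul_eq]
  module

theorem tendsto_disjSum : Tendsto (fun F : Finset κ => F.disjSum F) atTop atTop := by
  refine tendsto_atTop_finset_of_monotone (fun F G h => Finset.disjSum_mono h h) fun p => ?_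
  rcases p with k | k <;> exact ⟨{k}, by simp⟩

variable {ι : Type*} [LinearOrder ι] {ζ : HilbertBasis ι ℂ L}

theorem isHS_canTrunc (F : Finset κ) : IsHS ζ (canTrunc e f lam F) := by
  classical
  induction F using Finset.induction_on with
  | empty => simpa [canTrunc] using isHS_zero
  | insert a F ha ih =>
    rw [canTrunc, Finset.sum_insert ha]
    exact ((isHS_rankTwo _ _).smul _).add ih

theorem IsCanonical.norm_canTrunc_le (hc : IsCanonical Λ e f lam) (h : IsHS ζ Λ) (F : Finset κ)
    (v : L) : ‖canTrunc e f lam F v‖ ≤ ‖Λ v‖ := by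
  rw [hc.canTrunc_apply h.antisymm]
  exact norm_partial_le hc.orthonormal _ _

theorem IsCanonical.hsSq_canTrunc_le (hc : IsCanonical Λ e f lam) (h : IsHS ζ Λ) (F : Finset κ) :
    hsSq ζ (canTrunc e f lam F) ≤ hsSq ζ Λ :=
  (isHS_canTrunc F).summable.tsum_le_tsum
    (fun _ => pow_le_pow_left₀ (norm_nonneg _) (hc.norm_canTrunc_le h F _) 2) h.summable

variable [CompleteSpace L]

theorem IsCanonical.tendsto_canTrunc (hc : IsCanonical Λ e f lam) (h : IsHS ζ Λ) (v : L) :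
    Tendsto (fun F => canTrunc e f lam F v) atTop (𝓝 (Λ v)) := by
  have h1 : HasSum (fun p => inner ℂ (Sum.elim e f p) (Λ v) • Sum.elim e f p) (Λ v) :=
    hasSum_of_orthonormal_of_forall_perp hc.orthonormal fun z hz => by
      rw [h.antisymm, hc.map_perp z (fun k => hz (Sum.inl k)) (fun k => hz (Sum.inr k)),
        inner_zero_right, neg_zero]
  simp only [hc.canTrunc_apply h.antisymm]
  exact h1.comp tendsto_disjSum

theorem IsCanonical.tendsto_hsSq (hc : IsCanonical Λ e f lam) (h : IsHS ζ Λ) :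
    Tendsto (fun F => hsSq ζ (Λ - canTrunc e f lam F)) atTop (𝓝 0) := by
  have h0 : (∑' _ : ι, (0 : ℝ)) = 0 := tsum_zero
  rw [← h0]
  -- The factor 4 is 2²: the truncated and the full map are both bounded by ‖Λ ζᵢ‖.
  refine tendsto_tsum_of_dominated_convergence (bound := fun i => 4 * ‖Λ (ζ i)‖ ^ 2)
    (h.summable.mul_left 4) (fun i => ?_) (Eventually.of_forall fun F i => ?_)
  · have := ((tendsto_const_nhds (x := Λ (ζ i))).sub (hc.tendsto_canTrunc h (ζ i))).norm.pow 2
    simpa using this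
  · rw [Real.norm_of_nonneg (by positivity), LinearMap.sub_apply]
    have h1 := norm_sub_le (Λ (ζ i)) (canTrunc e f lam F (ζ i))
    have h2 := hc.norm_canTrunc_le h F (ζ i)
    calc _ ≤ (2 * ‖Λ (ζ i)‖) ^ 2 := pow_le_pow_left₀ (norm_nonneg _) (by linarith) 2
      _ = _ := by ring

theorem IsCanonical.smul (hc : IsCanonical Λ e f lam) {c : ℝ} (hpos : 0 < c) :
    IsCanonical (c • Λ) e f (fun k => c * lam k) where
  pos k := mul_pos hpos (hc.pos k)
  orthonormal := hc.orthonormal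
  map_e k := by rw [LinearMap.smul_apply, hc.map_e, real_smul_eq]; push_cast; module
  map_f k := by rw [LinearMap.smul_apply, hc.map_f, real_smul_eq]; push_cast; module
  map_perp v he hf := by rw [LinearMap.smul_apply, hc.map_perp v he hf, smul_zero]

/-- The composition `e^μ Λ`. -/
def expComp (μ : L →L[ℂ] L) (Λ : L →ₗ[ℝ] L) : L →ₗ[ℝ] L :=
  ((NormedSpace.exp μ : L →L[ℂ] L) : L →ₗ[ℂ] L).restrictScalars ℝ ∘ₗ Λ

theorem expComp_apply (μ : L →L[ℂ] L) (Λ : L →ₗ[ℝ] L) (v : L) :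
    expComp μ Λ v = NormedSpace.exp μ (Λ v) := rfl

theorem IsMu.isHS_expComp {μ : L →L[ℂ] L} (hμ : IsMu Λ μ) (h : IsXi Λ) :
    IsHS ζ (expComp μ Λ) := by
  refine ⟨hμ.antisymm h, ?_⟩
  refine Summable.of_nonneg_of_le (fun _ => by positivity) (fun i => ?_)
    ((h.isHS (ζ := ζ)).summable.mul_left (‖(NormedSpace.exp μ : L →L[ℂ] L)‖ ^ 2))
  rw [← mul_pow, expComp_apply]
  gcongr
  exact le_opNorm _ _

/-- On both vectors of a pair e^μ acts as (1 + λ²)⁻¹. The resulting singular values are the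
coefficients on the right of `pair_identity`. -/
theorem IsCanonical.expComp (hc : IsCanonical Λ e f lam) (hs : Summable fun k => lam k ^ 2) :
    IsCanonical (expComp (muCan e f lam) Λ) e f (fun k => lam k / (1 + lam k ^ 2)) := by
  have hexp : ∀ p : κ ⊕ κ, NormedSpace.exp (muCan e f lam) (Sum.elim e f p) =
      (1 + (lam (Sum.elim id id p) : ℂ) ^ 2)⁻¹ • Sum.elim e f p := fun p => by
    rw [exp_apply_of_eigenvector (hc.muCan_apply hs p), ← exp_neg_muEig, Complex.exp_neg, inv_inv]
  refine ⟨fun k => div_pos (hc.pos k) (by positivity), hc.orthonormal, fun k => ?_, fun k => ?_,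
    fun v he hf => ?_⟩
  · have := hexp (Sum.inr k)
    rw [Sum.elim_inr] at this
    rw [expComp_apply, hc.map_e, map_smul, this, smul_smul, div_eq_mul_inv]
    push_cast
    rfl
  · have := hexp (Sum.inl k)
    rw [Sum.elim_inl] at this
    rw [expComp_apply, hc.map_f, map_neg, map_smul, this, smul_smul, div_eq_mul_inv]
    push_cast
    rfl
  · rw [expComp_apply, hc.map_perp v he hf, map_zero]

end Truncation

/-! ### Limits of the truncations at bounded particle number. -/

section SectorLimit

variable {ι : Type*} [LinearOrder ι] {L : Type*} [NormedAddCommGroup L] [InnerProductSpace ℂ L]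
  [CompleteSpace L] {ζ : HilbertBasis ι ℂ L} {κ : Type*} {e f : κ → L} {lam : κ → ℝ}
  {Λ : L →ₗ[ℝ] L} {N : ℕ} {ψ : Fock ι}

variable (ζ e f lam) in
/-- The truncated pair annihilation operator. -/
def truncA (F : Finset κ) : Fock ι →L[ℂ] Fock ι := ∑ k ∈ F, (lam k : ℂ) • pairA ζ e f k

variable (ζ e f lam) in
/-- The truncated pair creation operator. -/
def truncC (F : Finset κ) : Fock ι →L[ℂ] Fock ι := ∑ k ∈ F, (lam k : ℂ) • pairC ζ e f k

theorem adjoint_truncC (F : Finset κ) : (truncC ζ e f lam F).adjoint = truncA ζ e f lam F := by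
  rw [truncC, truncA, map_sum]
  refine Finset.sum_congr rfl fun k _ => ?_
  rw [map_smulₛₗ, adjoint_pairC, Complex.conj_ofReal]

theorem hatPair_canTrunc (F : Finset κ) (hψ : ψ ∈ upTo ι N) :
    hatPair ζ (canTrunc e f lam F) ψ = truncA ζ e f lam F ψ := by
  classical
  induction F using Finset.induction_on with
  | empty => simp [canTrunc, truncA, hatPair, annih_zero]
  | insert a F ha ih =>
    rw [canTrunc, Finset.sum_insert ha, ← canTrunc,
      ((isHS_rankTwo _ _).smul _).add_hatPair (isHS_canTrunc F) hψ, ih, truncA, truncA,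
      Finset.sum_insert ha, (isHS_rankTwo _ _).smul_hatPair _ hψ, hatPair_rankTwo]
    rfl

theorem hatPairDag_canTrunc (F : Finset κ) (hψ : ψ ∈ upTo ι N) :
    hatPairDag ζ (canTrunc e f lam F) ψ = truncC ζ e f lam F ψ := by
  classical
  induction F using Finset.induction_on with
  | empty => simp [canTrunc, truncC, hatPairDag, create_zero]
  | insert a F ha ih =>
    have h1 : ∀ c : ℝ, ∀ u v : L, hatPairDag ζ (c • rankTwo u v) ψ
        = (c : ℂ) • create ζ v (create ζ u ψ) := fun c u v => by
      have : (c • rankTwo u v : L →ₗ[ℝ] L) = rankTwo u ((c : ℂ) • v) := by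
        ext η
        rw [LinearMap.smul_apply, rankTwo_apply, rankTwo_apply, inner_smul_right, real_smul_eq]
        module
      rw [this, hatPairDag_rankTwo, create_smul, Complex.conj_ofReal, smul_apply]
    rw [canTrunc, Finset.sum_insert ha, ← canTrunc,
      ((isHS_rankTwo _ _).smul _).add_hatPairDag (isHS_canTrunc F) hψ, ih, truncC, truncC,
      Finset.sum_insert ha, h1]
    rfl

theorem IsCanonical.tendsto_pairN (hc : IsCanonical Λ e f lam) (h : IsHS ζ Λ) :
    Tendsto (fun F => pairN N (isHS_canTrunc (ζ := ζ) (e := e) (f := f) (lam := lam) F)) atTop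
      (𝓝 (pairN N h)) := by
  rw [tendsto_iff_norm_sub_tendsto_zero]
  have h1 : ∀ F, pairN N (isHS_canTrunc (ζ := ζ) (e := e) (f := f) (lam := lam) F) - pairN N h
      = -pairN N (h.sub (isHS_canTrunc (e := e) (f := f) (lam := lam) F)) := fun F => by
    ext v
    refine incl_injective ?_
    rw [sub_apply, neg_apply, map_sub, map_neg, incl_pairN, incl_pairN, incl_pairN,
      h.sub_hatPair (isHS_canTrunc F) (incl_mem v), neg_sub]
  refine squeeze_zero (fun _ => norm_nonneg _) (fun F => ?_)
    (g := fun F => Real.sqrt (N * hsSq ζ (Λ - canTrunc e f lam F))) ?_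
  · rw [h1, norm_neg]
    exact norm_pairN_le _
  · have := ((hc.tendsto_hsSq h).const_mul (N : ℝ)).sqrt
    simpa using this

theorem exp_truncA_incl (F : Finset κ) (v : Sector ι N) :
    NormedSpace.exp (truncA ζ e f lam F) (incl ι N v) = incl ι N (NormedSpace.exp
      (pairN N (isHS_canTrunc (ζ := ζ) (e := e) (f := f) (lam := lam) F)) v) :=
  exp_comp_of_semiconj (fun v => by rw [incl_pairN, hatPair_canTrunc F (incl_mem v)]) v

theorem IsCanonical.tendsto_exp_truncA (hc : IsCanonical Λ e f lam) (h : IsHS ζ Λ)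
    (v : Sector ι N) : Tendsto (fun F => NormedSpace.exp (truncA ζ e f lam F) (incl ι N v)) atTop
      (𝓝 (incl ι N (NormedSpace.exp (pairN N h) v))) := by
  simp only [exp_truncA_incl]
  exact ((incl ι N).continuous.tendsto _).comp
    (((ContinuousLinearMap.apply ℂ (Sector ι N) v).continuous.tendsto _).comp
      (tendsto_exp (hc.tendsto_pairN h)))

theorem IsCanonical.tendsto_muPair (hc : IsCanonical Λ e f lam)
    (hs : Summable fun k => lam k ^ 2) :
    Tendsto (fun F => ∑ k ∈ F, muPair ζ e f lam k) atTop
      (𝓝 (hatCurrent ζ (muCan e f lam))) := by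
  have h1 := hasSum_hatCurrent ζ (hc.summable_norm_muCan hs) (hc.hasSum_muCan_apply hs)
  have h2 := h1.comp tendsto_disjSum
  refine Eq.mpr (congrArg (fun u => Tendsto u atTop _) (funext fun F => ?_)) h2
  rw [Function.comp_apply, Finset.sum_disjSum, ← Finset.sum_add_distrib]
  refine Finset.sum_congr rfl fun k _ => ?_
  have h3 : ∀ (c : ℂ) (y x : L), current ζ y (c • x) = c • current ζ y x := fun c y x => by
    rw [current, current, annih_smul, inner_smul_right, mul_smul_comm]
    module
  rw [muPair, h3, h3]
  rfl

/-- The inner products of the vectors obtained from the finite truncations of `e^(Λ^†)`. -/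
theorem IsCanonical.tendsto_inner_exp_truncC (hc : IsCanonical Λ e f lam) (h : IsXi Λ)
    (hK : IsHS ζ (FermiFock.expComp (muCan e f lam) Λ)) (v w : Sector ι N) :
    Tendsto (fun F => inner ℂ (NormedSpace.exp (truncC ζ e f lam F) (incl ι N v))
      (NormedSpace.exp (truncC ζ e f lam F) (incl ι N w))) atTop
      (𝓝 (inner ℂ (incl ι N (NormedSpace.exp (pairN N hK) v))
        (NormedSpace.exp (hatCurrent ζ (muCan e f lam))
          (incl ι N (NormedSpace.exp (pairN N hK) w))))) := by
  have hs := hc.summable_sq (h.isHS (ζ := ζ))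
  have hadj : ∀ T : Fock ι →L[ℂ] Fock ι, (NormedSpace.exp T).adjoint = NormedSpace.exp T.adjoint :=
    fun T => by
      rw [← ContinuousLinearMap.star_eq_adjoint, ← ContinuousLinearMap.star_eq_adjoint,
        NormedSpace.star_exp]
  -- Moving one exponential to the other side gives annihilators left of creators, which the pair
  -- identity reorders. In normal order each factor converges at bounded particle number, so the
  -- limit exists before anything is known about e^(Λ^†).
  have h1 : ∀ F, inner ℂ (NormedSpace.exp (truncC ζ e f lam F) (incl ι N v))
      (NormedSpace.exp (truncC ζ e f lam F) (incl ι N w)) =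
      inner ℂ (NormedSpace.exp (truncA ζ e f (fun k => lam k / (1 + lam k ^ 2)) F) (incl ι N v))
        (NormedSpace.exp (∑ k ∈ F, muPair ζ e f lam k)
          (NormedSpace.exp (truncA ζ e f (fun k => lam k / (1 + lam k ^ 2)) F)
            (incl ι N w))) := fun F => by
    have h2 := exp_sum_pair_identity (ζ := ζ) lam hc.orthonormal F
    rw [← adjoint_inner_right, hadj, adjoint_truncC, ← mul_apply_eq_comp, truncA, truncC, h2,
      mul_apply_eq_comp, mul_apply_eq_comp, ← truncA, ← truncC, ← adjoint_inner_left, hadj,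
      adjoint_truncC]
  simp only [h1]
  have h3 := fun v : Sector ι N => (hc.expComp hs).tendsto_exp_truncA hK v
  have h4 := tendsto_exp (hc.tendsto_muPair (ζ := ζ) hs)
  exact (h3 v).inner (tendsto_clm_apply h4 (h3 w))

end SectorLimit

/-! ### Vectors with a fixed number of particles. -/

section Homogeneous

variable {ι : Type*} [LinearOrder ι]

/-- The vectors with exactly `N` particles. -/
def exactly (ι : Type*) (N : ℕ) : Submodule ℂ (Fock ι) where
  carrier := {ψ | ∀ S : Finset ι, S.card ≠ N → (ψ : Finset ι → ℂ) S = 0}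
  add_mem' := fun {a b} ha hb S hS => by
    change (a : Finset ι → ℂ) S + (b : Finset ι → ℂ) S = 0
    rw [ha S hS, hb S hS, add_zero]
  zero_mem' := fun _ _ => rfl
  smul_mem' := fun c a ha S hS => by
    change c * (a : Finset ι → ℂ) S = 0
    rw [ha S hS, mul_zero]

theorem isClosed_exactly (N : ℕ) : IsClosed (exactly ι N : Set (Fock ι)) := by
  have : (exactly ι N : Set (Fock ι)) =
      ⋂ S : Finset ι, ⋂ _ : S.card ≠ N, {ψ | inner ℂ (lp.single 2 S (1 : ℂ) : Fock ι) ψ = 0} := by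
    ext ψ
    simp only [Set.mem_iInter, Set.mem_ofPred_eq, ← coeff_eq_inner]
    rfl
  rw [this]
  exact isClosed_iInter fun S => isClosed_iInter fun _ =>
    isClosed_eq (continuous_const.inner continuous_id) continuous_const

theorem exactly_le_upTo (N : ℕ) : exactly ι N ≤ upTo ι N := fun _ hψ S hS => hψ S hS.ne'

theorem inner_eq_zero_of_exactly {M N : ℕ} (h : M ≠ N) {ψ φ : Fock ι} (hψ : ψ ∈ exactly ι M)
    (hφ : φ ∈ exactly ι N) : inner ℂ ψ φ = 0 := by
  refine (lp.hasSum_inner (𝕜 := ℂ) ψ φ).unique ?_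
  refine Eq.mpr (congrArg (fun u => HasSum u _) (funext fun S : Finset ι => ?_)) hasSum_zero
  by_cases hS : S.card = M
  · rw [hφ S (by omega), inner_zero_right]
  · rw [hψ S hS, inner_zero_left]

/-- The orthogonal complement splits off the component of highest particle number. This makes
arguments available that rely on orthogonality of different particle numbers. -/
theorem upTo_induction {p : Fock ι → Prop} (hex : ∀ N, ∀ ψ ∈ exactly ι N, p ψ)
    (hadd : ∀ N, ∀ ψ ∈ upTo ι N, ∀ φ ∈ upTo ι N, p ψ → p φ → p (ψ + φ)) {N : ℕ} {ψ : Fock ι}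
    (hψ : ψ ∈ upTo ι N) : p ψ := by
  induction N generalizing ψ with
  | zero => exact hex 0 ψ fun S hS => hψ S (Nat.pos_of_ne_zero hS)
  | succ N ih =>
    have : CompleteSpace (upTo ι N) := (isClosed_upTo N).completeSpace_coe
    obtain ⟨y, hy, z, hz, rfl⟩ := (upTo ι N).exists_add_mem_mem_orthogonal ψ
    have hy' := upTo_mono N.le_succ hy
    have hz' : z ∈ exactly ι (N + 1) := fun S hS => by
      rcases lt_or_ge (N + 1) S.card with h | h
      · have h1 := hψ S h
        have h2 := hy' S h
        rw [lp.coeFn_add, Pi.add_apply, h2, zero_add] at h1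
        exact h1
      · rw [coeff_eq_inner]
        exact hz _ (single_mem_upTo S (by omega) 1)
    exact hadd (N + 1) y hy' z (exactly_le_upTo _ hz') (ih hy) (hex _ z hz')

variable {L : Type*} [NormedAddCommGroup L] [InnerProductSpace ℂ L] {ζ : HilbertBasis ι ℂ L}

theorem modeCreate_mem_exactly {N : ℕ} (i : ι) {ψ : Fock ι} (hψ : ψ ∈ exactly ι N) :
    (modeAnnih i).adjoint ψ ∈ exactly ι (N + 1) := fun S hS => by
  rw [modeCreate_apply]
  split_ifs with h
  · have := Finset.card_pos.2 ⟨i, h⟩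
    rw [hψ _ (by rw [Finset.card_erase_of_mem h]; omega), mul_zero]
  · rfl

theorem create_mem_exactly {N : ℕ} (ξ : L) {ψ : Fock ι} (hψ : ψ ∈ exactly ι N) :
    create ζ ξ ψ ∈ exactly ι (N + 1) := by
  have h := (hasSum_create ζ ξ).mapL (ContinuousLinearMap.apply ℂ (Fock ι) ψ)
  refine (isClosed_exactly (N + 1)).mem_of_tendsto h (Eventually.of_forall fun s =>
    Submodule.sum_mem _ fun i _ => Submodule.smul_mem _ _ ?_)
  rw [create, annih_basis]
  exact modeCreate_mem_exactly i hψ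

variable {κ : Type*} {e f : κ → L} {lam : κ → ℝ}

theorem truncC_mem_exactly (F : Finset κ) {N : ℕ} {ψ : Fock ι} (hψ : ψ ∈ exactly ι N) :
    truncC ζ e f lam F ψ ∈ exactly ι (N + 2) := by
  rw [truncC, sum_apply]
  refine Submodule.sum_mem _ fun k _ => ?_
  rw [smul_apply, pairC, mul_apply_eq_comp]
  exact Submodule.smul_mem _ _ (create_mem_exactly _ (create_mem_exactly _ hψ))

theorem truncC_pow_mem_exactly (F : Finset κ) {N : ℕ} {ψ : Fock ι} (hψ : ψ ∈ exactly ι N) (n : ℕ) :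
    (truncC ζ e f lam F ^ n) ψ ∈ exactly ι (N + 2 * n) := by
  induction n with
  | zero => simpa using hψ
  | succ n ih => rw [pow_succ', mul_apply_eq_comp]; exact truncC_mem_exactly F ih

/-- The terms of the exponential series are mutually orthogonal, hence bounded by the sum. -/
theorem norm_term_le_norm_exp_truncC (F : Finset κ) {N : ℕ} {ψ : Fock ι} (hψ : ψ ∈ exactly ι N)
    (n : ℕ) : ‖((n.factorial : ℂ)⁻¹) • (truncC ζ e f lam F ^ n) ψ‖
      ≤ ‖NormedSpace.exp (truncC ζ e f lam F) ψ‖ := by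
  set u : ℕ → Fock ι := fun n => ((n.factorial : ℂ)⁻¹) • (truncC ζ e f lam F ^ n) ψ with hu
  have hmem : ∀ n, u n ∈ exactly ι (N + 2 * n) := fun n =>
    Submodule.smul_mem _ _ (truncC_pow_mem_exactly F hψ n)
  have h1 : inner ℂ (u n) (NormedSpace.exp (truncC ζ e f lam F) ψ) = inner ℂ (u n) (u n) := by
    refine ((hasSum_exp_apply (truncC ζ e f lam F) ψ).mapL (innerSL ℂ (u n))).unique ?_
    refine Eq.mpr (congrArg (fun v => HasSum v _) (funext fun j => ?_))
      (hasSum_ite_eq n (inner ℂ (u n) (u n)))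
    rw [innerSL_apply_apply]
    by_cases hj : j = n
    · rw [if_pos hj, hj]
    · rw [if_neg hj]
      exact inner_eq_zero_of_exactly (by omega) (hmem n) (hmem j)
  have h2 : ‖u n‖ ^ 2 ≤ ‖u n‖ * ‖NormedSpace.exp (truncC ζ e f lam F) ψ‖ := by
    have := norm_inner_le_norm (𝕜 := ℂ) (u n) (NormedSpace.exp (truncC ζ e f lam F) ψ)
    rw [h1, inner_self_eq_norm_sq_to_K, norm_pow] at this
    simpa using this
  exact le_of_sq_le_mul (norm_nonneg _) (norm_nonneg _) (by rwa [mul_comm] at h2)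

end Homogeneous

/-! ### Convergence and properties of e^(Λ^†). -/

section ExpPairDag

variable {ι : Type*} [LinearOrder ι] {L : Type*} [NormedAddCommGroup L] [InnerProductSpace ℂ L]
  [CompleteSpace L] {ζ : HilbertBasis ι ℂ L} {κ : Type*} {e f : κ → L} {lam : κ → ℝ}
  {Λ : L →ₗ[ℝ] L} {N : ℕ} {ψ φ : Fock ι}

theorem IsHS.iterate_mem_upTo (h : IsHS ζ Λ) (hψ : ψ ∈ upTo ι N) (n : ℕ) :
    (hatPairDag ζ Λ)^[n] ψ ∈ upTo ι (N + 2 * n) := by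
  induction n with
  | zero => simpa using hψ
  | succ n ih => rw [Function.iterate_succ_apply']; exact h.hatPairDag_mem_upTo ih

theorem IsHS.iterate_add (h : IsHS ζ Λ) (hψ : ψ ∈ upTo ι N) (hφ : φ ∈ upTo ι N) (n : ℕ) :
    (hatPairDag ζ Λ)^[n] (ψ + φ) = (hatPairDag ζ Λ)^[n] ψ + (hatPairDag ζ Λ)^[n] φ := by
  induction n with
  | zero => rfl
  | succ n ih =>
    rw [Function.iterate_succ_apply', Function.iterate_succ_apply', Function.iterate_succ_apply',
      ih, h.hatPairDag_add (h.iterate_mem_upTo hψ n) (h.iterate_mem_upTo hφ n)]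

theorem truncC_pow_mem_upTo (F : Finset κ) (hψ : ψ ∈ upTo ι N) (n : ℕ) :
    (truncC ζ e f lam F ^ n) ψ ∈ upTo ι (N + 2 * n) := by
  induction n with
  | zero => simpa using hψ
  | succ n ih =>
    rw [pow_succ', mul_apply_eq_comp, ← hatPairDag_canTrunc F ih]
    exact (isHS_canTrunc F).hatPairDag_mem_upTo ih

theorem IsCanonical.tendsto_truncC_pow (hc : IsCanonical Λ e f lam) (h : IsHS ζ Λ)
    (hψ : ψ ∈ upTo ι N) (n : ℕ) : Tendsto (fun F => (truncC ζ e f lam F ^ n) ψ) atTop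
      (𝓝 ((hatPairDag ζ Λ)^[n] ψ)) := by
  induction n with
  | zero => simp
  | succ n ih =>
    have hm := h.iterate_mem_upTo hψ n
    set φ := (hatPairDag ζ Λ)^[n] ψ with hφ
    set M := N + 2 * n
    rw [Function.iterate_succ_apply', ← hφ, tendsto_iff_norm_sub_tendsto_zero]
    have hb : ∀ {Λ' : L →ₗ[ℝ] L}, IsHS ζ Λ' → ∀ χ ∈ upTo ι M, ‖hatPairDag ζ Λ' χ‖
        ≤ Real.sqrt ((M + 2) * hsSq ζ Λ') * ‖χ‖ := fun {Λ'} h' χ hχ => by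
      have h0 : 0 ≤ (M + 2 : ℝ) * hsSq ζ Λ' := mul_nonneg (by positivity) (hsSq_nonneg ζ _)
      refine abs_le_of_sq_le_sq' ?_ (by positivity) |>.2
      rw [mul_pow, Real.sq_sqrt h0]
      exact h'.norm_hatPairDag_sq_le hχ
    refine squeeze_zero (fun _ => norm_nonneg _) (fun F => ?_)
      (g := fun F => Real.sqrt ((M + 2) * hsSq ζ Λ) * ‖(truncC ζ e f lam F ^ n) ψ - φ‖ +
        Real.sqrt ((M + 2) * hsSq ζ (Λ - canTrunc e f lam F)) * ‖φ‖) ?_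
    · have h1 : (truncC ζ e f lam F ^ (n + 1)) ψ - hatPairDag ζ Λ φ =
          hatPairDag ζ (canTrunc e f lam F) ((truncC ζ e f lam F ^ n) ψ - φ)
            - hatPairDag ζ (Λ - canTrunc e f lam F) φ := by
        have hs := Submodule.sub_mem _ (truncC_pow_mem_upTo (ζ := ζ) (e := e) (f := f)
          (lam := lam) F hψ n) hm
        rw [h.sub_hatPairDag (isHS_canTrunc F) hm, hatPairDag_canTrunc F hs,
          hatPairDag_canTrunc F hm, map_sub, pow_succ', mul_apply_eq_comp]
        abel
      rw [h1]
      refine (norm_sub_le _ _).trans (add_le_add ((hb (isHS_canTrunc F) _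
        (Submodule.sub_mem _ (truncC_pow_mem_upTo F hψ n) hm)).trans ?_)
        (hb (h.sub (isHS_canTrunc F)) _ hm))
      have := hc.hsSq_canTrunc_le h F
      gcongr
    · have h1 := (tendsto_iff_norm_sub_tendsto_zero.1 ih).const_mul
        (Real.sqrt ((M + 2) * hsSq ζ Λ))
      have h2 := ((hc.tendsto_hsSq h).const_mul (M + 2 : ℝ)).sqrt.mul_const ‖φ‖
      simpa using h1.add h2

theorem IsXi.smul (h : IsXi Λ) (c : ℝ) : IsXi (c • Λ) := by
  obtain ⟨T, hT, x, y, hs, hl⟩ := h.sq_traceClass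
  refine ⟨fun ξ τ => ?_, ((c ^ 2 : ℝ) : ℂ) • T, fun v => ?_,
    fun n => ((c ^ 2 : ℝ) : ℂ) • x n, y, ?_, fun v => ?_⟩
  · rw [LinearMap.smul_apply, LinearMap.smul_apply, real_smul_eq, real_smul_eq, inner_smul_right,
      inner_smul_right, h.antisymm]
    ring
  · rw [smul_apply, hT, LinearMap.smul_apply, LinearMap.smul_apply, LinearMap.map_smul, smul_smul,
      ← pow_two, real_smul_eq]
  · simpa only [norm_smul, mul_assoc] using hs.mul_left ‖((c ^ 2 : ℝ) : ℂ)‖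
  · exact Eq.mpr (congrArg (fun u => HasSum u _) (funext fun n => smul_comm _ _ _))
      ((hl v).const_smul ((c ^ 2 : ℝ) : ℂ))

/-- The squared norms converge by `IsCanonical.tendsto_inner_exp_truncC`, hence are eventually below
the limit plus one. -/
theorem IsCanonical.eventually_norm_exp_truncC_le (hc : IsCanonical Λ e f lam) (h : IsXi Λ)
    (hψ : ψ ∈ upTo ι N) :
    ∃ C : ℝ, ∀ᶠ F in atTop, ‖NormedSpace.exp (truncC ζ e f lam F) ψ‖ ≤ C := by
  have hK := (hc.isMu (hc.summable_sq (h.isHS (ζ := ζ))) h).isHS_expComp (ζ := ζ) h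
  have h1 := (hc.tendsto_inner_exp_truncC h hK (toSector ψ hψ) (toSector ψ hψ)).norm
  simp only [inner_self_eq_norm_sq_to_K, norm_pow] at h1
  have h2 := h1.eventually (eventually_le_nhds (lt_add_one _))
  refine ⟨Real.sqrt _, h2.mono fun F hF => Real.le_sqrt_of_sq_le (le_trans (le_of_eq ?_) hF)⟩
  simp [incl_toSector]

/-- The exponential series of `Λ^†` converges on the vectors with finitely many particles, and is
the limit of its finite truncations. -/
theorem IsCanonical.tendsto_exp_truncC (hc : IsCanonical Λ e f lam) (h : IsXi Λ)
    (hψ : ψ ∈ upTo ι N) :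
    (Summable fun n : ℕ => ((n.factorial : ℂ)⁻¹) • (hatPairDag ζ Λ)^[n] ψ) ∧
    Tendsto (fun F => NormedSpace.exp (truncC ζ e f lam F) ψ) atTop
      (𝓝 (expOp (hatPairDag ζ Λ) ψ)) := by
  revert hψ
  refine upTo_induction (p := fun ψ =>
    (Summable fun n : ℕ => ((n.factorial : ℂ)⁻¹) • (hatPairDag ζ Λ)^[n] ψ) ∧
    Tendsto (fun F => NormedSpace.exp (truncC ζ e f lam F) ψ) atTop
      (𝓝 (expOp (hatPairDag ζ Λ) ψ))) (fun N ψ hψ => ?_) (fun N ψ hψ φ hφ h1 h2 => ?_)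
  -- The bound is taken for 2 Λ: its n-th term carries a factor 2^n, so the terms for Λ are at most
  -- C / 2^n, uniformly in the truncation.
  · obtain ⟨C, hC⟩ := (hc.smul (c := 2) (by norm_num)).eventually_norm_exp_truncC_le (ζ := ζ)
      (h.smul 2) (exactly_le_upTo N hψ)
    have h2 : ∀ F : Finset κ, truncC ζ e f (fun k => 2 * lam k) F =
        (2 : ℂ) • truncC ζ e f lam F := fun F => by
      rw [truncC, truncC, Finset.smul_sum]
      refine Finset.sum_congr rfl fun k _ => ?_
      push_cast
      rw [smul_smul]
    have hb : ∀ᶠ F in atTop, ∀ n : ℕ,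
        ‖((n.factorial : ℂ)⁻¹) • (truncC ζ e f lam F ^ n) ψ‖ ≤ C * (1 / 2) ^ n :=
      hC.mono fun F hF n => by
        have h3 := (norm_term_le_norm_exp_truncC (ζ := ζ) (e := e) (f := f)
          (lam := fun k => 2 * lam k) F hψ n).trans hF
        rw [h2, smul_pow, smul_apply, smul_comm, norm_smul, norm_pow] at h3
        rw [one_div, inv_pow, ← div_eq_mul_inv, le_div_iff₀ (by positivity), mul_comm]
        simpa using h3
    have hlim : ∀ n : ℕ, Tendsto (fun F => ((n.factorial : ℂ)⁻¹) • (truncC ζ e f lam F ^ n) ψ)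
        atTop (𝓝 (((n.factorial : ℂ)⁻¹) • (hatPairDag ζ Λ)^[n] ψ)) := fun n =>
      (hc.tendsto_truncC_pow (h.isHS (ζ := ζ)) (exactly_le_upTo N hψ) n).const_smul _
    have hs : Summable fun n : ℕ => C * (1 / 2 : ℝ) ^ n :=
      (summable_geometric_of_lt_one (by norm_num) (by norm_num)).mul_left C
    refine ⟨Summable.of_norm_bounded hs fun n => le_of_tendsto (hlim n).norm
      (hb.mono fun F hF => hF n), ?_⟩
    have h3 := tendsto_tsum_of_dominated_convergence hs hlim hb
    simp only [(hasSum_exp_apply _ _).tsum_eq] at h3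
    exact h3
  · have hX := h.isHS (ζ := ζ)
    have e1 : ∀ n : ℕ, ((n.factorial : ℂ)⁻¹) • (hatPairDag ζ Λ)^[n] (ψ + φ) =
        ((n.factorial : ℂ)⁻¹) • (hatPairDag ζ Λ)^[n] ψ
          + ((n.factorial : ℂ)⁻¹) • (hatPairDag ζ Λ)^[n] φ := fun n => by
      rw [hX.iterate_add hψ hφ, smul_add]
    have e2 : expOp (hatPairDag ζ Λ) (ψ + φ) =
        expOp (hatPairDag ζ Λ) ψ + expOp (hatPairDag ζ Λ) φ := by
      simp only [expOp, e1]
      exact h1.1.tsum_add h2.1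
    refine ⟨?_, ?_⟩
    · simp only [e1]
      exact h1.1.add h2.1
    · rw [e2]
      simpa only [map_add] using h1.2.add h2.2

theorem IsXi.summable_expOp (h : IsXi Λ) (hψ : ψ ∈ upTo ι N) :
    Summable fun n : ℕ => ((n.factorial : ℂ)⁻¹) • (hatPairDag ζ Λ)^[n] ψ := by
  obtain ⟨E, f, lam, hc⟩ := h.exists_canonical
  exact (hc.tendsto_exp_truncC h hψ).1

/-- The Gram matrix of the vectors `e^(Λ^†) ψ`. -/
theorem IsMu.inner_expOp {μ : L →L[ℂ] L} (hμ : IsMu Λ μ) (h : IsXi Λ)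
    (v w : Sector ι N) :
    inner ℂ (expOp (hatPairDag ζ Λ) (incl ι N v)) (expOp (hatPairDag ζ Λ) (incl ι N w)) =
      inner ℂ (incl ι N (NormedSpace.exp (pairN N (hμ.isHS_expComp (ζ := ζ) h)) v))
        (NormedSpace.exp (hatCurrent ζ μ)
          (incl ι N (NormedSpace.exp (pairN N (hμ.isHS_expComp (ζ := ζ) h)) w))) := by
  obtain ⟨E, f, lam, hc⟩ := h.exists_canonical
  have hm := hc.isMu (hc.summable_sq (h.isHS (ζ := ζ))) h
  obtain rfl := hμ.ext hm
  exact tendsto_nhds_unique ((hc.tendsto_exp_truncC h (incl_mem v)).2.inner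
    (hc.tendsto_exp_truncC h (incl_mem w)).2)
    (hc.tendsto_inner_exp_truncC h (hμ.isHS_expComp (ζ := ζ) h) v w)

theorem commute_create_truncC (F : Finset κ) (η : L) :
    Commute (create ζ η) (truncC ζ e f lam F) := by
  refine Commute.sum_right _ _ _ fun k _ => Commute.smul_right ?_ _
  change create ζ η * (create ζ (f k) * create ζ (e k)) = create ζ (f k) * create ζ (e k) * create ζ η
  rw [← mul_assoc, create_mul_create ζ η, neg_mul, mul_assoc, create_mul_create ζ η, mul_neg,
    neg_neg, mul_assoc]

theorem truncC_mul_annih (F : Finset κ) (η : L) : truncC ζ e f lam F * annih ζ η =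
    annih ζ η * truncC ζ e f lam F + create ζ (canTrunc e f lam F η) := by
  have h1 : ∀ k, pairC ζ e f k * annih ζ η =
      annih ζ η * pairC ζ e f k + create ζ (rankTwo (e k) (f k) η) := fun k => by
    rw [rankTwo_apply, create_sub, create_smul, create_smul, inner_conj_symm, inner_conj_symm,
      pairC, ← mul_assoc (annih ζ η), annih_mul_create, sub_mul, mul_assoc (create ζ (f k)),
      mul_assoc (create ζ (f k)), annih_mul_create, smul_mul_assoc, one_mul, mul_sub,
      mul_smul_comm, mul_one]
    abel
  have h2 : create ζ (canTrunc e f lam F η) =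
      ∑ k ∈ F, (lam k : ℂ) • create ζ (rankTwo (e k) (f k) η) := by
    rw [← createL_apply, canTrunc, LinearMap.sum_apply, map_sum]
    refine Finset.sum_congr rfl fun k _ => ?_
    rw [LinearMap.smul_apply, createL_apply, real_smul_eq, create_smul, Complex.conj_ofReal]
  rw [h2, truncC, Finset.sum_mul, Finset.mul_sum, ← Finset.sum_add_distrib]
  refine Finset.sum_congr rfl fun k _ => ?_
  rw [smul_mul_assoc, h1, smul_add, mul_smul_comm]

theorem exp_truncC_create (F : Finset κ) (η : L) (ψ : Fock ι) :
    NormedSpace.exp (truncC ζ e f lam F) (create ζ η ψ) =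
      create ζ η (NormedSpace.exp (truncC ζ e f lam F) ψ) :=
  exp_comp_of_semiconj (T := create ζ η) (fun v => by
    rw [← mul_apply_eq_comp, ← mul_apply_eq_comp, (commute_create_truncC F η).eq]) ψ

theorem exp_truncC_annih (F : Finset κ) (η : L) (ψ : Fock ι) :
    NormedSpace.exp (truncC ζ e f lam F) (annih ζ η ψ) =
      annih ζ η (NormedSpace.exp (truncC ζ e f lam F) ψ)
        + create ζ (canTrunc e f lam F η) (NormedSpace.exp (truncC ζ e f lam F) ψ) :=
  exp_comp_of_comp_eq_add (T := annih ζ η) (fun v => by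
    rw [← mul_apply_eq_comp, truncC_mul_annih]; rfl) (fun v => by
    rw [← mul_apply_eq_comp, ← mul_apply_eq_comp, (commute_create_truncC F _).eq]) ψ

/-- The relation for the bounded truncations survives the limit. Together with `IsXi.expOp_annih` it
makes the orthogonal complement of the range of e^(Λ^†) invariant under all field operators. -/
theorem IsXi.expOp_create (h : IsXi Λ) (hψ : ψ ∈ upTo ι N) (η : L) :
    expOp (hatPairDag ζ Λ) (create ζ η ψ) = create ζ η (expOp (hatPairDag ζ Λ) ψ) := by
  obtain ⟨E, f, lam, hc⟩ := h.exists_canonical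
  have h1 := (hc.tendsto_exp_truncC (ζ := ζ) h (create_mem_upTo ζ η hψ)).2
  simp only [exp_truncC_create] at h1
  exact tendsto_nhds_unique h1
    (((create ζ η).continuous.tendsto _).comp (hc.tendsto_exp_truncC h hψ).2)

theorem IsXi.expOp_annih (h : IsXi Λ) (hψ : ψ ∈ upTo ι N) (η : L) :
    expOp (hatPairDag ζ Λ) (annih ζ η ψ) = annih ζ η (expOp (hatPairDag ζ Λ) ψ)
      + create ζ (Λ η) (expOp (hatPairDag ζ Λ) ψ) := by
  obtain ⟨E, f, lam, hc⟩ := h.exists_canonical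
  have h1 := (hc.tendsto_exp_truncC (ζ := ζ) h (annih_mem_upTo ζ η hψ)).2
  simp only [exp_truncC_annih] at h1
  have h2 := (hc.tendsto_exp_truncC (ζ := ζ) h hψ).2
  have h3 : Tendsto (fun F => create ζ (canTrunc (fun e : E => (e : L)) f lam F η)) atTop
      (𝓝 (create ζ (Λ η))) :=
    ((createL ζ).continuous.tendsto _).comp (hc.tendsto_canTrunc (h.isHS (ζ := ζ)) η)
  exact tendsto_nhds_unique h1
    ((((annih ζ η).continuous.tendsto _).comp h2).add (tendsto_clm_apply h3 h2))

theorem IsXi.expOp_add (h : IsXi Λ) (hψ : ψ ∈ upTo ι N) (hφ : φ ∈ upTo ι N) :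
    expOp (hatPairDag ζ Λ) (ψ + φ) = expOp (hatPairDag ζ Λ) ψ + expOp (hatPairDag ζ Λ) φ := by
  simp only [expOp, (h.isHS (ζ := ζ)).iterate_add hψ hφ, smul_add]
  exact (h.summable_expOp hψ).tsum_add (h.summable_expOp hφ)

theorem IsXi.expOp_smul (h : IsXi Λ) (hψ : ψ ∈ upTo ι N) (c : ℂ) :
    expOp (hatPairDag ζ Λ) (c • ψ) = c • expOp (hatPairDag ζ Λ) ψ := by
  obtain ⟨E, f, lam, hc⟩ := h.exists_canonical
  have h1 := (hc.tendsto_exp_truncC (ζ := ζ) h (Submodule.smul_mem _ c hψ)).2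
  simp only [_root_.map_smul] at h1
  exact tendsto_nhds_unique h1 ((hc.tendsto_exp_truncC h hψ).2.const_smul c)

end ExpPairDag

/-! ### Normal ordering of the vector part. -/

section TwoModes

variable {A : Type*} [Ring A] [Algebra ℂ A]

/-- Here u, v are annihilators and p, q creators. In expanding either side, the only annihilator
ever standing to the left of a creator is u to the left of p, so u p is the only mixed relation
required. -/
theorem two_mode_identity {u v p q : A} (huu : u * u = 0) (hvv : v * v = 0) (hpp : p * p = 0)
    (hqq : q * q = 0) (hvu : v * u = -(u * v)) (hqp : q * p = -(p * q)) {c : ℂ} (hc : 1 + c ≠ 0)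
    (hup : u * p = c • 1 - p * u) :
    (1 + u - q) * (1 + p - v) =
      (1 + (1 + c)⁻¹ • (p - q)) * (1 - (1 + c)⁻¹ • (q * p)) * (1 + q * u) *
        ((1 + c) • 1 - ((2 + c) / (1 + c)) • (p * u)) * (1 + p * v) *
        (1 - (1 + c)⁻¹ • (u * v)) * (1 + (1 + c)⁻¹ • (u - v)) := by
  have a1 : ∀ x, u * (u * x) = 0 := fun x => by rw [← mul_assoc, huu, zero_mul]
  have a3 : ∀ x, p * (p * x) = 0 := fun x => by rw [← mul_assoc, hpp, zero_mul]
  have a4 : ∀ x, q * (q * x) = 0 := fun x => by rw [← mul_assoc, hqq, zero_mul]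
  have b1 : ∀ x, v * (u * x) = -(u * (v * x)) := fun x => by
    rw [← mul_assoc, hvu, neg_mul, mul_assoc]
  have b2 : ∀ x, q * (p * x) = -(p * (q * x)) := fun x => by
    rw [← mul_assoc, hqp, neg_mul, mul_assoc]
  have b3 : ∀ x, u * (p * x) = c • x - p * (u * x) := fun x => by
    rw [← mul_assoc, hup, sub_mul, smul_mul_assoc, one_mul, mul_assoc]
  simp only [mul_add, add_mul, mul_sub, sub_mul, mul_one, one_mul, smul_mul_assoc, mul_smul_comm,
    mul_assoc, huu, hvv, hqq, hvu, hqp, hup, a1, a3, a4, b1, b2, b3, mul_neg, neg_mul,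
    neg_neg, smul_add, smul_sub, smul_neg, smul_zero, mul_zero, neg_zero, add_zero, sub_zero,
    zero_sub]
  match_scalars <;> field_simp <;> ring

end TwoModes

/-! ### The normalized field operators ξ^ and ξ^†. -/

section HatVec

variable {ι : Type*} [LinearOrder ι] {L : Type*} [NormedAddCommGroup L] [InnerProductSpace ℂ L]
  {ζ : HilbertBasis ι ℂ L} {N : ℕ} {ψ φ : Fock ι}

theorem inv_sqrt_two_mul_self :
    ((1 / Real.sqrt 2 : ℝ) : ℂ) * ((1 / Real.sqrt 2 : ℝ) : ℂ) = 1 / 2 := by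
  rw [← Complex.ofReal_mul, div_mul_div_comm, Real.mul_self_sqrt (by norm_num)]
  push_cast
  norm_num

theorem hatVecDag_eq (ξ : L) : hatVecDag ζ ξ = ((1 / Real.sqrt 2 : ℝ) : ℂ) • create ζ ξ := by
  rw [hatVecDag, hatVec, map_smulₛₗ, Complex.conj_ofReal, adjoint_annih]

theorem adjoint_hatVecDag (ξ : L) : (hatVecDag ζ ξ).adjoint = hatVec ζ ξ := adjoint_adjoint _

theorem hatVec_sub (ξ τ : L) : hatVec ζ (ξ - τ) = hatVec ζ ξ - hatVec ζ τ := by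
  rw [hatVec, annih_sub, smul_sub, hatVec, hatVec]

theorem hatVec_smul (c : ℂ) (ξ : L) : hatVec ζ (c • ξ) = c • hatVec ζ ξ := by
  rw [hatVec, annih_smul, smul_comm, hatVec]

theorem hatVec_neg (ξ : L) : hatVec ζ (-ξ) = -hatVec ζ ξ := by
  rw [hatVec, annih_neg, smul_neg, hatVec]

theorem hatVec_zero : hatVec ζ 0 = 0 := by rw [hatVec, annih_zero, smul_zero]

theorem hatVec_mul_hatVec (ξ τ : L) : hatVec ζ ξ * hatVec ζ τ = -(hatVec ζ τ * hatVec ζ ξ) := by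
  rw [hatVec, hatVec, smul_mul_smul_comm, smul_mul_smul_comm, annih_mul_annih, smul_neg]

theorem hatVecDag_mul_hatVecDag (ξ τ : L) :
    hatVecDag ζ ξ * hatVecDag ζ τ = -(hatVecDag ζ τ * hatVecDag ζ ξ) := by
  rw [hatVecDag_eq, hatVecDag_eq, smul_mul_smul_comm, smul_mul_smul_comm, create_mul_create,
    smul_neg]

theorem hatVec_mul_self (ξ : L) : hatVec ζ ξ * hatVec ζ ξ = 0 :=
  eq_zero_of_eq_neg_self (hatVec_mul_hatVec ξ ξ)

theorem hatVecDag_mul_self (ξ : L) : hatVecDag ζ ξ * hatVecDag ζ ξ = 0 :=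
  eq_zero_of_eq_neg_self (hatVecDag_mul_hatVecDag ξ ξ)

theorem hatVec_mul_hatVecDag (ξ τ : L) : hatVec ζ τ * hatVecDag ζ ξ =
    (1 / 2 * inner ℂ ξ τ : ℂ) • 1 - hatVecDag ζ ξ * hatVec ζ τ := by
  rw [hatVecDag_eq, hatVec, smul_mul_smul_comm, smul_mul_smul_comm, annih_mul_create,
    inv_sqrt_two_mul_self, smul_sub, smul_smul]

theorem create_mul_annih_eq (ξ τ : L) :
    create ζ ξ * annih ζ τ = (2 : ℂ) • (hatVecDag ζ ξ * hatVec ζ τ) := by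
  rw [hatVecDag_eq, hatVec, smul_mul_smul_comm, inv_sqrt_two_mul_self, smul_smul]
  norm_num

theorem annih_mul_annih_eq (ξ τ : L) :
    annih ζ ξ * annih ζ τ = (2 : ℂ) • (hatVec ζ ξ * hatVec ζ τ) := by
  rw [hatVec, hatVec, smul_mul_smul_comm, inv_sqrt_two_mul_self, smul_smul]
  norm_num

theorem hatVec_mem_upTo (ξ : L) (hψ : ψ ∈ upTo ι N) : hatVec ζ ξ ψ ∈ upTo ι N :=
  Submodule.smul_mem _ _ (annih_mem_upTo ζ ξ hψ)

theorem hatVecDag_mem_upTo (ξ : L) (hψ : ψ ∈ upTo ι N) : hatVecDag ζ ξ ψ ∈ upTo ι (N + 1) := by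
  rw [hatVecDag_eq]
  exact Submodule.smul_mem _ _ (create_mem_upTo ζ ξ hψ)

variable [CompleteSpace L] {μ : L →L[ℂ] L}

theorem exp_hatCurrent_mul_hatVec {l : L →L[ℂ] L} (hl : IsTraceClass l) (v : L) :
    NormedSpace.exp (hatCurrent ζ l) * hatVec ζ v =
      hatVec ζ (NormedSpace.exp (-l) v) * NormedSpace.exp (hatCurrent ζ l) := by
  rw [hatVec, mul_smul_comm, exp_hatCurrent_mul_annih ζ hl, hatVec, smul_mul_assoc]

theorem exp_hatCurrent_mul_hatVecDag (hl : IsTraceClass μ) (hsa : IsSelfAdjoint μ) (v : L) :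
    NormedSpace.exp (hatCurrent ζ μ) * hatVecDag ζ v =
      hatVecDag ζ (NormedSpace.exp μ v) * NormedSpace.exp (hatCurrent ζ μ) := by
  have h1 : IsSelfAdjoint (hatCurrent ζ μ) := by
    rw [IsSelfAdjoint, ContinuousLinearMap.star_eq_adjoint, ← hatCurrent_adjoint ζ hl,
      ← ContinuousLinearMap.star_eq_adjoint, hsa.star_eq]
  have h2 := congrArg star (exp_hatCurrent_mul_hatVec (ζ := ζ) hl (NormedSpace.exp μ v))
  rw [star_mul, star_mul, h1.exp.star_eq, exp_neg_exp_apply] at h2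
  exact h2.symm

end HatVec

/-! ### Factorization of the vector part through ν and β. -/

section Core

variable {ι : Type*} [LinearOrder ι] {L : Type*} [NormedAddCommGroup L] [InnerProductSpace ℂ L]
  [CompleteSpace L] (ζ : HilbertBasis ι ℂ L) {Λ : L →ₗ[ℝ] L} {μ : L →L[ℂ] L}

/-- Orthogonality of ξ and e^μ Λ ξ removes the scalar part of the current and makes its square zero.
-/
theorem exp_hatCurrent_nuOp (Λ : L →ₗ[ℝ] L) (μ : L →L[ℂ] L) (ξ : L)
    (h : inner ℂ ξ (NormedSpace.exp μ (Λ ξ)) = 0) :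
    NormedSpace.exp (hatCurrent ζ (nuOp Λ μ ξ)) =
      1 + hatVecDag ζ ξ * hatVec ζ (NormedSpace.exp μ (Λ ξ)) := by
  have e1 : hatCurrent ζ (nuOp Λ μ ξ) = hatVecDag ζ ξ * hatVec ζ (NormedSpace.exp μ (Λ ξ)) := by
    rw [nuOp, hatCurrent_smul_rankOne, current, h, mul_zero, zero_smul, sub_zero,
      create_mul_annih_eq, smul_smul]
    norm_num
  rw [e1, exp_of_mul_self_eq_zero]
  rw [mul_assoc, ← mul_assoc (hatVec ζ _), hatVec_mul_hatVecDag, h, mul_zero, zero_smul, zero_sub,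
    neg_mul, mul_assoc, hatVec_mul_self, mul_zero, neg_zero, mul_zero]

/-- With β = -2 κ ξ ⟨e^μ ξ, ·⟩ and e^(κ b) = 1 + c, the scalar part of the current contributes 1 + c
and its rank one part the eigenvalue (1 + c)⁻². This is the middle factor of `two_mode_identity`; c
= b/2 reflects the factor 1/√2 in ξ^. -/
theorem exp_hatCurrent_betaOp (hsa : IsSelfAdjoint μ) (ξ : L) {c : ℂ} (hc : c = bCoeff μ ξ / 2) :
    NormedSpace.exp (hatCurrent ζ (betaOp μ ξ)) = (1 + c) • 1 -
      ((2 + c) / (1 + c)) • (hatVecDag ζ (NormedSpace.exp μ ξ) * hatVec ζ ξ) := by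
  by_cases hb : bReal μ ξ = 0
  · have hξ := eq_zero_of_bReal hb
    have hc0 : c = 0 := by rw [hc, hξ, bCoeff, inner_zero_left, zero_div]
    rw [betaOp, hatCurrent_smul_rankOne, hξ, hc0, current, annih_zero, hatVec_zero]
    simp
  have hbc : bCoeff μ ξ = bReal μ ξ := bCoeff_eq hsa ξ
  have hb' : (bReal μ ξ : ℂ) ≠ 0 := Complex.ofReal_ne_zero.2 hb
  have hcb : (bReal μ ξ : ℂ) = 2 * c := by rw [hc, hbc]; ring
  have hc0 : c ≠ 0 := fun h => hb' (by rw [hcb, h, mul_zero])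
  have hin : inner ℂ (NormedSpace.exp μ ξ) ξ = (bReal μ ξ : ℂ) := by
    rw [inner_exp_left hsa, ← hbc, bCoeff]
  set T := create ζ (NormedSpace.exp μ ξ) * annih ζ ξ with hT
  have hTT : T * T = (bReal μ ξ : ℂ) • T := by
    rw [hT, mul_assoc, ← mul_assoc (annih ζ ξ), annih_mul_create, hin, sub_mul, mul_assoc (create ζ _)
      (annih ζ ξ), annih_mul_self, mul_zero, sub_zero, smul_mul_assoc, one_mul, mul_smul_comm]
  have e1 : hatCurrent ζ (betaOp μ ξ) = ((betaCoeff μ ξ : ℂ) * bReal μ ξ) • (1 : Fock ι →L[ℂ] Fock ι)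
      + (-2 * betaCoeff μ ξ : ℂ) • T := by
    rw [betaOp, hatCurrent_smul_rankOne, current, hin, smul_sub, smul_smul, sub_eq_add_neg, add_comm,
      ← neg_smul]
    congr 2
    ring
  have h1c : 1 + c ≠ 0 := by
    have h0 := bReal_nonneg μ ξ
    have : (1 + c) = ((1 + bReal μ ξ / 2 : ℝ) : ℂ) := by push_cast; rw [hcb]; ring
    rw [this]
    exact Complex.ofReal_ne_zero.2 (by positivity)
  have e2 : Complex.exp ((betaCoeff μ ξ : ℂ) * bReal μ ξ) = 1 + c := by
    rw [exp_betaCoeff_mul hb, hcb]; ring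
  have e3 : Complex.exp ((-2 * betaCoeff μ ξ : ℂ) * bReal μ ξ) = ((1 + c) * (1 + c))⁻¹ := by
    rw [← e2, ← Complex.exp_add, ← Complex.exp_neg]
    congr 1
    ring
  rw [e1, exp_add_of_commute ((Commute.one_left _).smul_left _), exp_smul_one, e2,
    exp_smul_of_mul_self hTT hb', e3, smul_mul_assoc, one_mul, hT, create_mul_annih_eq, hcb]
  match_scalars
  · ring
  · field_simp
    ring

/-- The part of `e^(Ω^ + ω^)` which comes from the vector `ξ`. -/
def vecFactor (μ : L →L[ℂ] L) (Λ : L →ₗ[ℝ] L) (ξ : L) (c : ℂ) : Fock ι →L[ℂ] Fock ι :=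
  (1 - (1 + c)⁻¹ • (hatVec ζ (NormedSpace.exp μ ξ) * hatVec ζ (NormedSpace.exp μ (Λ ξ)))) *
    (1 + (1 + c)⁻¹ • (hatVec ζ (NormedSpace.exp μ ξ) - hatVec ζ (NormedSpace.exp μ (Λ ξ))))

/-- Carry e^(μ^) to the far right on both sides. Annihilators lose and creators gain a factor e^μ,
and what remains is `two_mode_identity` for u = ξ^, v = (Λ ξ)^, p = (e^μ ξ)^†, q = (e^μ Λ ξ)^†. -/
theorem IsMu.factorization (hμ : IsMu Λ μ) (h : IsXi Λ) (ξ : L) {c : ℂ} (hc : c = bCoeff μ ξ / 2) :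
    (1 + hatVecDag ζ ξ - hatVec ζ (NormedSpace.exp μ (Λ ξ))).adjoint *
        NormedSpace.exp (hatCurrent ζ μ) *
        (1 + hatVecDag ζ ξ - hatVec ζ (NormedSpace.exp μ (Λ ξ))) =
      (vecFactor ζ μ Λ ξ c).adjoint *
        ((NormedSpace.exp (hatCurrent ζ (nuOp Λ μ ξ))).adjoint *
          NormedSpace.exp (hatCurrent ζ (betaOp μ ξ)) * NormedSpace.exp (hatCurrent ζ μ) *
          NormedSpace.exp (hatCurrent ζ (nuOp Λ μ ξ))) * vecFactor ζ μ Λ ξ c := by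
  have hsa := hμ.isSelfAdjoint
  have hcr : c = ((bReal μ ξ / 2 : ℝ) : ℂ) := by rw [hc, bCoeff_eq hsa]; push_cast; rfl
  have h1c : 1 + c ≠ 0 := by
    have h0 := bReal_nonneg μ ξ
    have : (1 + c) = ((1 + bReal μ ξ / 2 : ℝ) : ℂ) := by rw [hcr]; push_cast; rfl
    rw [this]
    exact Complex.ofReal_ne_zero.2 (by positivity)
  have hconj : star ((1 + c)⁻¹) = (1 + c)⁻¹ := by
    rw [hcr, Complex.star_def, map_inv₀, map_add, map_one, Complex.conj_ofReal]
  have h0 : inner ℂ ξ (NormedSpace.exp μ (Λ ξ)) = 0 := by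
    have := hμ.antisymm h ξ ξ
    linear_combination this / 2
  set M := NormedSpace.exp (hatCurrent ζ μ) with hM
  set U := hatVec ζ ξ with hU
  set V := hatVec ζ (Λ ξ) with hV
  set P := hatVecDag ζ (NormedSpace.exp μ ξ) with hP
  set Q := hatVecDag ζ (NormedSpace.exp μ (Λ ξ)) with hQ
  have m1 : M * hatVec ζ (NormedSpace.exp μ (Λ ξ)) = V * M := by
    rw [hM, exp_hatCurrent_mul_hatVec hμ.traceClass, exp_neg_exp_apply]
  have m2 : M * hatVec ζ (NormedSpace.exp μ ξ) = U * M := by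
    rw [hM, exp_hatCurrent_mul_hatVec hμ.traceClass, exp_neg_exp_apply]
  have m3 : M * hatVecDag ζ ξ = P * M := exp_hatCurrent_mul_hatVecDag hμ.traceClass hsa ξ
  have hadj : ∀ T : Fock ι →L[ℂ] Fock ι, T.adjoint = star T := fun _ => rfl
  have s1 : star (hatVecDag ζ ξ) = U := adjoint_hatVecDag ξ
  have s2 : star (hatVec ζ (NormedSpace.exp μ (Λ ξ))) = Q := rfl
  have s3 : star (hatVec ζ (NormedSpace.exp μ ξ)) = P := rfl
  have key := two_mode_identity (hatVec_mul_self (ζ := ζ) ξ) (hatVec_mul_self (ζ := ζ) (Λ ξ))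
    (hatVecDag_mul_self (ζ := ζ) (NormedSpace.exp μ ξ))
    (hatVecDag_mul_self (ζ := ζ) (NormedSpace.exp μ (Λ ξ))) (hatVec_mul_hatVec (Λ ξ) ξ)
    (hatVecDag_mul_hatVecDag _ _) h1c (by
      rw [hatVec_mul_hatVecDag, inner_exp_left hsa, hc, bCoeff, mul_comm, mul_one_div])
  rw [← hU, ← hV, ← hP, ← hQ] at key
  rw [exp_hatCurrent_betaOp ζ hsa ξ hc, exp_hatCurrent_nuOp ζ Λ μ ξ h0, vecFactor, ← hU, ← hP]
  simp only [hadj, star_sub, star_add, star_one, star_mul, star_smul, s1, s2, s3, hconj]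
  have l1 : M * (1 + hatVecDag ζ ξ - hatVec ζ (NormedSpace.exp μ (Λ ξ))) = (1 + P - V) * M := by
    rw [mul_sub, mul_add, m1, m3, sub_mul, add_mul, one_mul, mul_one]
  have l2 : M * (1 + hatVecDag ζ ξ * hatVec ζ (NormedSpace.exp μ (Λ ξ))) = (1 + P * V) * M := by
    rw [mul_add, mul_one, ← mul_assoc, m3, mul_assoc, m1, add_mul, one_mul, mul_assoc]
  have l3 : M * (1 - (1 + c)⁻¹ •
      (hatVec ζ (NormedSpace.exp μ ξ) * hatVec ζ (NormedSpace.exp μ (Λ ξ)))) =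
      (1 - (1 + c)⁻¹ • (U * V)) * M := by
    rw [mul_sub, mul_one, mul_smul_comm, ← mul_assoc, m2, mul_assoc, m1, sub_mul, one_mul,
      smul_mul_assoc, mul_assoc]
  have l4 : M * (1 + (1 + c)⁻¹ •
      (hatVec ζ (NormedSpace.exp μ ξ) - hatVec ζ (NormedSpace.exp μ (Λ ξ)))) =
      (1 + (1 + c)⁻¹ • (U - V)) * M := by
    rw [mul_add, mul_one, mul_smul_comm, mul_sub, m2, m1, add_mul, one_mul, smul_mul_assoc, sub_mul]
  rw [mul_assoc, l1, ← mul_assoc, key]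
  simp only [mul_assoc]
  rw [← l4, ← mul_assoc (1 - (1 + c)⁻¹ • (U * V)) M, ← l3, mul_assoc M,
    ← mul_assoc (1 + P * V) M, ← l2, mul_assoc M]

end Core

/-! ### The annihilating exponentials e^(Λ^ + ξ^). -/

section LowerExp

variable {ι : Type*} [LinearOrder ι] {L : Type*} [NormedAddCommGroup L] [InnerProductSpace ℂ L]
  (ζ : HilbertBasis ι ℂ L) {Λ M : L →ₗ[ℝ] L} {N : ℕ} {ψ φ : Fock ι}

/-- The exponential `e^(Λ^ + ξ^)`. -/
def lowerExp (Λ : L →ₗ[ℝ] L) (ξ : L) (ψ : Fock ι) : Fock ι :=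
  expOp (fun ψ => hatPair ζ Λ ψ + hatVec ζ ξ ψ) ψ

/-- The operator `ξ^` on the vectors with at most `N` particles. -/
def vecN (N : ℕ) (ξ : L) : Sector ι N →L[ℂ] Sector ι N :=
  sectorRestrict (hatVec ζ ξ) fun _ hψ => hatVec_mem_upTo ξ hψ

variable {ζ}

theorem incl_vecN (ξ : L) (v : Sector ι N) : incl ι N (vecN ζ N ξ v) = hatVec ζ ξ (incl ι N v) := rfl

theorem vecN_mul_self (ξ : L) : vecN ζ N ξ * vecN ζ N ξ = 0 := by
  ext v
  refine incl_injective ?_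
  rw [mul_apply_eq_comp, incl_vecN, incl_vecN, ← mul_apply_eq_comp, hatVec_mul_self]
  rfl

theorem IsHS.hatPair_hatVec (h : IsHS ζ Λ) (ξ : L) (hψ : ψ ∈ upTo ι N) :
    hatPair ζ Λ (hatVec ζ ξ ψ) = hatVec ζ ξ (hatPair ζ Λ ψ) := by
  rw [hatVec, smul_apply, h.hatPair_smul _ (annih_mem_upTo ζ ξ hψ), h.hatPair_annih ξ hψ]
  rfl

theorem commute_pairN_vecN (h : IsHS ζ Λ) (ξ : L) : Commute (pairN N h) (vecN ζ N ξ) := by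
  refine ContinuousLinearMap.ext fun v => incl_injective ?_
  change hatPair ζ Λ (hatVec ζ ξ (incl ι N v)) = hatVec ζ ξ (hatPair ζ Λ (incl ι N v))
  exact h.hatPair_hatVec ξ (incl_mem v)

theorem lowerExp_incl (h : IsHS ζ Λ) (ξ : L) (v : Sector ι N) : lowerExp ζ Λ ξ (incl ι N v) =
    incl ι N (NormedSpace.exp (pairN N h + vecN ζ N ξ) v) :=
  expOp_of_semiconj (fun v => by rw [add_apply, map_add, incl_pairN, incl_vecN]) v

theorem IsHS.lowerExp_mem_upTo (h : IsHS ζ Λ) (ξ : L) (hψ : ψ ∈ upTo ι N) :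
    lowerExp ζ Λ ξ ψ ∈ upTo ι N := by
  rw [← incl_toSector ψ hψ, lowerExp_incl h]
  exact incl_mem _

theorem IsHS.lowerExp_add (h : IsHS ζ Λ) (ξ : L) (hψ : ψ ∈ upTo ι N) (hφ : φ ∈ upTo ι N) :
    lowerExp ζ Λ ξ (ψ + φ) = lowerExp ζ Λ ξ ψ + lowerExp ζ Λ ξ φ := by
  rw [← incl_toSector ψ hψ, ← incl_toSector φ hφ, ← map_add, lowerExp_incl h, lowerExp_incl h,
    lowerExp_incl h, map_add, map_add]

theorem IsHS.lowerExp_smul (h : IsHS ζ Λ) (ξ : L) (hψ : ψ ∈ upTo ι N) (c : ℂ) :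
    lowerExp ζ Λ ξ (c • ψ) = c • lowerExp ζ Λ ξ ψ := by
  rw [← incl_toSector ψ hψ, ← _root_.map_smul, lowerExp_incl h, lowerExp_incl h, _root_.map_smul,
    _root_.map_smul]

theorem vecN_zero : vecN ζ N 0 = 0 := by
  ext v
  refine incl_injective ?_
  rw [incl_vecN, hatVec_zero]
  rfl

theorem lowerExp_zero_incl (h : IsHS ζ Λ) (v : Sector ι N) : lowerExp ζ Λ 0 (incl ι N v) =
    incl ι N (NormedSpace.exp (pairN N h) v) := by
  rw [lowerExp_incl h, vecN_zero, add_zero]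

/-- The vector part of `e^(Λ^ + ξ^)` splits off. -/
theorem IsHS.lowerExp_eq (h : IsHS ζ Λ) (ξ : L) (hψ : ψ ∈ upTo ι N) :
    lowerExp ζ Λ ξ ψ = lowerExp ζ Λ 0 ψ + hatVec ζ ξ (lowerExp ζ Λ 0 ψ) := by
  rw [← incl_toSector ψ hψ, lowerExp_incl h, lowerExp_zero_incl h, add_comm (pairN N h),
    exp_add_of_commute (commute_pairN_vecN h ξ).symm,
    exp_of_mul_self_eq_zero (vecN_mul_self ξ), mul_apply_eq_comp, add_apply, one_apply_eq_self,
    map_add, incl_vecN]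

theorem pairN_neg (h : IsHS ζ Λ) : pairN N h.neg = -pairN N h := by
  ext v
  refine incl_injective ?_
  rw [neg_apply, map_neg, incl_pairN, incl_pairN, h.neg_hatPair (incl_mem v)]

theorem vecN_neg (ξ : L) : vecN ζ N (-ξ) = -vecN ζ N ξ := by
  ext v
  refine incl_injective ?_
  rw [neg_apply, map_neg, incl_vecN, incl_vecN, hatVec_neg, neg_apply]

theorem IsHS.lowerExp_neg_lowerExp (h : IsHS ζ Λ) (ξ : L) (hψ : ψ ∈ upTo ι N) :
    lowerExp ζ (-Λ) (-ξ) (lowerExp ζ Λ ξ ψ) = ψ := by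
  rw [← incl_toSector ψ hψ, lowerExp_incl h, lowerExp_incl h.neg, pairN_neg h, vecN_neg, ← neg_add,
    ← mul_apply_eq_comp, exp_neg_mul_exp, one_apply_eq_self]

theorem IsHS.lowerExp_lowerExp_neg (h : IsHS ζ Λ) (ξ : L) (hψ : ψ ∈ upTo ι N) :
    lowerExp ζ Λ ξ (lowerExp ζ (-Λ) (-ξ) ψ) = ψ := by
  have := h.neg.lowerExp_neg_lowerExp (-ξ) hψ
  rwa [neg_neg, neg_neg] at this

theorem IsHS.hatPair_vac (h : IsHS ζ Λ) : hatPair ζ Λ (vac ι) = 0 := by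
  refine (h.hasSum_pair (vac_mem_upTo 0)).unique ?_
  simp

theorem IsHS.lowerExp_vac (h : IsHS ζ Λ) (ξ : L) : lowerExp ζ Λ ξ (vac ι) = vac ι := by
  have h1 : (pairN 0 h + vecN ζ 0 ξ) (toSector (vac ι) (vac_mem_upTo 0)) =
      (0 : ℂ) • toSector (vac ι) (vac_mem_upTo 0) := by
    refine incl_injective ?_
    rw [zero_smul, map_zero, add_apply, map_add, incl_pairN, incl_vecN, incl_toSector,
      h.hatPair_vac, hatVec, smul_apply, annih_vac, smul_zero, add_zero]
  have h2 := lowerExp_incl h ξ (toSector (vac ι) (vac_mem_upTo 0))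
  rw [exp_apply_of_eigenvector h1, Complex.exp_zero, one_smul] at h2
  exact h2

/-- Creation operators as maps between sectors. -/
def createN (ζ : HilbertBasis ι ℂ L) (N : ℕ) (ξ : L) : Sector ι N →L[ℂ] Sector ι (N + 1) :=
  sectorRestrict (create ζ ξ) fun _ hψ => create_mem_upTo ζ ξ hψ

theorem incl_createN (ξ : L) (v : Sector ι N) :
    incl ι (N + 1) (createN ζ N ξ v) = create ζ ξ (incl ι N v) := rfl

theorem IsHS.lowerExp_create (h : IsHS ζ Λ) (α : L) (hψ : ψ ∈ upTo ι N) :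
    lowerExp ζ Λ 0 (create ζ α ψ) =
      create ζ α (lowerExp ζ Λ 0 ψ) - annih ζ (Λ α) (lowerExp ζ Λ 0 ψ) := by
  have h1 := exp_comp_of_comp_eq_add (k := pairN N h) (l := pairN (N + 1) h) (T := createN ζ N α)
    (y := -sectorRestrict (annih ζ (Λ α)) fun _ hψ => upTo_mono N.le_succ (annih_mem_upTo ζ _ hψ))
    (fun v => incl_injective (by
      rw [incl_pairN, incl_createN, h.hatPair_create α (incl_mem v), map_add, neg_apply, map_neg,
        incl_createN, incl_pairN, incl_sectorRestrict, sub_eq_add_neg]))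
    (fun v => incl_injective (by
      have h2 : annih ζ (Λ α) (incl ι N v) ∈ upTo ι N := annih_mem_upTo ζ _ (incl_mem v)
      have h3 := h.smul_hatPair (-1) h2
      rw [neg_apply, neg_apply, map_neg, map_neg, map_neg, incl_pairN, incl_sectorRestrict,
        incl_sectorRestrict, h.hatPair_annih _ (incl_mem v), incl_pairN])) (toSector ψ hψ)
  have h2 := congrArg (incl ι (N + 1)) h1
  rw [← lowerExp_zero_incl h, map_add, neg_apply, map_neg, incl_createN, incl_createN,
    incl_sectorRestrict, ← lowerExp_zero_incl h, incl_toSector, ← sub_eq_add_neg] at h2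
  exact h2

/-- This and the next lemma recover ξ and Λ from vacuum components of e^(Λ^ + ξ^). On two particles
ξ drops out, since ξ^ removes an odd number of them. -/
theorem IsHS.inner_vac_lowerExp_create (h : IsHS ζ Λ) (ξ α : L) :
    inner ℂ (vac ι) (lowerExp ζ Λ ξ (create ζ α (vac ι))) =
      ((1 / Real.sqrt 2 : ℝ) : ℂ) * inner ℂ α ξ := by
  rw [h.lowerExp_eq ξ (create_mem_upTo ζ α (vac_mem_upTo 0)), h.lowerExp_create α (vac_mem_upTo 0),
    h.lowerExp_vac, annih_vac, sub_zero, hatVec, smul_apply, annih_create_apply, annih_vac]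
  simp only [map_zero, sub_zero, inner_add_right, inner_vac_create, inner_smul_right, inner_vac_vac,
    mul_one, zero_add]

theorem IsHS.inner_vac_lowerExp_create_create (h : IsHS ζ Λ) (ξ α γ : L) :
    inner ℂ (vac ι) (lowerExp ζ Λ ξ (create ζ α (create ζ γ (vac ι)))) = -inner ℂ γ (Λ α) := by
  rw [h.lowerExp_eq ξ (create_mem_upTo ζ α (create_mem_upTo ζ γ (vac_mem_upTo 0))),
    h.lowerExp_create α (create_mem_upTo ζ γ (vac_mem_upTo 0)),
    h.lowerExp_create γ (vac_mem_upTo 0),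
    h.lowerExp_vac, annih_vac, sub_zero, hatVec, smul_apply]
  simp only [map_sub, annih_create_apply, annih_vac, map_zero, sub_zero, inner_add_right,
    inner_sub_right, inner_vac_create, inner_smul_right, _root_.map_smul, inner_vac_vac]
  simp

end LowerExp

/-! ### The Gram matrix of e^(Λ^† + ξ^†). -/

section Gram

variable {ι : Type*} [LinearOrder ι] {L : Type*} [NormedAddCommGroup L] [InnerProductSpace ℂ L]
  [CompleteSpace L] {ζ : HilbertBasis ι ℂ L} {Λ : L →ₗ[ℝ] L} {μ : L →L[ℂ] L} {N : ℕ} {ψ φ : Fock ι}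

/-- The map `omegaMap` as a real linear map. -/
def omegaL (Λ : L →ₗ[ℝ] L) (μ : L →L[ℂ] L) (ξ : L) : L →ₗ[ℝ] L :=
  expComp μ Λ - (2 + bReal μ ξ)⁻¹ • rankTwo (NormedSpace.exp μ ξ) (NormedSpace.exp μ (Λ ξ))

theorem omegaL_apply (hsa : IsSelfAdjoint μ) (ξ η : L) : omegaL Λ μ ξ η = omegaMap Λ μ ξ η := by
  rw [omegaL, omegaMap, LinearMap.sub_apply, LinearMap.smul_apply, expComp_apply, rankTwo_apply,
    bCoeff_eq hsa, real_smul_eq]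
  push_cast
  rfl

theorem IsMu.isHS_omegaL (hμ : IsMu Λ μ) (h : IsXi Λ) (ξ : L) : IsHS ζ (omegaL Λ μ ξ) :=
  (hμ.isHS_expComp h).sub ((isHS_rankTwo _ _).smul _)

/-- The vector `ω = 2 (2 + b)⁻¹ (1 - Λ) e^μ ξ`. -/
def omegaVec (Λ : L →ₗ[ℝ] L) (μ : L →L[ℂ] L) (ξ : L) : L :=
  (2 * (2 + bCoeff μ ξ)⁻¹) • (NormedSpace.exp μ ξ - Λ (NormedSpace.exp μ ξ))

/-- The pair operator of a rank two map is a product of two annihilators. It has square zero and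
commutes with K^, so its exponential splits off as a linear factor. -/
theorem lowerExp_sub_rankTwo {K : L →ₗ[ℝ] L} (h : IsHS ζ K) (c : ℝ) (η ρ : L)
    (hψ : ψ ∈ upTo ι N) : lowerExp ζ (K - c • rankTwo η ρ) 0 ψ =
      lowerExp ζ K 0 ψ - (c : ℂ) • annih ζ η (annih ζ ρ (lowerExp ζ K 0 ψ)) := by
  have hr : IsHS ζ (rankTwo η ρ) := isHS_rankTwo η ρ
  set T := pairN N hr with hT
  have hTv : ∀ v, incl ι N (T v) = annih ζ η (annih ζ ρ (incl ι N v)) := fun v => by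
    rw [hT, incl_pairN, hatPair_rankTwo]
  have hTT : T * T = 0 := by
    ext v
    refine incl_injective ?_
    rw [mul_apply_eq_comp, hTv, hTv]
    exact congrArg (fun A : Fock ι →L[ℂ] Fock ι => A (incl ι N v))
      (mul_self_pairA (ζ := ζ) (e := fun _ : Unit => η) (f := fun _ : Unit => ρ) ())
  have hcomm : Commute (pairN N h) T := by
    refine ContinuousLinearMap.ext fun v => incl_injective ?_
    rw [mul_apply_eq_comp, mul_apply_eq_comp, incl_pairN, hTv, hTv, incl_pairN,
      h.hatPair_annih _ (annih_mem_upTo ζ _ (incl_mem v)), h.hatPair_annih _ (incl_mem v)]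
  have e1 : pairN N (h.sub (hr.smul c)) = (-(c : ℂ)) • T + pairN N h := by
    refine ContinuousLinearMap.ext fun v => incl_injective ?_
    rw [add_apply, smul_apply, map_add, _root_.map_smul, incl_pairN, incl_pairN, incl_pairN,
      h.sub_hatPair (hr.smul c) (incl_mem v), hr.smul_hatPair c (incl_mem v)]
    module
  rw [← incl_toSector ψ hψ, lowerExp_zero_incl (h.sub (hr.smul c)), e1,
    exp_add_of_commute (hcomm.symm.smul_left _),
    exp_of_mul_self_eq_zero (by rw [smul_mul_smul_comm, hTT, smul_zero]), mul_apply_eq_comp,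
    add_apply, one_apply_eq_self, smul_apply, map_add, _root_.map_smul, hTv, lowerExp_zero_incl h]
  module

/-- Identifies the outer factors of `IsMu.factorization`, combined with e^(K^) for K = e^μ Λ, as one
exponential; this is where Ω and ω come from. -/
theorem IsMu.lowerExp_omega (hμ : IsMu Λ μ) (h : IsXi Λ) (ξ : L) {c : ℂ} (hc : c = bCoeff μ ξ / 2)
    (hψ : ψ ∈ upTo ι N) : lowerExp ζ (omegaL Λ μ ξ) (omegaVec Λ μ ξ) ψ =
      vecFactor ζ μ Λ ξ c (lowerExp ζ (expComp μ Λ) 0 ψ) := by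
  have hK := hμ.isHS_expComp (ζ := ζ) h
  have e0 : ((2 + bReal μ ξ : ℝ)⁻¹ : ℂ) = (1 + c)⁻¹ * (1 / 2) := by
    rw [hc, bCoeff_eq hμ.isSelfAdjoint, one_div, ← mul_inv]
    push_cast
    congr 1
    ring
  have e1 : hatVec ζ (omegaVec Λ μ ξ) = (1 + c)⁻¹ • (hatVec ζ (NormedSpace.exp μ ξ)
      - hatVec ζ (NormedSpace.exp μ (Λ ξ))) := by
    rw [omegaVec, hatVec_smul, hatVec_sub, hμ.comm]
    congr 1
    have : (2 : ℂ) + bCoeff μ ξ = 2 * (1 + c) := by rw [hc]; ring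
    rw [this, mul_inv, ← mul_assoc, mul_inv_cancel₀ two_ne_zero, one_mul]
  rw [(hμ.isHS_omegaL h ξ).lowerExp_eq _ hψ, omegaL, lowerExp_sub_rankTwo hK _ _ _ hψ, e1]
  set χ := lowerExp ζ (expComp μ Λ) 0 ψ
  have e2 : (((2 + bReal μ ξ)⁻¹ : ℝ) : ℂ) • annih ζ (NormedSpace.exp μ ξ)
      (annih ζ (NormedSpace.exp μ (Λ ξ)) χ) = (1 + c)⁻¹ • (hatVec ζ (NormedSpace.exp μ ξ) *
        hatVec ζ (NormedSpace.exp μ (Λ ξ))) χ := by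
    rw [← mul_apply_eq_comp, annih_mul_annih_eq, smul_apply, smul_smul]
    congr 1
    rw [Complex.ofReal_inv, e0]
    ring
  rw [e2]
  have h1 : ∀ (A B : Fock ι →L[ℂ] Fock ι), Commute A B → (χ - A χ) + B (χ - A χ) =
      ((1 - A) * (1 + B)) χ := fun A B hAB => by
    have : (1 - A) * (1 + B) = (1 + B) * (1 - A) :=
      ((Commute.one_right _).add_right ((Commute.one_left B).sub_left hAB)).eq
    rw [this]
    rfl
  refine h1 ((1 + c)⁻¹ • _) _ (Commute.smul_left (Commute.smul_right ?_ _) _)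
  have h2 : ∀ x y z : L, Commute (hatVec ζ x * hatVec ζ y) (hatVec ζ z) := fun x y z => by
    change hatVec ζ x * hatVec ζ y * hatVec ζ z = hatVec ζ z * (hatVec ζ x * hatVec ζ y)
    rw [mul_assoc, hatVec_mul_hatVec y z, mul_neg, ← mul_assoc, hatVec_mul_hatVec x z, neg_mul,
      neg_neg, mul_assoc]
  exact (h2 _ _ _).sub_right (h2 _ _ _)

/-- The exponential `e^(Λ^† + ξ^†)`. -/
def upperExp (ζ : HilbertBasis ι ℂ L) (Λ : L →ₗ[ℝ] L) (ξ : L) (ψ : Fock ι) : Fock ι :=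
  expOp (fun ψ => hatPairDag ζ Λ ψ + hatVecDag ζ ξ ψ) ψ

theorem IsHS.hatPairDag_hatVecDag (h : IsHS ζ Λ) (ξ : L) (hψ : ψ ∈ upTo ι N) :
    hatPairDag ζ Λ (hatVecDag ζ ξ ψ) = hatVecDag ζ ξ (hatPairDag ζ Λ ψ) := by
  rw [hatVecDag_eq, smul_apply, h.hatPairDag_smul _ (create_mem_upTo ζ ξ hψ),
    h.hatPairDag_create ξ hψ]
  rfl

theorem IsHS.iterate_hatVecDag (h : IsHS ζ Λ) (ξ : L) (hψ : ψ ∈ upTo ι N) (n : ℕ) :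
    (hatPairDag ζ Λ)^[n] (hatVecDag ζ ξ ψ) = hatVecDag ζ ξ ((hatPairDag ζ Λ)^[n] ψ) := by
  induction n with
  | zero => rfl
  | succ n ih =>
    rw [Function.iterate_succ_apply', ih, h.hatPairDag_hatVecDag ξ (h.iterate_mem_upTo hψ n),
      Function.iterate_succ_apply']

/-- As ξ^† commutes with Λ^† and has square zero, only terms of degree at most one in it survive in
the powers, so e^(Λ^† + ξ^†) = e^(Λ^†) (1 + ξ^†). The comparison is made vector by vector because
Λ^† may be unbounded. -/
theorem IsXi.upperExp_eq (h : IsXi Λ) (ξ : L) (hψ : ψ ∈ upTo ι N) :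
    upperExp ζ Λ ξ ψ = expOp (hatPairDag ζ Λ) (ψ + hatVecDag ζ ξ ψ) := by
  have hX := h.isHS (ζ := ζ)
  set t := hatVecDag ζ ξ with ht
  have htt : ∀ χ, t (t χ) = 0 := fun χ => by
    rw [ht, ← mul_apply_eq_comp, hatVecDag_mul_self]; rfl
  have hn : ∀ n : ℕ, (fun ψ => hatPairDag ζ Λ ψ + t ψ)^[n + 1] ψ =
      (hatPairDag ζ Λ)^[n + 1] ψ + (n + 1 : ℂ) • t ((hatPairDag ζ Λ)^[n] ψ) := by
    intro n
    induction n with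
    | zero => simp
    | succ n ih =>
      have hm := hX.iterate_mem_upTo hψ n
      have hm1 := upTo_mono (Nat.le_succ _) (hX.iterate_mem_upTo hψ (n + 1))
      have hm2 : (n + 1 : ℂ) • t ((hatPairDag ζ Λ)^[n] ψ) ∈ upTo ι (N + 2 * n + 1) :=
        Submodule.smul_mem _ _ (hatVecDag_mem_upTo ξ hm)
      rw [Function.iterate_succ_apply', ih, hX.hatPairDag_add hm1 (upTo_mono (by omega) hm2),
        hX.hatPairDag_smul _ (hatVecDag_mem_upTo ξ hm), hX.hatPairDag_hatVecDag ξ hm, map_add,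
        _root_.map_smul, htt, Function.iterate_succ_apply' (hatPairDag ζ Λ) (n + 1), Function.iterate_succ_apply' (hatPairDag ζ Λ) n]
      push_cast
      module
  have h1 := (h.summable_expOp (ζ := ζ) hψ).hasSum
  have h2 := (h.summable_expOp (ζ := ζ) (hatVecDag_mem_upTo (ζ := ζ) ξ hψ)).hasSum
  rw [h.expOp_add (upTo_mono N.le_succ hψ) (hatVecDag_mem_upTo ξ hψ)]
  have e2 := ((hasSum_nat_add_iff' 1).2 h1).add h2
  have e3 : HasSum (fun n : ℕ => (((n + 1).factorial : ℂ)⁻¹) • (fun ψ => hatPairDag ζ Λ ψ + t ψ)^[n + 1] ψ) _ :=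
    Eq.mpr (congrArg (fun u => HasSum u _) (funext fun n => ?_)) e2
  · have e4 := (hasSum_nat_add_iff (f := fun n : ℕ =>
      ((n.factorial : ℂ)⁻¹) • (fun ψ => hatPairDag ζ Λ ψ + t ψ)^[n] ψ) 1).1 e3
    refine e4.tsum_eq.trans ?_
    simp only [Finset.range_one, Finset.sum_singleton, Nat.factorial_zero, Function.iterate_zero,
      id, expOp]
    abel
  · rw [hn, smul_add, hX.iterate_hatVecDag ξ hψ, smul_smul]
    congr 2
    rw [Nat.factorial_succ]
    push_cast
    have : ((n : ℂ) + 1) ≠ 0 := by exact_mod_cast n.succ_ne_zero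
    have h' : (n.factorial : ℂ) ≠ 0 := by exact_mod_cast n.factorial_ne_zero
    field_simp

/-- The Gram matrix of the vectors `e^(Λ^† + ξ^†) ψ`. -/
theorem IsMu.inner_upperExp (hμ : IsMu Λ μ) (h : IsXi Λ) (ξ : L) (hψ : ψ ∈ upTo ι N)
    (hφ : φ ∈ upTo ι N) :
    inner ℂ (upperExp ζ Λ ξ ψ) (upperExp ζ Λ ξ φ) =
      inner ℂ (lowerExp ζ (omegaL Λ μ ξ) (omegaVec Λ μ ξ) ψ)
        (((NormedSpace.exp (hatCurrent ζ (nuOp Λ μ ξ))).adjoint *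
          NormedSpace.exp (hatCurrent ζ (betaOp μ ξ)) * NormedSpace.exp (hatCurrent ζ μ) *
          NormedSpace.exp (hatCurrent ζ (nuOp Λ μ ξ)))
          (lowerExp ζ (omegaL Λ μ ξ) (omegaVec Λ μ ξ) φ)) := by
  have hK := hμ.isHS_expComp (ζ := ζ) h
  have h1 : ∀ {χ : Fock ι}, χ ∈ upTo ι N → χ + hatVecDag ζ ξ χ ∈ upTo ι (N + 1) := fun hχ =>
    Submodule.add_mem _ (upTo_mono N.le_succ hχ) (hatVecDag_mem_upTo ξ hχ)
  -- Passing e^(K^), K = e^μ Λ, through the creator ξ^† produces the additional annihilator -(K ξ)^.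
  have h2 : ∀ {χ : Fock ι}, χ ∈ upTo ι N → lowerExp ζ (expComp μ Λ) 0 (χ + hatVecDag ζ ξ χ) =
      (1 + hatVecDag ζ ξ - hatVec ζ (NormedSpace.exp μ (Λ ξ)))
        (lowerExp ζ (expComp μ Λ) 0 χ) := fun {χ} hχ => by
    rw [hK.lowerExp_add 0 (upTo_mono N.le_succ hχ) (hatVecDag_mem_upTo ξ hχ), hatVecDag_eq,
      smul_apply, hK.lowerExp_smul 0 (create_mem_upTo ζ ξ hχ), hK.lowerExp_create ξ hχ, smul_sub]
    simp only [sub_apply, add_apply, one_apply_eq_self, smul_apply, hatVec, expComp_apply]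
    abel
  have h3 := hμ.inner_expOp (ζ := ζ) h (toSector _ (h1 hψ)) (toSector _ (h1 hφ))
  rw [← lowerExp_zero_incl hK, ← lowerExp_zero_incl hK, incl_toSector, incl_toSector, h2 hψ, h2 hφ,
    ← adjoint_inner_right, ← mul_apply_eq_comp, ← mul_apply_eq_comp, hμ.factorization ζ h ξ rfl,
    ← h.upperExp_eq ξ hψ, ← h.upperExp_eq ξ hφ] at h3
  rw [h3, hμ.lowerExp_omega h ξ rfl hψ, hμ.lowerExp_omega h ξ rfl hφ, mul_apply_eq_comp,
    mul_apply_eq_comp, adjoint_inner_right]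

end Gram

/-! ### Irreducibility and density of the range of e^(Λ^†). -/

section Density

variable {ι : Type*} [LinearOrder ι]

theorem single_insert {i : ι} {S : Finset ι} (hi : i ∉ S) :
    (lp.single 2 (insert i S) (1 : ℂ) : Fock ι) =
      sgn i S • (modeAnnih i).adjoint (lp.single 2 S (1 : ℂ)) := by
  refine Subtype.ext (funext fun T => ?_)
  rw [lp.coeFn_smul, Pi.smul_apply, modeCreate_apply]
  by_cases hT : T = insert i S
  · subst hT
    simp [sgn_insert i i S hi, sgn_mul_self, hi]
  · by_cases h : i ∈ T
    · have : T.erase i ≠ S := fun e => hT (by rw [← e, Finset.insert_erase h])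
      simp [hT, h, this]
    · simp [hT, h]

theorem hasSum_coeff (ψ : Fock ι) :
    HasSum (fun S => (ψ : Finset ι → ℂ) S • (lp.single 2 S (1 : ℂ) : Fock ι)) ψ := by
  refine Eq.mpr (congrArg (fun u => HasSum u _) (funext fun S => ?_))
    (lp.hasSum_single (by norm_num) ψ)
  rw [← lp.single_smul]
  simp

variable (ι) in
/-- The subspace of vectors with finitely many particles. -/
def finiteSub : Submodule ℂ (Fock ι) where
  carrier := finiteParticle ι
  add_mem' := by
    rintro a b ⟨m, hm⟩ ⟨n, hn⟩
    exact ⟨max m n, Submodule.add_mem (upTo ι (max m n)) (upTo_mono (le_max_left m n) hm)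
      (upTo_mono (le_max_right m n) hn)⟩
  zero_mem' := ⟨0, (upTo ι 0).zero_mem⟩
  smul_mem' := by
    rintro c a ⟨m, hm⟩
    exact ⟨m, (upTo ι m).smul_mem c hm⟩

theorem dense_finiteParticle : Dense (finiteParticle ι) := fun ψ => by
  refine mem_closure_of_tendsto (hasSum_coeff ψ) (Eventually.of_forall fun F => ?_)
  exact Submodule.sum_mem (finiteSub ι) fun S _ => Submodule.smul_mem _ _
    ⟨S.card, single_mem_upTo S le_rfl 1⟩

theorem exists_common_upTo {ψ φ : Fock ι} (hψ : ψ ∈ finiteParticle ι)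
    (hφ : φ ∈ finiteParticle ι) : ∃ N, ψ ∈ upTo ι N ∧ φ ∈ upTo ι N := by
  obtain ⟨m, hm⟩ := hψ
  obtain ⟨n, hn⟩ := hφ
  exact ⟨max m n, upTo_mono (le_max_left m n) hm, upTo_mono (le_max_right m n) hn⟩

theorem eq_of_forall_inner_finiteParticle {A B : Fock ι →L[ℂ] Fock ι}
    (h : ∀ ψ ∈ finiteParticle ι, ∀ φ ∈ finiteParticle ι, inner ℂ ψ (A φ) = inner ℂ ψ (B φ)) :
    A = B := by
  have h1 : ∀ φ ∈ finiteParticle ι, A φ = B φ := fun φ hφ => by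
    refine ext_inner_left ℂ fun ψ => ?_
    exact isClosed_property (p := fun ψ => inner ℂ ψ (A φ) = inner ℂ ψ (B φ))
      (e := ((↑) : finiteParticle ι → Fock ι)) dense_finiteParticle.denseRange_val
      (isClosed_eq (continuous_id.inner continuous_const) (continuous_id.inner continuous_const))
      (fun ψ => h ψ ψ.2 φ hφ) ψ
  refine ContinuousLinearMap.ext fun φ => ?_
  exact isClosed_property (p := fun φ => A φ = B φ)
    (e := ((↑) : finiteParticle ι → Fock ι)) dense_finiteParticle.denseRange_val
    (isClosed_eq A.continuous B.continuous) (fun φ => h1 φ φ.2) φ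

/-- A bounded operator on a sector is determined by its values on the occupation number basis. -/
theorem sector_eq_zero {N : ℕ} {E : Type*} [NormedAddCommGroup E] [NormedSpace ℂ E]
    (Z : Sector ι N →L[ℂ] E)
    (h : ∀ (S : Finset ι) (hS : S.card ≤ N), Z (toSector _ (single_mem_upTo S hS 1)) = 0)
    (v : Sector ι N) : Z v = 0 := by
  classical
  have h1 := hasSum_coeff (incl ι N v)
  set w : Finset ι → Sector ι N := fun S => if hS : S.card ≤ N then
    (incl ι N v : Finset ι → ℂ) S • toSector _ (single_mem_upTo S hS 1) else 0 with hw
  have h2 : ∀ S, incl ι N (w S) =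
      (incl ι N v : Finset ι → ℂ) S • (lp.single 2 S (1 : ℂ) : Fock ι) := fun S => by
    by_cases hS : S.card ≤ N
    · rw [hw]
      simp only [hS, dite_true]
      rw [_root_.map_smul, incl_toSector]
    · rw [hw]
      simp only [hS, dite_false]
      rw [map_zero, incl_mem v S (not_le.1 hS), zero_smul]
  have h3 : HasSum w v := by
    rw [HasSum, tendsto_iff_norm_sub_tendsto_zero]
    have h4 := tendsto_iff_norm_sub_tendsto_zero.1 h1
    refine h4.congr fun F => ?_
    rw [← norm_incl, map_sub, map_sum]
    simp only [h2]
  refine (h3.mapL Z).unique ?_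
  refine Eq.mpr (congrArg (fun u => HasSum u _) (funext fun S => ?_)) hasSum_zero
  by_cases hS : S.card ≤ N
  · rw [hw]
    simp only [hS, dite_true]
    rw [_root_.map_smul, h S hS, smul_zero]
  · rw [hw]
    simp only [hS, dite_false, map_zero]

variable {L : Type*} [NormedAddCommGroup L] [InnerProductSpace ℂ L] {ζ : HilbertBasis ι ℂ L}

/-- Irreducibility of the canonical anticommutation relations: a subspace which is invariant under
all creation and annihilation operators and orthogonal to a vector with a vacuum component is
trivial. -/
theorem eq_bot_of_invariant {K : Submodule ℂ (Fock ι)} (ha : ∀ i, ∀ z ∈ K, modeAnnih i z ∈ K)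
    (hc : ∀ i, ∀ z ∈ K, (modeAnnih i).adjoint z ∈ K) {y : Fock ι}
    (hy : (y : Finset ι → ℂ) ∅ ≠ 0) (hK : ∀ z ∈ K, inner ℂ z y = 0) : K = ⊥ := by
  classical
  -- The product of annihilator and creator of the mode i is the projection to the configurations
  -- without i; these are applied for all i in F.
  have h1 : ∀ z ∈ K, ∀ F : Finset ι, ∃ χ ∈ K, ∀ S : Finset ι, (χ : Finset ι → ℂ) S =
      if Disjoint S F then (z : Finset ι → ℂ) S else 0 := by
    intro z hz F
    induction F using Finset.induction_on with
    | empty => exact ⟨z, hz, fun S => by simp⟩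
    | insert i F _ ih =>
      obtain ⟨χ, hχ, hχS⟩ := ih
      refine ⟨_, ha i _ (hc i χ hχ), fun S => ?_⟩
      rw [modeAnnih_apply, modeCreate_apply]
      by_cases hi : i ∈ S
      · simp [hi, Finset.disjoint_insert_right]
      · simp only [hi, if_false, Finset.mem_insert_self, if_true, Finset.erase_insert hi,
          Finset.disjoint_insert_right, not_false_eq_true, true_and, ← hχS]
        rw [sgn_insert i i S hi, if_neg (lt_irrefl i), one_mul, ← mul_assoc, sgn_mul_self, one_mul]
  -- As F exhausts the modes only the empty configuration survives, so the product of the vacuum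
  -- components of z and y vanishes.
  have h2 : ∀ z ∈ K, (z : Finset ι → ℂ) ∅ = 0 := by
    intro z hz
    have hs : Summable fun S => ‖inner ℂ ((z : Finset ι → ℂ) S) ((y : Finset ι → ℂ) S)‖ :=
      (lp.summable_inner (𝕜 := ℂ) z y).norm
    have hlim := tendsto_tsum_of_dominated_convergence (𝓕 := (atTop : Filter (Finset ι)))
      (f := fun F S => if Disjoint S F then
        inner ℂ ((z : Finset ι → ℂ) S) ((y : Finset ι → ℂ) S) else 0)
      (g := fun S => if S = ∅ then inner ℂ ((z : Finset ι → ℂ) ∅) ((y : Finset ι → ℂ) ∅) else 0)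
      hs (fun S => by
        by_cases hS : S = ∅
        · simp [hS]
        · obtain ⟨i, hi⟩ := Finset.nonempty_iff_ne_empty.2 hS
          rw [if_neg hS]
          refine tendsto_const_nhds.congr' ((eventually_ge_atTop {i}).mono fun F hF => ?_)
          exact (if_neg fun hd => Finset.disjoint_left.1 hd hi
            (hF (Finset.mem_singleton_self i))).symm)
      (Eventually.of_forall fun F S => by
        split_ifs
        · exact le_rfl
        · rw [norm_zero]
          exact norm_nonneg _)
    have h0 : ∀ F : Finset ι, ∑' S, (if Disjoint S F then
        inner ℂ ((z : Finset ι → ℂ) S) ((y : Finset ι → ℂ) S) else 0) = 0 := fun F => by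
      obtain ⟨χ, hχ, hχS⟩ := h1 z hz F
      refine Eq.trans ?_ ((lp.inner_eq_tsum (𝕜 := ℂ) χ y).symm.trans (hK χ hχ))
      refine tsum_congr fun S => ?_
      rw [hχS]
      split_ifs
      · rfl
      · rw [inner_zero_left]
    simp only [h0] at hlim
    rw [tsum_ite_eq] at hlim
    have h3 := tendsto_nhds_unique hlim tendsto_const_nhds
    have h4 : (y : Finset ι → ℂ) ∅ * starRingEnd ℂ ((z : Finset ι → ℂ) ∅) = 0 := h3
    simpa [hy] using h4
  -- A coefficient at `insert i S` is, up to sign, the coefficient at S after annihilating the mode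
  -- i, and K is invariant under that.
  have h3 : ∀ S : Finset ι, ∀ z ∈ K, (z : Finset ι → ℂ) S = 0 := by
    intro S
    induction S using Finset.induction_on with
    | empty => exact h2
    | insert i S hi ih =>
      intro z hz
      have h4 := ih _ (ha i z hz)
      rw [modeAnnih_apply, if_neg hi] at h4
      refine (mul_eq_zero.1 h4).resolve_left fun h5 => ?_
      have := sgn_mul_self i S
      rw [h5, mul_zero] at this
      exact zero_ne_one this
  rw [eq_bot_iff]
  intro z hz
  exact (Submodule.mem_bot ℂ).2 (Subtype.ext (funext fun S => h3 S z hz))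

variable [CompleteSpace L] {Λ : L →ₗ[ℝ] L}

theorem IsXi.expOp_vac_empty (h : IsXi Λ) :
    (expOp (hatPairDag ζ Λ) (vac ι) : Finset ι → ℂ) ∅ = 1 := by
  have hX := h.isHS (ζ := ζ)
  rw [coeff_eq_inner]
  have h1 := ((h.summable_expOp (ζ := ζ) (vac_mem_upTo 0)).hasSum).mapL (innerSL ℂ (vac ι))
  refine h1.unique ?_
  refine Eq.mpr (congrArg (fun u => HasSum u _) (funext fun n => ?_)) (hasSum_ite_eq 0 (1 : ℂ))
  rw [innerSL_apply_apply, inner_smul_right]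
  cases n with
  | zero =>
    rw [if_pos rfl, Function.iterate_zero, id, inner_vac_vac, mul_one, Nat.factorial_zero,
      Nat.cast_one, inv_one]
  | succ n =>
    have h2 := (hX.hasSum_pairDag (hX.iterate_mem_upTo (vac_mem_upTo 0) n)).mapL (innerSL ℂ (vac ι))
    have h3 : inner ℂ (vac ι) (hatPairDag ζ Λ ((hatPairDag ζ Λ)^[n] (vac ι))) = (0 : ℂ) := by
      refine h2.unique ?_
      simp
    rw [Function.iterate_succ_apply', h3]
    simp

/-- The vectors `e^(Λ^†) ψ` span a dense subspace. -/
theorem IsXi.eq_zero_of_forall_inner_expOp (h : IsXi Λ) {z : Fock ι}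
    (hz : ∀ ψ ∈ finiteParticle ι, inner ℂ z (expOp (hatPairDag ζ Λ) ψ) = 0) : z = 0 := by
  let K : Submodule ℂ (Fock ι) :=
    { carrier := {z | ∀ ψ ∈ finiteParticle ι, inner ℂ z (expOp (hatPairDag ζ Λ) ψ) = 0}
      add_mem' := fun {a b} ha hb ψ hψ => by rw [inner_add_left, ha ψ hψ, hb ψ hψ, add_zero]
      zero_mem' := fun ψ _ => inner_zero_left _
      smul_mem' := fun c a ha ψ hψ => by rw [inner_smul_left, ha ψ hψ, mul_zero] }
  have hK : K = ⊥ := by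
    refine eq_bot_of_invariant (y := expOp (hatPairDag ζ Λ) (vac ι)) ?_ ?_ ?_ ?_
    · rintro i z hz ψ ⟨N, hψ⟩
      rw [← annih_basis ζ, ← adjoint_inner_right, adjoint_annih, ← h.expOp_create hψ]
      exact hz _ ⟨N + 1, create_mem_upTo ζ _ hψ⟩
    · rintro i z hz ψ ⟨N, hψ⟩
      have h1 := h.expOp_annih (ζ := ζ) hψ (ζ i)
      rw [← h.expOp_create hψ] at h1
      rw [← annih_basis ζ, adjoint_inner_left, eq_sub_of_add_eq h1.symm, inner_sub_right,
        hz _ ⟨N, annih_mem_upTo ζ _ hψ⟩, hz _ ⟨N + 1, create_mem_upTo ζ _ hψ⟩, sub_zero]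
    · rw [h.expOp_vac_empty]
      exact one_ne_zero
    · exact fun z hz => hz _ ⟨0, vac_mem_upTo 0⟩
  have : z ∈ K := hz
  rwa [hK, Submodule.mem_bot] at this

end Density

/-! ### Implementation of canonical transformations by e^(r^) e^(s^). -/

section Intertwining

variable {ι : Type*} [LinearOrder ι] {L : Type*} [NormedAddCommGroup L] [InnerProductSpace ℂ L]
  {ζ : HilbertBasis ι ℂ L}

theorem exp_hatCurrent_mul_create [CompleteSpace L] {l : L →L[ℂ] L} (hl : IsTraceClass l) (v : L) :
    NormedSpace.exp (hatCurrent ζ l) * create ζ v =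
      create ζ (NormedSpace.exp l.adjoint v) * NormedSpace.exp (hatCurrent ζ l) := by
  have h1 : star (NormedSpace.exp (hatCurrent ζ l.adjoint)) = NormedSpace.exp (hatCurrent ζ l) := by
    rw [hatCurrent_adjoint ζ hl, ← ContinuousLinearMap.star_eq_adjoint, ← NormedSpace.star_exp,
      star_star]
  have h2 := congrArg star (exp_hatCurrent_mul_annih ζ hl.adjoint (NormedSpace.exp l.adjoint v))
  rw [star_mul, star_mul, h1, exp_neg_exp_apply] at h2
  exact h2.symm

/-- Implementation of a linear canonical transformation by a bounded operator. -/
structure Implements (ζ : HilbertBasis ι ℂ L) (Q : Fock ι →L[ℂ] Fock ι) (q p : L →L[ℂ] L) : Prop where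
  mul_annih : ∀ v, Q * annih ζ v = annih ζ (q v) * Q
  mul_create : ∀ v, Q * create ζ v = create ζ (p v) * Q
  inner_map : ∀ v w, inner ℂ (p v) (q w) = inner ℂ v w
  surjective : Function.Surjective p
  map_vac : ∃ c : ℂ, c ≠ 0 ∧ Q (vac ι) = c • vac ι
  mem_upTo : ∀ N, ∀ ψ ∈ upTo ι N, Q ψ ∈ upTo ι N

variable {Q : Fock ι →L[ℂ] Fock ι} {q p : L →L[ℂ] L} {Λ Ω : L →ₗ[ℝ] L} {N : ℕ} {ψ : Fock ι}

theorem Implements.apply_annih (hQ : Implements ζ Q q p) (v : L) (ψ : Fock ι) :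
    Q (annih ζ v ψ) = annih ζ (q v) (Q ψ) := by
  rw [← mul_apply_eq_comp, hQ.mul_annih, mul_apply_eq_comp]

theorem Implements.apply_create (hQ : Implements ζ Q q p) (v : L) (ψ : Fock ι) :
    Q (create ζ v ψ) = create ζ (p v) (Q ψ) := by
  rw [← mul_apply_eq_comp, hQ.mul_create, mul_apply_eq_comp]

/-- The restriction of an implementer to a sector. -/
def Implements.sector (hQ : Implements ζ Q q p) (N : ℕ) : Sector ι N →L[ℂ] Sector ι N :=
  sectorRestrict Q (hQ.mem_upTo N)

theorem Implements.incl_sector (hQ : Implements ζ Q q p) (v : Sector ι N) :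
    incl ι N (hQ.sector N v) = Q (incl ι N v) := rfl

/-- Both sides vanish on the vacuum and change by the same rule when a particle is created; the
relation between Ω and Λ matches the contraction terms. -/
theorem Implements.hatPair_single (hQ : Implements ζ Q q p) (hΛ : IsHS ζ Λ) (hΩ : IsHS ζ Ω)
    (h : ∀ v, Ω (p v) = -q (Λ v)) (S : Finset ι) :
    hatPair ζ Ω (Q (lp.single 2 S (1 : ℂ))) = -Q (hatPair ζ Λ (lp.single 2 S (1 : ℂ))) := by
  induction S using Finset.induction_on with
  | empty =>
    obtain ⟨c, -, hc⟩ := hQ.map_vac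
    change hatPair ζ Ω (Q (vac ι)) = -Q (hatPair ζ Λ (vac ι))
    rw [hc, hΩ.hatPair_smul c (vac_mem_upTo 0), hΩ.hatPair_vac, hΛ.hatPair_vac, smul_zero, map_zero,
      neg_zero]
  | insert i S hi ih =>
    have hS : (lp.single 2 S (1 : ℂ) : Fock ι) ∈ upTo ι S.card := single_mem_upTo S le_rfl 1
    have hQS := hQ.mem_upTo _ _ hS
    rw [single_insert hi, ← annih_basis ζ, adjoint_annih, _root_.map_smul, hQ.apply_create,
      hΩ.hatPair_smul _ (create_mem_upTo ζ _ hQS), hΩ.hatPair_create _ hQS, ih,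
      hΛ.hatPair_smul _ (create_mem_upTo ζ _ hS), hΛ.hatPair_create _ hS, _root_.map_smul, map_sub,
      hQ.apply_create, hQ.apply_annih, h, annih_neg, neg_apply, map_neg]
    module

theorem Implements.hatPair_apply (hQ : Implements ζ Q q p) (hΛ : IsHS ζ Λ) (hΩ : IsHS ζ Ω)
    (h : ∀ v, Ω (p v) = -q (Λ v)) (hψ : ψ ∈ upTo ι N) :
    hatPair ζ Ω (Q ψ) = -Q (hatPair ζ Λ ψ) := by
  have h1 := sector_eq_zero (incl ι N ∘L (pairN N hΩ * hQ.sector N + hQ.sector N * pairN N hΛ))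
    (fun S hS => by
      rw [comp_apply, add_apply, map_add, mul_apply_eq_comp, mul_apply_eq_comp, incl_pairN,
        hQ.incl_sector, hQ.incl_sector, incl_pairN, incl_toSector,
        hQ.hatPair_single hΛ hΩ h, neg_add_cancel]) (toSector ψ hψ)
  rw [comp_apply, add_apply, map_add, mul_apply_eq_comp, mul_apply_eq_comp, incl_pairN,
    hQ.incl_sector, hQ.incl_sector, incl_pairN, incl_toSector] at h1
  exact eq_neg_of_add_eq_zero_left h1

theorem Implements.lowerExp_apply (hQ : Implements ζ Q q p) (hΛ : IsHS ζ Λ) (hΩ : IsHS ζ Ω)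
    (h : ∀ v, Ω (p v) = -q (Λ v)) {ξ ω : L} (hω : ω = -q ξ) (hψ : ψ ∈ upTo ι N) :
    lowerExp ζ Ω ω (Q ψ) = Q (lowerExp ζ (-Λ) (-ξ) ψ) := by
  have h1 := exp_comp_of_semiconj (T := hQ.sector N) (k := pairN N hΛ.neg + vecN ζ N (-ξ))
    (l := pairN N hΩ + vecN ζ N ω) (fun v => incl_injective (by
      rw [add_apply, map_add, incl_pairN, incl_vecN, hQ.incl_sector, hQ.incl_sector, add_apply,
        map_add, incl_pairN, incl_vecN, hQ.hatPair_apply hΛ hΩ h (incl_mem v),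
        hΛ.neg_hatPair (incl_mem v), map_add, map_neg, hatVec, hatVec, smul_apply, smul_apply,
        _root_.map_smul, hQ.apply_annih, hω, map_neg])) (toSector ψ hψ)
  have h2 := congrArg (incl ι N) h1
  rw [← lowerExp_incl hΩ, hQ.incl_sector, hQ.incl_sector, ← lowerExp_incl hΛ.neg,
    incl_toSector] at h2
  exact h2

/-- The vacuum matrix elements determine the canonical transformation. -/
theorem Implements.of_vacuum (hQ : Implements ζ Q q p) (hΛ : IsHS ζ Λ) (hΩ : IsHS ζ Ω) {ξ ω : L}
    {k : ℂ} (h : ∀ χ ∈ finiteParticle ι, k * inner ℂ (vac ι) (lowerExp ζ Ω ω (Q χ)) =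
      inner ℂ (vac ι) (lowerExp ζ (-Λ) (-ξ) χ)) :
    (∀ v, Ω (p v) = -q (Λ v)) ∧ ω = -q ξ := by
  obtain ⟨c, hc, hv⟩ := hQ.map_vac
  -- The vacuum itself fixes the normalization k c = 1; two-particle and one-particle vectors then
  -- determine Ω and ω.
  have hvac := h (vac ι) ⟨0, vac_mem_upTo 0⟩
  rw [hv, hΩ.lowerExp_smul ω (vac_mem_upTo 0), hΩ.lowerExp_vac, hΛ.neg.lowerExp_vac,
    inner_smul_right, inner_vac_vac, mul_one] at hvac
  refine ⟨fun α => ?_, ?_⟩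
  · refine ext_inner_left ℂ fun w => ?_
    obtain ⟨γ, rfl⟩ := hQ.surjective w
    have h1 := h (create ζ α (create ζ γ (vac ι)))
      ⟨2, create_mem_upTo ζ _ (create_mem_upTo ζ _ (vac_mem_upTo 0))⟩
    rw [hQ.apply_create, hQ.apply_create, hv, _root_.map_smul, _root_.map_smul,
      hΩ.lowerExp_smul ω (create_mem_upTo ζ _ (create_mem_upTo ζ _ (vac_mem_upTo 0))),
      inner_smul_right, hΩ.inner_vac_lowerExp_create_create, ← mul_assoc, hvac, one_mul,
      hΛ.neg.inner_vac_lowerExp_create_create, LinearMap.neg_apply, inner_neg_right, neg_neg] at h1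
    rw [inner_neg_right, hQ.inner_map, ← h1, neg_neg]
  · refine ext_inner_left ℂ fun w => ?_
    obtain ⟨α, rfl⟩ := hQ.surjective w
    have h1 := h (create ζ α (vac ι)) ⟨1, create_mem_upTo ζ _ (vac_mem_upTo 0)⟩
    rw [hQ.apply_create, hv, _root_.map_smul,
      hΩ.lowerExp_smul ω (create_mem_upTo ζ _ (vac_mem_upTo 0)), inner_smul_right,
      hΩ.inner_vac_lowerExp_create, ← mul_assoc, hvac, one_mul,
      hΛ.neg.inner_vac_lowerExp_create] at h1
    have h2 : ((1 / Real.sqrt 2 : ℝ) : ℂ) ≠ 0 := Complex.ofReal_ne_zero.2 (by positivity)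
    rw [inner_neg_right, hQ.inner_map, ← inner_neg_right]
    exact mul_left_cancel₀ h2 h1

end Intertwining

/-! ### Extension of isometries to unitary operators. -/

section Unitary

variable {ι : Type*} [LinearOrder ι]

/-- An isometric linear map on the vectors with finitely many particles, whose range is dense,
extends to a unitary operator. -/
theorem exists_unitary_of_inner_map (g : finiteSub ι →ₗ[ℂ] Fock ι)
    (hg : ∀ x y : finiteSub ι, inner ℂ (g x) (g y) = inner ℂ (x : Fock ι) y)
    (hd : ∀ z : Fock ι, (∀ x, inner ℂ z (g x) = 0) → z = 0) :
    ∃ U ∈ unitary (Fock ι →L[ℂ] Fock ι), ∀ x : finiteSub ι, g x = U x := by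
  have hn : ∀ x : finiteSub ι, ‖g x‖ ≤ 1 * ‖(finiteSub ι).subtype x‖ := fun x => by
    have h1 := hg x x
    rw [inner_self_eq_norm_sq_to_K, inner_self_eq_norm_sq_to_K] at h1
    have h2 : ‖g x‖ ^ 2 = ‖(x : Fock ι)‖ ^ 2 := by exact_mod_cast h1
    rw [one_mul]
    exact le_of_pow_le_pow_left₀ two_ne_zero (norm_nonneg _) h2.le
  have hdense : DenseRange (finiteSub ι).subtype := by
    have := (dense_finiteParticle (ι := ι)).denseRange_val
    exact this
  set U := g.extendOfNorm (finiteSub ι).subtype with hU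
  have hUg : ∀ x : finiteSub ι, U x = g x := fun x => LinearMap.extendOfNorm_eq hdense ⟨1, hn⟩ x
  have h1 : star U * U = 1 := by
    refine eq_of_forall_inner_finiteParticle fun ψ hψ φ hφ => ?_
    rw [mul_apply_eq_comp, ContinuousLinearMap.star_eq_adjoint, adjoint_inner_right,
      one_apply_eq_self]
    exact (congrArg₂ (inner ℂ) (hUg ⟨ψ, hψ⟩) (hUg ⟨φ, hφ⟩)).trans (hg ⟨ψ, hψ⟩ ⟨φ, hφ⟩)
  have h2 : ∀ z, star U z = 0 → z = 0 := fun z hz => hd z fun x => by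
    rw [← hUg, ← adjoint_inner_left, ← ContinuousLinearMap.star_eq_adjoint, hz, inner_zero_left]
  refine ⟨U, Unitary.mem_iff.2 ⟨h1, ContinuousLinearMap.ext fun z => ?_⟩, fun x => (hUg x).symm⟩
  -- The adjoint of U is injective as U has dense range, and it annihilates U U* z - z.
  refine sub_eq_zero.1 (h2 _ ?_)
  have h3 : star U (U (star U z)) = star U z := by
    rw [← mul_apply_eq_comp, h1, one_apply_eq_self]
  rw [map_sub, mul_apply_eq_comp, h3, one_apply_eq_self, sub_self]

end Unitary

/-! ### Exponentials of currents as implementers. -/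

section Currents

variable {ι : Type*} [LinearOrder ι] {L : Type*} [NormedAddCommGroup L] [InnerProductSpace ℂ L]
  {ζ : HilbertBasis ι ℂ L} {l r s : L →L[ℂ] L} {N : ℕ} {ψ : Fock ι}

theorem isTraceClass_zero : IsTraceClass (0 : L →L[ℂ] L) := by
  simpa using isTraceClass_smul_rankOne (0 : ℂ) (0 : L) 0

theorem isXi_zero : IsXi (0 : L →ₗ[ℝ] L) :=
  ⟨fun ξ τ => by simp, 0, fun v => by simp, isTraceClass_zero⟩

theorem hatCurrent_neg (ζ : HilbertBasis ι ℂ L) (l : L →L[ℂ] L) :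
    hatCurrent ζ (-l) = -hatCurrent ζ l := by
  rw [hatCurrent, hatCurrent, ← tsum_neg]
  refine tsum_congr fun i => ?_
  rw [neg_apply, annih_neg, mul_neg, neg_mul, ← smul_neg]
  congr 1
  abel

theorem hatCurrent_zero (ζ : HilbertBasis ι ℂ L) : hatCurrent ζ 0 = 0 := by
  simp [hatCurrent, annih_zero]

theorem hatPair_zero (ζ : HilbertBasis ι ℂ L) (ψ : Fock ι) : hatPair ζ 0 ψ = 0 := by
  simp [hatPair, annih_zero]

theorem hatPairDag_zero (ζ : HilbertBasis ι ℂ L) (ψ : Fock ι) : hatPairDag ζ 0 ψ = 0 := by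
  simp [hatPairDag, create_zero]

theorem hatVecDag_zero (ζ : HilbertBasis ι ℂ L) : hatVecDag ζ 0 = 0 := by
  rw [hatVecDag, hatVec_zero, map_zero]

theorem exp_hatCurrent_vac (hl : IsTraceClass l) :
    ∃ c : ℂ, c ≠ 0 ∧ NormedSpace.exp (hatCurrent ζ l) (vac ι) = c • vac ι := by
  obtain ⟨c, hc⟩ := hatCurrent_vac ζ hl
  exact ⟨Complex.exp c, Complex.exp_ne_zero c, exp_apply_of_eigenvector hc⟩

theorem exp_hatCurrent_mem_upTo (hl : IsTraceClass l) (hψ : ψ ∈ upTo ι N) :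
    NormedSpace.exp (hatCurrent ζ l) ψ ∈ upTo ι N :=
  exp_apply_mem (isClosed_upTo N) (fun _ hv => hatCurrent_mem_upTo ζ hl hv) hψ

theorem exp_neg_hatCurrent_mem_upTo (hl : IsTraceClass l) (hψ : ψ ∈ upTo ι N) :
    NormedSpace.exp (-hatCurrent ζ l) ψ ∈ upTo ι N :=
  exp_apply_mem (isClosed_upTo N)
    (fun _ hv => Submodule.neg_mem _ (hatCurrent_mem_upTo ζ hl hv)) hψ

variable [CompleteSpace L]

theorem adjoint_exp_hatCurrent (hl : IsTraceClass l) :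
    (NormedSpace.exp (hatCurrent ζ l)).adjoint = NormedSpace.exp (hatCurrent ζ l.adjoint) := by
  rw [hatCurrent_adjoint ζ hl, ← ContinuousLinearMap.star_eq_adjoint,
    ← ContinuousLinearMap.star_eq_adjoint, NormedSpace.star_exp]

theorem inner_vac_exp_hatCurrent (hl : IsTraceClass l) :
    ∃ c : ℂ, ∀ χ, inner ℂ (vac ι) (NormedSpace.exp (hatCurrent ζ l) χ) = c * inner ℂ (vac ι) χ := by
  obtain ⟨c, -, hc⟩ := exp_hatCurrent_vac (ζ := ζ) hl.adjoint
  refine ⟨starRingEnd ℂ c, fun χ => ?_⟩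
  rw [← adjoint_inner_left, adjoint_exp_hatCurrent hl, hc, inner_smul_left]

/-- Creators transform with the exponentials of the adjoints r* = r and s* = -s, annihilators with
those of -r and -s. Hence p and q differ only in the sign of r and are contragredient to each other.
-/
theorem implements_exp (hr : IsTraceClass r) (hr' : r.adjoint = r) (hs : IsTraceClass s)
    (hs' : s.adjoint = -s) :
    Implements ζ (NormedSpace.exp (hatCurrent ζ r) * NormedSpace.exp (hatCurrent ζ s))
      (NormedSpace.exp (-r) * NormedSpace.exp (-s)) (NormedSpace.exp r * NormedSpace.exp (-s)) where
  mul_annih v := by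
    rw [mul_assoc, exp_hatCurrent_mul_annih ζ hs, ← mul_assoc, exp_hatCurrent_mul_annih ζ hr,
      mul_assoc]
    rfl
  mul_create v := by
    rw [mul_assoc, exp_hatCurrent_mul_create hs, ← mul_assoc, exp_hatCurrent_mul_create hr,
      mul_assoc, hr', hs']
    rfl
  inner_map v w := by
    have h1 : (NormedSpace.exp (-s)).adjoint = NormedSpace.exp s := by
      rw [← ContinuousLinearMap.star_eq_adjoint, NormedSpace.star_exp,
        ContinuousLinearMap.star_eq_adjoint, map_neg, hs', neg_neg]
    have h2 : IsSelfAdjoint r := hr'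
    rw [mul_apply_eq_comp, mul_apply_eq_comp, inner_exp_left h2, exp_exp_neg_apply,
      ← adjoint_inner_right, h1, exp_exp_neg_apply]
  surjective w := ⟨NormedSpace.exp s (NormedSpace.exp (-r) w), by
    rw [mul_apply_eq_comp, exp_neg_exp_apply, exp_exp_neg_apply]⟩
  map_vac := by
    obtain ⟨c, hc, h⟩ := exp_hatCurrent_vac (ζ := ζ) hs
    obtain ⟨d, hd, h'⟩ := exp_hatCurrent_vac (ζ := ζ) hr
    exact ⟨c * d, mul_ne_zero hc hd, by
      rw [mul_apply_eq_comp, h, _root_.map_smul, h', smul_smul]⟩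
  mem_upTo N ψ hψ := exp_hatCurrent_mem_upTo hr (exp_hatCurrent_mem_upTo hs hψ)

end Currents

/-! ### The isometry condition in terms of Q, Ω and ω. -/

section Isometry

variable {ι : Type*} [LinearOrder ι] {L : Type*} [NormedAddCommGroup L] [InnerProductSpace ℂ L]
  {ζ : HilbertBasis ι ℂ L} {Q E : Fock ι →L[ℂ] Fock ι} {q p : L →L[ℂ] L} {Λ Ω : L →ₗ[ℝ] L}

/-- Annihilating exponentials fix the vacuum, Q rescales it, and `hE` makes it a left eigenvector of
E. The isometry relation with ψ the vacuum thus involves vacuum components only and gives both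
intertwining conditions. Under these the product collapses to Q, and Q† E Q = 1 is all that remains.
-/
theorem Implements.isometry_iff (hQ : Implements ζ Q q p) (hΛ : IsHS ζ Λ) (hΩ : IsHS ζ Ω) {ξ ω : L}
    (hE : ∃ d : ℂ, ∀ χ, inner ℂ (vac ι) (E χ) = d * inner ℂ (vac ι) χ) :
    (∀ ψ ∈ finiteParticle ι, ∀ φ ∈ finiteParticle ι,
      inner ℂ (lowerExp ζ Ω ω (Q (lowerExp ζ Λ ξ ψ))) (E (lowerExp ζ Ω ω (Q (lowerExp ζ Λ ξ φ)))) =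
        inner ℂ ψ φ) ↔
      Q.adjoint * E * Q = 1 ∧ (∀ v, Ω (p v) = -q (Λ v)) ∧ ω = -q ξ := by
  have key : (∀ v, Ω (p v) = -q (Λ v)) ∧ ω = -q ξ → ∀ ψ ∈ finiteParticle ι,
      lowerExp ζ Ω ω (Q (lowerExp ζ Λ ξ ψ)) = Q ψ := by
    rintro ⟨h1, h2⟩ ψ ⟨N, hψ⟩
    rw [hQ.lowerExp_apply hΛ hΩ h1 h2 (hΛ.lowerExp_mem_upTo ξ hψ), hΛ.lowerExp_neg_lowerExp ξ hψ]
  constructor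
  · intro h
    obtain ⟨c, -, hc⟩ := hQ.map_vac
    obtain ⟨d, hd⟩ := hE
    have hcond : (∀ v, Ω (p v) = -q (Λ v)) ∧ ω = -q ξ := by
      refine hQ.of_vacuum hΛ hΩ (k := starRingEnd ℂ c * d) fun χ ⟨N, hχ⟩ => ?_
      -- The inverse exponential is inserted so that the factor e^(Λ^ + ξ^) cancels and χ is left
      -- bare.
      have h1 := h (vac ι) ⟨0, vac_mem_upTo 0⟩ (lowerExp ζ (-Λ) (-ξ) χ)
        ⟨N, hΛ.neg.lowerExp_mem_upTo (-ξ) hχ⟩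
      rwa [hΛ.lowerExp_vac, hc, hΩ.lowerExp_smul ω (vac_mem_upTo 0), hΩ.lowerExp_vac,
        hΛ.lowerExp_lowerExp_neg ξ hχ, inner_smul_left, hd, ← mul_assoc] at h1
    refine ⟨eq_of_forall_inner_finiteParticle fun ψ hψ φ hφ => ?_, hcond⟩
    rw [mul_assoc, mul_apply_eq_comp, mul_apply_eq_comp, adjoint_inner_right, one_apply_eq_self,
      ← h ψ hψ φ hφ, key hcond ψ hψ, key hcond φ hφ]
  · rintro ⟨h1, hcond⟩ ψ hψ φ hφ
    rw [key hcond ψ hψ, key hcond φ hφ, ← adjoint_inner_right, ← mul_apply_eq_comp,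
      ← mul_apply_eq_comp, h1, one_apply_eq_self]

end Isometry

/-! ### Membership in the dynamical group. -/

section Group

variable {ι : Type*} [LinearOrder ι] {L : Type*} [NormedAddCommGroup L] [InnerProductSpace ℂ L]
  [CompleteSpace L] {ζ : HilbertBasis ι ℂ L} {r s : L →L[ℂ] L} {Λ Λ' : L →ₗ[ℝ] L} {ξ ξ' : L}

theorem decProduct_apply (ψ : Fock ι) : decProduct ζ Λ ξ r s Λ' ξ' ψ =
    upperExp ζ Λ ξ ((NormedSpace.exp (hatCurrent ζ r) * NormedSpace.exp (hatCurrent ζ s))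
      (lowerExp ζ Λ' ξ' ψ)) := by
  rw [mul_apply_eq_comp, ← expOp_clm, ← expOp_clm]
  rfl

theorem decProduct_mem_algGroup (hr : IsTraceClass r) (hs : IsTraceClass s) (hΛ : IsXi Λ)
    (hΛ' : IsXi Λ') : decProduct ζ Λ ξ r s Λ' ξ' ∈ algGroup ζ := by
  refine ⟨[fun ψ => hatPairDag ζ Λ ψ + hatVecDag ζ ξ ψ, hatCurrent ζ r, hatCurrent ζ s,
    fun ψ => hatPair ζ Λ' ψ + hatVec ζ ξ' ψ], ?_, rfl⟩
  simp only [List.mem_cons, List.not_mem_nil, or_false]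
  rintro X (rfl | rfl | rfl | rfl)
  · refine ⟨0, Λ, 0, ξ, 0, isTraceClass_zero, hΛ, isXi_zero, funext fun ψ => ?_⟩
    simp [hatCurrent_zero, hatPair_zero, hatVec_zero]
  · refine ⟨r, 0, 0, 0, 0, hr, isXi_zero, isXi_zero, funext fun ψ => ?_⟩
    simp [hatPairDag_zero, hatPair_zero, hatVec_zero, hatVecDag_zero]
  · refine ⟨s, 0, 0, 0, 0, hs, isXi_zero, isXi_zero, funext fun ψ => ?_⟩
    simp [hatPairDag_zero, hatPair_zero, hatVec_zero, hatVecDag_zero]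
  · refine ⟨0, 0, Λ', 0, ξ', isTraceClass_zero, isXi_zero, hΛ', funext fun ψ => ?_⟩
    simp [hatCurrent_zero, hatPairDag_zero, hatVecDag_zero]

theorem IsXi.upperExp_add (h : IsXi Λ) {N : ℕ} {ψ φ : Fock ι} (hψ : ψ ∈ upTo ι N)
    (hφ : φ ∈ upTo ι N) : upperExp ζ Λ ξ (ψ + φ) = upperExp ζ Λ ξ ψ + upperExp ζ Λ ξ φ := by
  have h1 : ∀ {χ : Fock ι}, χ ∈ upTo ι N → χ + hatVecDag ζ ξ χ ∈ upTo ι (N + 1) := fun hχ =>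
    Submodule.add_mem _ (upTo_mono N.le_succ hχ) (hatVecDag_mem_upTo ξ hχ)
  rw [h.upperExp_eq ξ (Submodule.add_mem _ hψ hφ), h.upperExp_eq ξ hψ, h.upperExp_eq ξ hφ,
    ← h.expOp_add (h1 hψ) (h1 hφ), map_add]
  congr 1
  abel

theorem IsXi.upperExp_smul (h : IsXi Λ) {N : ℕ} {ψ : Fock ι} (hψ : ψ ∈ upTo ι N) (c : ℂ) :
    upperExp ζ Λ ξ (c • ψ) = c • upperExp ζ Λ ξ ψ := by
  rw [h.upperExp_eq ξ (Submodule.smul_mem _ c hψ), h.upperExp_eq ξ hψ,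
    ← h.expOp_smul (Submodule.add_mem _ (upTo_mono N.le_succ hψ) (hatVecDag_mem_upTo ξ hψ)),
    _root_.map_smul, smul_add]

/-- All factors except e^(Λ^†) are inverted explicitly on vectors with finitely many particles, with
1 - ξ^† inverse to 1 + ξ^†. Hence density of the range of e^(Λ^†) passes to the whole product. -/
theorem exists_decProduct_eq_expOp (hr : IsTraceClass r) (hs : IsTraceClass s) (hΛ : IsXi Λ)
    (hΛ' : IsXi Λ') {N : ℕ} {φ : Fock ι} (hφ : φ ∈ upTo ι N) :
    ∃ ψ ∈ finiteParticle ι, decProduct ζ Λ ξ r s Λ' ξ' ψ = expOp (hatPairDag ζ Λ) φ := by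
  have h2 : φ - hatVecDag ζ ξ φ ∈ upTo ι (N + 1) :=
    Submodule.sub_mem _ (upTo_mono N.le_succ hφ) (hatVecDag_mem_upTo ξ hφ)
  have h3 := exp_neg_hatCurrent_mem_upTo (ζ := ζ) hs
    (exp_neg_hatCurrent_mem_upTo (ζ := ζ) hr h2)
  refine ⟨_, ⟨N + 1, (hΛ'.isHS (ζ := ζ)).neg.lowerExp_mem_upTo (-ξ') h3⟩, ?_⟩
  have h4 : (NormedSpace.exp (hatCurrent ζ r) * NormedSpace.exp (hatCurrent ζ s))
      (NormedSpace.exp (-hatCurrent ζ s) (NormedSpace.exp (-hatCurrent ζ r)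
        (φ - hatVecDag ζ ξ φ))) = φ - hatVecDag ζ ξ φ := by
    rw [mul_apply_eq_comp, exp_exp_neg_apply, exp_exp_neg_apply]
  rw [decProduct_apply, hΛ'.isHS.lowerExp_lowerExp_neg ξ' h3, h4, hΛ.upperExp_eq ξ h2, map_sub,
    ← mul_apply_eq_comp (hatVecDag ζ ξ) (hatVecDag ζ ξ) φ, hatVecDag_mul_self, zero_apply, sub_zero,
    sub_add_cancel]

/-- The product approximates its own extension with error zero, so the only question is whether it
extends to a unitary operator; it does when it is isometric, its range being dense. -/
theorem memDynGroup_decProduct_iff (hr : IsTraceClass r) (hs : IsTraceClass s) (hΛ : IsXi Λ)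
    (hΛ' : IsXi Λ') : MemDynGroup ζ (decProduct ζ Λ ξ r s Λ' ξ') ↔
      ∀ ψ ∈ finiteParticle ι, ∀ φ ∈ finiteParticle ι,
        inner ℂ (decProduct ζ Λ ξ r s Λ' ξ' ψ) (decProduct ζ Λ ξ r s Λ' ξ' φ) = inner ℂ ψ φ := by
  constructor
  · rintro ⟨U, ⟨-, hU⟩, h⟩ ψ hψ φ hφ
    rw [h ψ hψ, h φ hφ, inner_map_map_of_mem_unitary hU]
  · intro h
    have hB := hΛ'.isHS (ζ := ζ)
    set Q := NormedSpace.exp (hatCurrent ζ r) * NormedSpace.exp (hatCurrent ζ s) with hQ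
    have hm : ∀ {N : ℕ} {ψ : Fock ι}, ψ ∈ upTo ι N → Q (lowerExp ζ Λ' ξ' ψ) ∈ upTo ι N :=
      fun hψ => exp_hatCurrent_mem_upTo hr (exp_hatCurrent_mem_upTo hs (hB.lowerExp_mem_upTo ξ' hψ))
    let g : finiteSub ι →ₗ[ℂ] Fock ι :=
      { toFun := fun ψ => decProduct ζ Λ ξ r s Λ' ξ' ψ
        map_add' := by
          rintro ⟨ψ, hψ⟩ ⟨φ, hφ⟩
          obtain ⟨N, h1, h2⟩ := exists_common_upTo hψ hφ
          change decProduct ζ Λ ξ r s Λ' ξ' (ψ + φ) = _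
          simp only [decProduct_apply]
          rw [hB.lowerExp_add ξ' h1 h2, map_add, hΛ.upperExp_add (hm h1) (hm h2)]
        map_smul' := by
          rintro c ⟨ψ, N, h1⟩
          change decProduct ζ Λ ξ r s Λ' ξ' (c • ψ) = _
          simp only [decProduct_apply, RingHom.id_apply]
          rw [hB.lowerExp_smul ξ' h1 c, _root_.map_smul, hΛ.upperExp_smul (hm h1)] }
    obtain ⟨U, hU, hUg⟩ := exists_unitary_of_inner_map g (fun x y => h x x.2 y y.2) (fun z hz => by
      refine hΛ.eq_zero_of_forall_inner_expOp (ζ := ζ) fun φ ⟨N, hφ⟩ => ?_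
      obtain ⟨ψ, hψ, he⟩ := exists_decProduct_eq_expOp (ζ := ζ) (ξ := ξ) (ξ' := ξ') hr hs hΛ hΛ' hφ
      rw [← he]
      exact hz ⟨ψ, hψ⟩)
    have hU' : ∀ ψ ∈ finiteParticle ι, decProduct ζ Λ ξ r s Λ' ξ' ψ = U ψ := fun ψ hψ =>
      hUg ⟨ψ, hψ⟩
    refine ⟨U, ⟨⟨⟨⟨U, star U, (Unitary.mem_iff.1 hU).2, (Unitary.mem_iff.1 hU).1⟩, rfl⟩,
      fun ε hε => ⟨_, decProduct_mem_algGroup (ξ := ξ) (ξ' := ξ') hr hs hΛ hΛ', fun ψ hψ => ?_⟩⟩, hU⟩, hU'⟩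
    rw [hU' ψ hψ, sub_self, norm_zero]
    positivity

/-- The normalization condition for the current part of the decomposition. -/
theorem adjoint_mul_mul_eq_one_iff (hr : IsTraceClass r) (hr' : r.adjoint = r) (hs : IsTraceClass s)
    (hs' : s.adjoint = -s) (E : Fock ι →L[ℂ] Fock ι) :
    (NormedSpace.exp (hatCurrent ζ r) * NormedSpace.exp (hatCurrent ζ s)).adjoint * E *
        (NormedSpace.exp (hatCurrent ζ r) * NormedSpace.exp (hatCurrent ζ s)) = 1 ↔
      NormedSpace.exp (-((2 : ℂ) • hatCurrent ζ r)) = E := by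
  set R := hatCurrent ζ r with hR
  set S := hatCurrent ζ s with hS
  have h1 : (NormedSpace.exp R * NormedSpace.exp S).adjoint =
      NormedSpace.exp (-S) * NormedSpace.exp R := by
    rw [← ContinuousLinearMap.star_eq_adjoint, star_mul, ContinuousLinearMap.star_eq_adjoint,
      ContinuousLinearMap.star_eq_adjoint, hR, hS, adjoint_exp_hatCurrent hr,
      adjoint_exp_hatCurrent hs, hr', hs', hatCurrent_neg]
  have h2 : NormedSpace.exp (-((2 : ℂ) • R)) = NormedSpace.exp (-R) * NormedSpace.exp (-R) := by
    rw [← exp_add_of_commute (Commute.refl _), two_smul, neg_add]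
  rw [h1, h2]
  constructor
  · intro h
    have h3 := congrArg (fun T => NormedSpace.exp (-R) * (NormedSpace.exp S * T *
      NormedSpace.exp (-S)) * NormedSpace.exp (-R)) h
    simp only [mul_one, exp_mul_exp_neg] at h3
    rw [← h3]
    calc _ = (NormedSpace.exp (-R) * (NormedSpace.exp S * NormedSpace.exp (-S)) * NormedSpace.exp R)
          * E * (NormedSpace.exp R * (NormedSpace.exp S * NormedSpace.exp (-S)) *
            NormedSpace.exp (-R)) := by simp only [mul_assoc]
      _ = E := by simp only [exp_mul_exp_neg, exp_neg_mul_exp, mul_one, one_mul]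
  · rintro rfl
    calc _ = NormedSpace.exp (-S) * (NormedSpace.exp R * NormedSpace.exp (-R)) *
          (NormedSpace.exp (-R) * NormedSpace.exp R) * NormedSpace.exp S := by simp only [mul_assoc]
      _ = 1 := by simp only [exp_mul_exp_neg, exp_neg_mul_exp, mul_one]

variable {μ : L →L[ℂ] L}

/-- The vacuum is an eigenvector of exponentials of currents and of their adjoints. -/
theorem IsMu.inner_vac_gram (hμ : IsMu Λ μ) (ξ : L) : ∃ d : ℂ, ∀ χ, inner ℂ (vac ι)
    (((NormedSpace.exp (hatCurrent ζ (nuOp Λ μ ξ))).adjoint *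
      NormedSpace.exp (hatCurrent ζ (betaOp μ ξ)) * NormedSpace.exp (hatCurrent ζ μ) *
      NormedSpace.exp (hatCurrent ζ (nuOp Λ μ ξ))) χ) = d * inner ℂ (vac ι) χ := by
  have hν : IsTraceClass (nuOp Λ μ ξ) := isTraceClass_smul_rankOne _ _ _
  obtain ⟨c₁, -, h₁⟩ := exp_hatCurrent_vac (ζ := ζ) hν
  obtain ⟨c₂, h₂⟩ := inner_vac_exp_hatCurrent (ζ := ζ) (isBeta_betaOp hμ.isSelfAdjoint ξ).traceClass
  obtain ⟨c₃, h₃⟩ := inner_vac_exp_hatCurrent (ζ := ζ) hμ.traceClass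
  obtain ⟨c₄, h₄⟩ := inner_vac_exp_hatCurrent (ζ := ζ) hν
  refine ⟨starRingEnd ℂ c₁ * (c₂ * (c₃ * c₄)), fun χ => ?_⟩
  rw [mul_apply_eq_comp, mul_apply_eq_comp, mul_apply_eq_comp, adjoint_inner_right, h₁,
    inner_smul_left, h₂, h₃, h₄]
  ring

theorem IsMu.memDynGroup_iff (hμ : IsMu Λ μ) (hr : IsTraceClass r) (hr' : r.adjoint = r)
    (hs : IsTraceClass s) (hs' : s.adjoint = -s) (hΛ : IsXi Λ) (hΛ' : IsXi Λ') :
    MemDynGroup ζ (decProduct ζ Λ ξ r s Λ' ξ') ↔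
      NormedSpace.exp (-((2 : ℂ) • hatCurrent ζ r)) =
          NormedSpace.exp (hatCurrent ζ (nuOp Λ μ ξ)).adjoint *
            NormedSpace.exp (hatCurrent ζ (betaOp μ ξ)) * NormedSpace.exp (hatCurrent ζ μ) *
            NormedSpace.exp (hatCurrent ζ (nuOp Λ μ ξ)) ∧
      (∀ η, Λ' η = -NormedSpace.exp s (NormedSpace.exp r
          (omegaMap Λ μ ξ (NormedSpace.exp r (NormedSpace.exp (-s) η))))) ∧
      ξ' = -((2 * (2 + bCoeff μ ξ)⁻¹) • NormedSpace.exp s (NormedSpace.exp r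
          (NormedSpace.exp μ ξ - Λ (NormedSpace.exp μ ξ)))) := by
  have hQ := implements_exp (ζ := ζ) hr hr' hs hs'
  have hB := hΛ'.isHS (ζ := ζ)
  -- Inverting q solves the intertwining conditions for Λ' and ξ'.
  have hinv : ∀ v w : L, w = -(NormedSpace.exp (-r) * NormedSpace.exp (-s)) v ↔
      v = -NormedSpace.exp s (NormedSpace.exp r w) := fun v w => by
    rw [mul_apply_eq_comp]
    constructor
    · rintro rfl
      rw [map_neg, map_neg, neg_neg, exp_exp_neg_apply, exp_exp_neg_apply]
    · rintro rfl
      rw [map_neg, map_neg, neg_neg, exp_neg_exp_apply, exp_neg_exp_apply]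
  have hstar : NormedSpace.exp (hatCurrent ζ (nuOp Λ μ ξ)).adjoint =
      (NormedSpace.exp (hatCurrent ζ (nuOp Λ μ ξ))).adjoint := by
    rw [← ContinuousLinearMap.star_eq_adjoint, ← ContinuousLinearMap.star_eq_adjoint,
      NormedSpace.star_exp]
  have hiso := hQ.isometry_iff (ξ := ξ') (ω := omegaVec Λ μ ξ) hB (hμ.isHS_omegaL hΛ ξ)
    (hμ.inner_vac_gram (ζ := ζ) ξ)
  rw [adjoint_mul_mul_eq_one_iff hr hr' hs hs'] at hiso
  rw [memDynGroup_decProduct_iff hr hs hΛ hΛ', hstar]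
  refine Iff.trans (forall₄_congr fun ψ hψ φ hφ => ?_) (hiso.trans (and_congr_right' ?_))
  · obtain ⟨N, h1, h2⟩ := exists_common_upTo hψ hφ
    rw [decProduct_apply, decProduct_apply, hμ.inner_upperExp (ζ := ζ) hΛ ξ
      (hQ.mem_upTo N _ (hB.lowerExp_mem_upTo ξ' h1)) (hQ.mem_upTo N _ (hB.lowerExp_mem_upTo ξ' h2))]
  · refine and_congr (forall_congr' fun η => ?_) ?_
    · rw [hinv, mul_apply_eq_comp, omegaL_apply hμ.isSelfAdjoint]
    · rw [hinv, omegaVec, _root_.map_smul, _root_.map_smul]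

end Group

end FermiFock
end

theorem mainTheorem2 {L : Type*} [NormedAddCommGroup L] [InnerProductSpace ℂ L] [CompleteSpace L]
    [TopologicalSpace.SeparableSpace L] {ι : Type*} [LinearOrder ι] (ζ : HilbertBasis ι ℂ L)
    (r s : L →L[ℂ] L) (hr : IsTraceClass r) (hr' : r.adjoint = r)
    (hs : IsTraceClass s) (hs' : s.adjoint = -s)
    (Λ Λ' : L →ₗ[ℝ] L) (hΛ : IsXi Λ) (hΛ' : IsXi Λ') (ξ ξ' : L) :
    (∃! μ : L →L[ℂ] L, IsMu Λ μ) ∧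
    ∀ μ : L →L[ℂ] L, IsMu Λ μ →
      (∃! β : L →L[ℂ] L, IsBeta μ ξ β) ∧ IsTraceClass (nuOp Λ μ ξ) ∧
      ∀ β : L →L[ℂ] L, IsBeta μ ξ β →
        (MemDynGroup ζ (decProduct ζ Λ ξ r s Λ' ξ') ↔
          NormedSpace.exp (-((2 : ℂ) • hatCurrent ζ r)) =
              NormedSpace.exp (hatCurrent ζ (nuOp Λ μ ξ)).adjoint *
                NormedSpace.exp (hatCurrent ζ β) * NormedSpace.exp (hatCurrent ζ μ) *
                NormedSpace.exp (hatCurrent ζ (nuOp Λ μ ξ)) ∧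
          (∀ η, Λ' η = -NormedSpace.exp s (NormedSpace.exp r
              (omegaMap Λ μ ξ (NormedSpace.exp r (NormedSpace.exp (-s) η))))) ∧
          ξ' = -((2 * (2 + bCoeff μ ξ)⁻¹) • NormedSpace.exp s (NormedSpace.exp r
              (NormedSpace.exp μ ξ - Λ (NormedSpace.exp μ ξ))))) := by
  refine ⟨existsUnique_isMu ζ hΛ, fun μ hμ => ⟨existsUnique_isBeta hμ.isSelfAdjoint ξ,
    isTraceClass_smul_rankOne _ _ _, fun β hβ => ?_⟩⟩
  -- By uniqueness β may be taken in the closed form in which its exponential was computed.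
  rw [hβ.ext hμ.isSelfAdjoint (isBeta_betaOp hμ.isSelfAdjoint ξ)]
  exact hμ.memDynGroup_iff hr hr' hs hs' hΛ hΛ'
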